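/- Let $(M,g)$ be a smooth oriented Riemannian manifold of dimension $d$ (Hausdorff, second countable, without boundary). Let $\Omega^\bullet(M)=\bigoplus_{k=0}^d\Omega^k(M)$ be the space of smooth complex differential forms, let $*$ be the Hodge star operator, let $\mathrm d^*=(-1)^{d(k+1)+1}*\mathrm d*$ on $\Omega^k(M)$ for $k\ge 1$ and $\mathrm d^*=0$ on $\Omega^0(M)$, and let $D=\mathrm d+\mathrm d^*$ be the Hodge–Dirac operator. For a smooth function $f\colon M\to\mathbb C$ let $M_f\omega=f\omega$ and $[D,M_f]=DM_f-M_fD$. The gradient of $f=u+iv$ ($u,v$ real) is the complex vector field $\nabla f=\nabla u+i\nabla v$, and $i_{\nabla f}=i_{\nabla u}+i\,i_{\nabla v}$ is the interior product. For $1\le p<\infty$, $\mathrm L^p(\Omega^\bullet(M))$ is the space of measurable complex forms $\omega=\sum_k\omega_k$ modulo equality almost everywhere with $$\|\omega\|_{\mathrm L^p}=\Big(\int_M\Big(\sum_{k=0}^d|\omega_k(x)|^2\Big)^{p/2}\,d\mathrm{vol}_g(x)\Big)^{1/p}<\infty,$$ where $|\cdot|$ is the Hermitian norm on $\Lambda^k\mathrm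 T_x^*M\otimes\mathbb C$ induced by $g$, and $\|\mathrm df\|_\infty=\operatorname{ess\,sup}_{x\in M}|\mathrm df(x)|$. 1. For every smooth $f\colon M\to\mathbb C$ and every $\omega\in\Omega^\bullet(M)$, $$[D,M_f]\,\omega=\mathrm df\wedge\omega-i_{\nabla f}\,\omega .$$ 2. Let $1\le p<\infty$ and let $f\colon M\to\mathbb C$ be smooth with $\|\mathrm df\|_\infty<\infty$. Then $[D,M_f]$ extends to a bounded operator $C$ on $\mathrm L^p(\Omega^\bullet(M))$: for every smooth $\omega\in\mathrm L^p(\Omega^\bullet(M))$ one has $[D,M_f]\omega\in\mathrm L^p(\Omega^\bullet(M))$ and $C\omega=[D,M_f]\omega$. The operator $C$ is the only bounded operator that agrees with $[D,M_f]$ on the smooth forms with compact support. If $f$ is moreover real-valued, then $$\|C\|_{\mathrm L^p(\Omega^\bullet(M))\to\mathrm L^p(\Omega^\bullet(M))}=\|\mathrm df\|_{\infty}.$$ -/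

import Mathlib

open Set Filter MeasureTheory Bundle Manifold
open scoped ContDiff Topology ENNReal Nat RealInnerProductSpace

noncomputable section

namespace HodgeDirac

/-! ### Multilinear algebra on one tangent space -/

/-- Complex-valued alternating `k`-forms on a real vector space `V`. -/
abbrev CForm (V : Type*) [AddCommGroup V] [Module ℝ V] [TopologicalSpace V] (k : ℕ) : Type _ :=
  V [⋀^Fin k]→L[ℝ] ℂ

section Fibre

variable {V : Type*} [NormedAddCommGroup V] [InnerProductSpace ℝ V] [FiniteDimensional ℝ V]

/-- An alternating map on a finite-dimensional space is continuous. -/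
def CForm.ofAlternating {k : ℕ} (α : V [⋀^Fin k]→ₗ[ℝ] ℂ) : CForm V k :=
  { α with
    cont := by
      let b := Module.finBasis ℝ V
      have h : (α : (Fin k → V) → ℂ) = fun v => ∑ t : Fin k → Fin (Module.finrank ℝ V),
          (∏ j, b.repr (v j) (t j)) • α (fun j => b (t j)) := by
        funext v
        have hv : v = fun j => ∑ i, b.repr (v j) i • b i := by
          funext j; exact (b.sum_repr (v j)).symm
        conv_lhs => rw [hv]
        exact (α.toMultilinearMap.map_sum (fun j i => b.repr (v j) i • b i)).trans
          (Finset.sum_congr rfl fun t _ =>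
            α.toMultilinearMap.map_smul_univ (fun j => b.repr (v j) (t j)) (fun j => b (t j)))
      change Continuous (α : (Fin k → V) → ℂ)
      rw [h]
      have hc (t : Fin k → Fin (Module.finrank ℝ V)) :
          Continuous fun v : Fin k → V => ∏ j, b.repr (v j) (t j) :=
        continuous_finsetProd _ fun j _ =>
          (LinearMap.continuous_of_finiteDimensional (b.coord (t j))).comp (continuous_apply j)
      exact continuous_finsetSum _ fun t _ => (hc t).smul continuous_const }

/-- The exterior product of a `k`-form and an `l`-form, as a form of degree `m = k + l`. -/
def wedge {k l m : ℕ} (h : k + l = m) (α : CForm V k) (β : CForm V l) : CForm V m :=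
  CForm.ofAlternating
    (((LinearMap.mul' ℝ ℂ).compAlternatingMap
      (α.toAlternatingMap.domCoprod β.toAlternatingMap)).domDomCongr
        (finSumFinEquiv.trans (finCongr h)))

/-- The interior product `i_v η = η(v, ·, …, ·)`. -/
def interiorProd (v : V) {k : ℕ} (η : CForm V (k + 1)) : CForm V k :=
  CForm.ofAlternating (η.toAlternatingMap.curryLeft v)

/-- The `ℂ`-bilinear extension of the inner product on `Λ^k V^*` that is induced by that of `V`,
`⟨u₁ ∧ ⋯ ∧ u_k, v₁ ∧ ⋯ ∧ v_k⟩ = det ⟨u_i, v_j⟩`. In an orthonormal basis `e` it is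
`(1 / k!) ∑ α(e_{t₁}, …, e_{t_k}) β(e_{t₁}, …, e_{t_k})`, the sum running over all `k`-tuples of
indices. -/
def pairing {k : ℕ} (α β : CForm V k) : ℂ :=
  (k ! : ℂ)⁻¹ * ∑ t : Fin k → Fin (Module.finrank ℝ V),
    α (fun j => stdOrthonormalBasis ℝ V (t j)) * β (fun j => stdOrthonormalBasis ℝ V (t j))

/-- The square of the norm of a complex `k`-form, for the Hermitian extension of the same inner
product. -/
def normSqForm {k : ℕ} (α : CForm V k) : ℝ :=
  (k ! : ℝ)⁻¹ * ∑ t : Fin k → Fin (Module.finrank ℝ V),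
    ‖α (fun j => stdOrthonormalBasis ℝ V (t j))‖ ^ 2

/-- The norm of a complex `k`-form. -/
def normForm {k : ℕ} (α : CForm V k) : ℝ := √(normSqForm α)

/-- The norm on `⨁ₖ Λ^k V^*`: the `ℓ²`-sum over the degrees `0, …, dim V`. -/
def normGraded (α : ∀ k, CForm V k) : ℝ :=
  √(∑ k ∈ Finset.range (Module.finrank ℝ V + 1), normSqForm (α k))

/-- The volume form of an oriented Euclidean space, as a complex form. -/
def volForm {d : ℕ} [Fact (Module.finrank ℝ V = d)] (o : Orientation ℝ V (Fin d)) : CForm V d :=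
  CForm.ofAlternating (Complex.ofRealCLM.toLinearMap.compAlternatingMap o.volumeForm)

/-- `γ` is the Hodge dual of `β`: `α ∧ γ = ⟨α, β⟩ vol` for all `α` of the degree of `β`. -/
def IsHodgeDual {d : ℕ} [Fact (Module.finrank ℝ V = d)] (o : Orientation ℝ V (Fin d)) {k l : ℕ}
    (h : k + l = d) (β : CForm V k) (γ : CForm V l) : Prop :=
  ∀ α : CForm V k, wedge h α γ = pairing α β • volForm o

/-- The Hodge star operator `Λ^k V^* → Λ^l V^*`, `k + l = dim V`: the form `⋆β` is the one that
satisfies `α ∧ ⋆β = ⟨α, β⟩ vol` for all `α`. -/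
def hodgeStar {d : ℕ} [Fact (Module.finrank ℝ V = d)] (o : Orientation ℝ V (Fin d)) {k l : ℕ}
    (h : k + l = d) (β : CForm V k) : CForm V l :=
  Classical.epsilon (IsHodgeDual o h β)

/-- The normalized components of a form in an orthonormal basis. -/
def comps : (∀ k, CForm V k) →ₗ[ℂ]
    EuclideanSpace ℂ (Σ k : Fin (Module.finrank ℝ V + 1), Fin k → Fin (Module.finrank ℝ V)) where
  toFun α := WithLp.toLp 2 fun i =>
    ((√(((i.1 : ℕ)! : ℝ)⁻¹) : ℝ) : ℂ) * α i.1 (fun j => stdOrthonormalBasis ℝ V (i.2 j))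
  map_add' α β := by ext i; simp [mul_add]
  map_smul' c α := by ext i; simp [mul_left_comm]

theorem normGraded_eq (α : ∀ k, CForm V k) : normGraded α = ‖comps α‖ := by
  rw [EuclideanSpace.norm_eq, Fintype.sum_sigma, normGraded, Finset.sum_range]
  congr 1
  refine Finset.sum_congr rfl fun k _ => ?_
  rw [normSqForm, Finset.mul_sum]
  refine Finset.sum_congr rfl fun t _ => ?_
  have h : (0 : ℝ) ≤ (((k : ℕ)! : ℝ)⁻¹) := by positivity
  simp only [comps, LinearMap.coe_mk, AddHom.coe_mk, norm_mul, mul_pow, Complex.norm_real,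
    Real.norm_eq_abs, sq_abs, Real.sq_sqrt h]

/-- The norm of a form in terms of an arbitrary basis, through the inverse of its Gram matrix. -/
theorem normSqForm_eq_gram {n k : ℕ} (b : Module.Basis (Fin n) ℝ V)
    (α : CForm V k) :
    normSqForm α = (k ! : ℝ)⁻¹ * ∑ s : Fin k → Fin n, ∑ s' : Fin k → Fin n,
      (∏ j, (Matrix.of fun i l => inner ℝ (b i) (b l))⁻¹ (s j) (s' j)) *
        (α (fun j => b (s j)) * star (α fun j => b (s' j))).re := by
  set e := stdOrthonormalBasis ℝ V
  set A : Matrix (Fin (Module.finrank ℝ V)) (Fin n) ℝ := Matrix.of fun i j => b.repr (e i) j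
  have hn : Module.finrank ℝ V = n := by simpa using Module.finrank_eq_card_basis b
  have hA : (Matrix.of fun i l => (inner ℝ (b i) (b l) : ℝ))⁻¹ = A.transpose * A := by
    set B : Matrix (Fin n) (Fin (Module.finrank ℝ V)) ℝ := Matrix.of fun i j => e.repr (b i) j
    have hG : (Matrix.of fun i l => (inner ℝ (b i) (b l) : ℝ)) = B * B.transpose := by
      ext i l
      rw [Matrix.of_apply, Matrix.mul_apply, ← e.sum_inner_mul_inner]
      refine Finset.sum_congr rfl fun m _ => ?_
      simp [B, e.repr_apply_apply, real_inner_comm]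
    have hAB : A * B = 1 := by
      ext i l
      have := congrArg (fun v => e.repr v l) (b.sum_repr (e i))
      simp only [map_sum, map_smul] at this
      simpa [Matrix.mul_apply, A, B, Matrix.one_apply, PiLp.single_apply, eq_comm] using this
    have hBA : B * A = 1 := (Matrix.mul_eq_one_comm_of_card_eq _ _ _ (by simp [hn])).1 hAB
    refine Matrix.inv_eq_right_inv ?_
    rw [hG, Matrix.mul_assoc, ← Matrix.mul_assoc B.transpose, ← Matrix.transpose_mul, hAB]
    simpa using hBA
  rw [hA, show normSqForm α = (k ! : ℝ)⁻¹ * ∑ t : Fin k → Fin (Module.finrank ℝ V),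
    ‖α (fun j => e (t j))‖ ^ 2 from rfl]
  congr 1
  have hexp (t : Fin k → Fin (Module.finrank ℝ V)) : α (fun j => e (t j)) =
      ∑ s : Fin k → Fin n, (∏ j, A (t j) (s j)) • α (fun j => b (s j)) := by
    have hv : (fun j => e (t j)) = fun j => ∑ i, A (t j) i • b i := by
      funext j; exact (b.sum_repr (e (t j))).symm
    rw [hv]
    exact (α.toMultilinearMap.map_sum (fun j i => A (t j) i • b i)).trans
      (Finset.sum_congr rfl fun s _ =>
        α.toMultilinearMap.map_smul_univ (fun j => A (t j) (s j)) (fun j => b (s j)))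
  have hsq (z : ℂ) : ‖z‖ ^ 2 = (z * star z).re := by
    simp [← Complex.normSq_eq_norm_sq, Complex.mul_conj]
  have hterm (t : Fin k → Fin (Module.finrank ℝ V)) : ‖α (fun j => e (t j))‖ ^ 2 =
      ∑ s : Fin k → Fin n, ∑ s' : Fin k → Fin n, (∏ j, A (t j) (s j) * A (t j) (s' j)) *
        (α (fun j => b (s j)) * star (α fun j => b (s' j))).re := by
    rw [hsq, hexp, star_sum, Finset.sum_mul_sum, Complex.re_sum]
    refine Finset.sum_congr rfl fun s _ => ?_
    rw [Complex.re_sum]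
    refine Finset.sum_congr rfl fun s' _ => ?_
    rw [Finset.prod_mul_distrib, star_smul, smul_mul_smul_comm, Complex.smul_re]
    simp
  rw [Finset.sum_congr rfl fun t _ => hterm t]
  rw [Finset.sum_comm]
  refine Finset.sum_congr rfl fun s _ => ?_
  rw [Finset.sum_comm]
  refine Finset.sum_congr rfl fun s' _ => ?_
  rw [← Finset.sum_mul]
  congr 1
  exact ((Finset.prod_congr rfl fun j _ => Matrix.mul_apply).trans
    (Fintype.prod_sum fun j i => A i (s j) * A i (s' j))).symm
end Fibre

/-! ### Differential forms on a Riemannian manifold -/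

section Forms

variable {d : ℕ} {M : Type*} [TopologicalSpace M] [ChartedSpace (EuclideanSpace ℝ (Fin d)) M]

variable (d) in
/-- The tangent space at `x` of a manifold of dimension `d`. -/
abbrev TSpace (x : M) : Type := TangentSpace (𝓡 d) x

variable (d M) in
/-- Sections of the bundle of complex `k`-forms (no regularity). -/
abbrev KForm (k : ℕ) : Type _ := ∀ x : M, CForm (TSpace d x) k

variable (d M) in
/-- Sections of the bundle of complex forms of all degrees (no regularity); the components of
degree greater than `d` vanish automatically. -/
abbrev Form : Type _ := ∀ k : ℕ, KForm d M k

/-- The local expression of a `k`-form in the chart at `x₀`: its pull-back by the inverse of this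
chart. -/
def inChart (x₀ : M) {k : ℕ} (η : KForm d M k) (y : EuclideanSpace ℝ (Fin d)) :
    CForm (EuclideanSpace ℝ (Fin d)) k :=
  (η ((extChartAt (𝓡 d) x₀).symm y)).compContinuousLinearMap
    (mfderiv 𝓘(ℝ, EuclideanSpace ℝ (Fin d)) (𝓡 d) (extChartAt (𝓡 d) x₀).symm y)

/-- Smooth forms: the local expressions in the charts are smooth. -/
def IsSmooth (η : Form d M) : Prop :=
  ∀ k : ℕ, ∀ x₀ : M, ContDiffOn ℝ ∞ (inChart x₀ (η k)) (extChartAt (𝓡 d) x₀).target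

/-- The exterior derivative, computed at `x` in the chart at `x`. -/
def extD {k : ℕ} (η : KForm d M k) : KForm d M (k + 1) := fun x =>
  (extDeriv (inChart x η) (extChartAt (𝓡 d) x x)).compContinuousLinearMap
    (mfderiv (𝓡 d) 𝓘(ℝ, EuclideanSpace ℝ (Fin d)) (extChartAt (𝓡 d) x) x)

/-- The differential of a complex function at `x`, as a complex `1`-form. -/
def diff (f : M → ℂ) : KForm d M 1 := fun x =>
  ContinuousAlternatingMap.ofSubsingleton ℝ (TSpace d x) ℂ (0 : Fin 1)
    (mfderiv (𝓡 d) 𝓘(ℝ, ℂ) f x : TSpace d x →L[ℝ] ℂ)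

/-- The multiplication operator `M_f`. -/
def mulOp (f : M → ℂ) (η : Form d M) : Form d M := fun k x => f x • η k x

/-- The `i`-th coordinate vector field of the chart at `x₀`, at the point `x` of its source. -/
def coordField (x₀ : M) (i : Fin d) (x : M) : TSpace d x :=
  mfderiv 𝓘(ℝ, EuclideanSpace ℝ (Fin d)) (𝓡 d) (extChartAt (𝓡 d) x₀).symm
    (extChartAt (𝓡 d) x₀ x) (EuclideanSpace.single i (1 : ℝ))

theorem coordField_eq_localFrame [IsManifold (𝓡 d) 1 M] (x₀ : M) (i : Fin d) {x : M}
    (hx : x ∈ (chartAt (EuclideanSpace ℝ (Fin d)) x₀).source) :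
    coordField x₀ i x = (trivializationAt (EuclideanSpace ℝ (Fin d)) (TangentSpace (𝓡 d)) x₀).basisAt
      (EuclideanSpace.basisFun (Fin d) ℝ).toBasis hx i := by
  have h := TangentBundle.symmL_trivializationAt (I := 𝓡 d) hx
  have h2 := congrArg (fun L => L (EuclideanSpace.single i (1 : ℝ))) h
  simp only [modelWithCornersSelf_coe, Set.range_id, mfderivWithin_univ] at h2
  rw [coordField]
  refine h2.symm.trans ?_
  simp only [Bundle.Trivialization.basisAt, Module.Basis.map_apply,
    OrthonormalBasis.coe_toBasis, EuclideanSpace.basisFun_apply]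
  exact (trivializationAt (EuclideanSpace ℝ (Fin d)) (TangentSpace (𝓡 d)) x₀).symmₗ_apply hx _

variable [RiemannianBundle (fun x : M => TangentSpace (𝓡 d) x)]

instance instFiniteDimensionalTangent (x : M) : FiniteDimensional ℝ (TSpace d x) :=
  inferInstanceAs (FiniteDimensional ℝ (EuclideanSpace ℝ (Fin d)))

instance instFactFinrankTangent (x : M) : Fact (Module.finrank ℝ (TSpace d x) = d) :=
  ⟨(finrank_euclideanSpace_fin : Module.finrank ℝ (EuclideanSpace ℝ (Fin d)) = d)⟩

/-- The gradient of a real function: `⟨∇u(x), v⟩ = du(x) v`. -/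
def grad (u : M → ℝ) (x : M) : TSpace d x :=
  (InnerProductSpace.toDual ℝ (TSpace d x)).symm (mfderiv (𝓡 d) 𝓘(ℝ, ℝ) u x : TSpace d x →L[ℝ] ℝ)

variable (d M) in
/-- A choice of an orientation of every tangent space that is locally constant in the
trivializations of the tangent bundle, that is, an orientation of the manifold. -/
structure TangentOrientation [IsManifold (𝓡 d) 1 M] where
  /-- The orientation of the tangent space at `x`. -/
  orient : ∀ x : M, Orientation ℝ (TSpace d x) (Fin d)
  locallyConstant : ∀ x₀ : M, ∃ s : Orientation ℝ (EuclideanSpace ℝ (Fin d)) (Fin d),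
    ∀ᶠ x in 𝓝 x₀,
      ∀ hx : x ∈ (trivializationAt (EuclideanSpace ℝ (Fin d)) (TangentSpace (𝓡 d)) x₀).baseSet,
        Orientation.map (Fin d) ((trivializationAt (EuclideanSpace ℝ (Fin d)) (TangentSpace (𝓡 d))
          x₀).continuousLinearEquivAt ℝ x hx).toLinearEquiv (orient x) = s

/-- The interior product of `η` with the gradient of the complex function `f`. For `f = u + i v`
with real `u`, `v` the gradient is the complex vector field `∇u + i ∇v`, and the interior product is
complex linear in the vector field; it vanishes on `0`-forms. -/
def interiorGrad (f : M → ℂ) (η : Form d M) : Form d M := fun k x =>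
  interiorProd (grad (fun y => (f y).re) x) (η (k + 1) x) +
    Complex.I • interiorProd (grad (fun y => (f y).im) x) (η (k + 1) x)

/-- The exterior product `df ∧ η`. -/
def wedgeDiff (f : M → ℂ) (η : Form d M) : Form d M
  | 0 => 0
  | k + 1 => fun x => wedge (Nat.add_comm 1 k) (diff f x) (η k x)

section Oriented

variable [IsManifold (𝓡 d) 1 M]

/-- The codifferential on forms of degree `k + 1`, `d^* = (-1)^{d((k+1)+1)+1} ⋆ d ⋆`. -/
def coD (o : TangentOrientation d M) {k : ℕ} (η : KForm d M (k + 1)) : KForm d M k :=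
  if h : k + 1 ≤ d then fun x =>
    (-1 : ℂ) ^ (d * ((k + 1) + 1) + 1) •
      hodgeStar (o.orient x) (show (d - (k + 1) + 1) + k = d by omega)
        (extD (fun y => hodgeStar (o.orient y) (show (k + 1) + (d - (k + 1)) = d by omega) (η y)) x)
  else 0

/-- The Hodge-Dirac operator `D = d + d^*`. -/
def hodgeDirac (o : TangentOrientation d M) (η : Form d M) : Form d M
  | 0 => coD o (η 1)
  | k + 1 => extD (η k) + coD o (η (k + 2))

/-- The commutator `[D, M_f]`. -/
def commutator (o : TangentOrientation d M) (f : M → ℂ) (η : Form d M) : Form d M :=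
  hodgeDirac o (mulOp f η) - mulOp f (hodgeDirac o η)

end Oriented

/-! ### The Riemannian measure and the spaces `L^p` -/

/-- The matrix `g_{ij}` of the metric in the chart at `x₀`. -/
def gram (x₀ x : M) : Matrix (Fin d) (Fin d) ℝ :=
  Matrix.of fun i j => inner ℝ (coordField x₀ i x) (coordField x₀ j x)

/-- The pointwise norm of a form. -/
def ptNorm (η : Form d M) (x : M) : ℝ := normGraded fun k => η k x

theorem ptNorm_add_le (η θ : Form d M) (x : M) : ptNorm (η + θ) x ≤ ptNorm η x + ptNorm θ x := by
  simp only [ptNorm, normGraded_eq]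
  exact (congrArg norm (comps.map_add (fun k => η k x) fun k => θ k x)).le.trans (norm_add_le _ _)

theorem ptNorm_smul (c : ℂ) (η : Form d M) (x : M) : ptNorm (c • η) x = ‖c‖ * ptNorm η x := by
  simp only [ptNorm, normGraded_eq]
  exact (congrArg norm (comps.map_smul c fun k => η k x)).trans (norm_smul _ _)

theorem ptNorm_nonneg (η : Form d M) (x : M) : 0 ≤ ptNorm η x := Real.sqrt_nonneg _

variable [MeasurableSpace M]

/-- The measure `√(det g_{ij}) dy` on the domain of the chart at `x₀`. -/
def chartVolume (x₀ : M) : Measure M :=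
  ((volume.restrict (extChartAt (𝓡 d) x₀).target).withDensity fun y =>
    ENNReal.ofReal √(gram (d := d) x₀ ((extChartAt (𝓡 d) x₀).symm y)).det).map (extChartAt (𝓡 d) x₀).symm

variable (d M) in
/-- The Riemannian measure, the smallest measure that dominates `√(det g_{ij}) dy` on every chart
domain. (These measures agree on the overlaps of the charts, so the Riemannian measure restricts to
them.) -/
def riemVolume : Measure M := ⨆ x₀ : M, chartVolume (d := d) x₀

/-- Measurable forms: the components in the charts are (almost everywhere) measurable. -/
def IsMeas (η : Form d M) : Prop :=
  ∀ (k : ℕ) (x₀ : M) (t : Fin k → Fin d),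
    AEMeasurable (fun x => η k x fun j => coordField x₀ (t j) x)
      ((riemVolume d M).restrict (extChartAt (𝓡 d) x₀).source)

theorem eLpNorm_ptNorm_smul (p : ℝ≥0∞) (c : ℂ) (η : Form d M) :
    eLpNorm (ptNorm (c • η)) p (riemVolume d M) =
      ‖c‖ₑ * eLpNorm (ptNorm η) p (riemVolume d M) := by
  have h : ptNorm (c • η) = ‖c‖ • ptNorm η := funext fun x => ptNorm_smul c η x
  rw [h, eLpNorm_const_smul, enorm_norm]

/-- Forms with compact support. -/
def IsCompactlySupported (η : Form d M) : Prop :=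
  ∃ K : Set M, IsCompact K ∧ ∀ x ∉ K, ∀ k, η k x = 0

/-- The norm `‖df‖_∞`, the essential supremum of `|df|`. -/
def supNormDiff (f : M → ℂ) : ℝ≥0∞ :=
  eLpNorm (fun x => normForm (diff (d := d) f x)) ⊤ (riemVolume d M)

end Forms

section Gram

variable {d : ℕ} {M : Type*} [TopologicalSpace M] [ChartedSpace (EuclideanSpace ℝ (Fin d)) M]
  [RiemannianBundle (fun x : M => TangentSpace (𝓡 d) x)] [IsManifold (𝓡 d) ∞ M]
  [IsContMDiffRiemannianBundle (𝓡 d) ∞ (EuclideanSpace ℝ (Fin d))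
    (fun x : M => TangentSpace (𝓡 d) x)]

theorem gram_continuousOn (x₀ : M) (i j : Fin d) :
    ContinuousOn (fun x => gram (d := d) x₀ x i j)
      (chartAt (EuclideanSpace ℝ (Fin d)) x₀).source := by
  have h (i : Fin d) := ((trivializationAt (EuclideanSpace ℝ (Fin d)) (TangentSpace (𝓡 d))
    x₀).contMDiffOn_localFrame_baseSet (I := 𝓡 d) (n := ∞)
      (EuclideanSpace.basisFun (Fin d) ℝ).toBasis i)
  refine (ContMDiffOn.inner_bundle (h i) (h j)).continuousOn.congr fun x hx => ?_
  simp only [gram, Matrix.of_apply]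
  rw [coordField_eq_localFrame x₀ i hx, coordField_eq_localFrame x₀ j hx,
    Bundle.Trivialization.localFrame_apply_of_mem_baseSet _ _ hx,
    Bundle.Trivialization.localFrame_apply_of_mem_baseSet _ _ hx]

end Gram

section Lp

variable {d : ℕ} {M : Type*} [TopologicalSpace M] [ChartedSpace (EuclideanSpace ℝ (Fin d)) M]
  [RiemannianBundle (fun x : M => TangentSpace (𝓡 d) x)] [MeasurableSpace M]
  [SecondCountableTopology M] [BorelSpace M] [IsManifold (𝓡 d) ∞ M]
  [IsContMDiffRiemannianBundle (𝓡 d) ∞ (EuclideanSpace ℝ (Fin d))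
    (fun x : M => TangentSpace (𝓡 d) x)]

theorem aemeasurable_ptNorm {η : Form d M} (hη : IsMeas η) :
    AEMeasurable (ptNorm η) (riemVolume d M) := by
  obtain ⟨S, hS, hcov⟩ := TopologicalSpace.countable_cover_nhds
    (f := fun x₀ : M => (chartAt (EuclideanSpace ℝ (Fin d)) x₀).source)
    fun x₀ => chart_source_mem_nhds _ x₀
  have := hS.to_subtype
  rw [← Measure.restrict_univ (μ := riemVolume d M), ← hcov, biUnion_eq_iUnion,
    aemeasurable_iUnion_iff]
  rintro ⟨x₀, -⟩
  have hms : MeasurableSet (chartAt (EuclideanSpace ℝ (Fin d)) x₀).source :=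
    (chartAt _ x₀).open_source.measurableSet
  set μ := (riemVolume d M).restrict (chartAt (EuclideanSpace ℝ (Fin d)) x₀).source with hμ
  have hGc : ContinuousOn (fun x => gram (d := d) x₀ x)
      (chartAt (EuclideanSpace ℝ (Fin d)) x₀).source :=
    continuousOn_pi.2 fun i => continuousOn_pi.2 fun j => gram_continuousOn x₀ i j
  have hinv (i j : Fin d) : AEMeasurable (fun x => (gram (d := d) x₀ x)⁻¹ i j) μ := by
    have hdet : AEMeasurable (fun x => (gram (d := d) x₀ x).det) μ :=
      ((Continuous.matrix_det continuous_id).comp_continuousOn hGc).aemeasurable hms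
    have hadj : AEMeasurable (fun x => (gram (d := d) x₀ x).adjugate i j) μ :=
      (((Continuous.matrix_adjugate continuous_id).matrix_elem i j).comp_continuousOn
        hGc).aemeasurable hms
    refine (hdet.inv.mul hadj).congr (ae_of_all _ fun x => ?_)
    simp [Matrix.inv_def]
  have hc (k : ℕ) (t : Fin k → Fin d) :
      AEMeasurable (fun x => η k x fun j => coordField x₀ (t j) x) μ := by
    have := hη k x₀ t
    rwa [extChartAt_source] at this
  refine AEMeasurable.congr (f := fun x => √(∑ k ∈ Finset.range (d + 1),
    (k ! : ℝ)⁻¹ * ∑ s : Fin k → Fin d, ∑ s' : Fin k → Fin d,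
      (∏ j, (gram (d := d) x₀ x)⁻¹ (s j) (s' j)) *
        (η k x (fun j => coordField x₀ (s j) x) *
          star (η k x fun j => coordField x₀ (s' j) x)).re)) ?_ ?_
  · refine AEMeasurable.sqrt ?_
    refine Finset.aemeasurable_fun_sum _ fun k _ => ?_
    refine AEMeasurable.const_mul ?_ _
    refine Finset.aemeasurable_fun_sum _ fun s _ => Finset.aemeasurable_fun_sum _ fun s' _ => ?_
    refine (Finset.aemeasurable_fun_prod _ fun j _ => hinv _ _).mul ?_
    exact Complex.measurable_re.comp_aemeasurable
      ((hc k s).mul (Complex.continuous_conj.measurable.comp_aemeasurable (hc k s')))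
  · filter_upwards [ae_restrict_mem hms] with x hx
    rw [ptNorm, normGraded, (Fact.out : Module.finrank ℝ (TSpace d x) = d)]
    congr 1
    refine Finset.sum_congr rfl fun k _ => ?_
    rw [normSqForm_eq_gram ((trivializationAt (EuclideanSpace ℝ (Fin d)) (TangentSpace (𝓡 d))
      x₀).basisAt (EuclideanSpace.basisFun (Fin d) ℝ).toBasis hx)]
    simp only [gram, ← coordField_eq_localFrame x₀ _ hx]

theorem eLpNorm_ptNorm_add_le {p : ℝ≥0∞} (hp : 1 ≤ p) {η θ : Form d M} (hη : IsMeas η)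
    (hθ : IsMeas θ) : eLpNorm (ptNorm (η + θ)) p (riemVolume d M) ≤
      eLpNorm (ptNorm η) p (riemVolume d M) + eLpNorm (ptNorm θ) p (riemVolume d M) := by
  refine le_trans (eLpNorm_mono (g := ptNorm η + ptNorm θ) fun x => ?_)
    (eLpNorm_add_le (aemeasurable_ptNorm hη).aestronglyMeasurable
      (aemeasurable_ptNorm hθ).aestronglyMeasurable hp)
  rw [Real.norm_of_nonneg (ptNorm_nonneg _ _), Pi.add_apply,
    Real.norm_of_nonneg (add_nonneg (ptNorm_nonneg _ _) (ptNorm_nonneg _ _))]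
  exact ptNorm_add_le η θ x

variable (d M) in
/-- The space of the measurable forms `η` such that `|η|` is in `L^p`. -/
def lpForms (p : ℝ≥0∞) [Fact (1 ≤ p)] : Submodule ℂ (Form d M) where
  carrier := {η | IsMeas η ∧ eLpNorm (ptNorm η) p (riemVolume d M) < ⊤}
  add_mem' {η θ} hη hθ := ⟨fun k x₀ t => (hη.1 k x₀ t).add (hθ.1 k x₀ t),
    (eLpNorm_ptNorm_add_le Fact.out hη.1 hθ.1).trans_lt (ENNReal.add_lt_top.2 ⟨hη.2, hθ.2⟩)⟩
  zero_mem' := ⟨fun _ _ _ => aemeasurable_const, by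
    rw [← zero_smul ℂ (0 : Form d M), eLpNorm_ptNorm_smul]; simp⟩
  smul_mem' c η hη := ⟨fun k x₀ t => (hη.1 k x₀ t).const_mul c, by
    rw [eLpNorm_ptNorm_smul]; exact ENNReal.mul_lt_top enorm_lt_top hη.2⟩

variable (d M) in
/-- The space `lpForms d M p`, with the `L^p`-seminorm. -/
def PreLp (p : ℝ≥0∞) [Fact (1 ≤ p)] : Type _ := lpForms d M p

variable {p : ℝ≥0∞} [Fact (1 ≤ p)]

instance : AddCommGroup (PreLp d M p) := inferInstanceAs (AddCommGroup (lpForms d M p))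

instance : Module ℂ (PreLp d M p) := inferInstanceAs (Module ℂ (lpForms d M p))

/-- The `L^p`-seminorm `(∫ |η(x)|^p dvol(x))^{1/p}` on `L^p`-forms. -/
def lpSeminorm : AddGroupSeminorm (PreLp d M p) where
  toFun η := (eLpNorm (ptNorm η.1) p (riemVolume d M)).toReal
  map_zero' := by
    change (eLpNorm (ptNorm (0 : Form d M)) p (riemVolume d M)).toReal = 0
    rw [← zero_smul ℂ (0 : Form d M), eLpNorm_ptNorm_smul]; simp
  add_le' η θ := by
    rw [← ENNReal.toReal_add η.2.2.ne θ.2.2.ne]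
    exact ENNReal.toReal_mono (ENNReal.add_lt_top.2 ⟨η.2.2, θ.2.2⟩).ne
      (eLpNorm_ptNorm_add_le Fact.out η.2.1 θ.2.1)
  neg' η := by
    change (eLpNorm (ptNorm (-η.1)) p (riemVolume d M)).toReal = _
    rw [← neg_one_smul ℂ η.1, eLpNorm_ptNorm_smul]; simp

instance : SeminormedAddCommGroup (PreLp d M p) := lpSeminorm.toSeminormedAddCommGroup

instance : NormedSpace ℂ (PreLp d M p) where
  norm_smul_le c η := by
    change (eLpNorm (ptNorm (c • η.1)) p (riemVolume d M)).toReal ≤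
      ‖c‖ * (eLpNorm (ptNorm η.1) p (riemVolume d M)).toReal
    rw [eLpNorm_ptNorm_smul, ENNReal.toReal_mul]; simp

variable (d M p) in
/-- The space `L^p(Ω^•(M))`: measurable forms with finite `L^p`-norm, modulo the forms of norm `0`,
that is, modulo equality almost everywhere. -/
abbrev LpForms : Type _ := SeparationQuotient (PreLp d M p)

/-- The class in `L^p(Ω^•(M))` of an `L^p`-form. -/
def toLp (η : Form d M) (h : η ∈ lpForms d M p) : LpForms d M p :=
  SeparationQuotient.mk (⟨η, h⟩ : lpForms d M p)

end Lp

end HodgeDirac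

end

/-!
The commutator of the Hodge-Dirac operator with a function `f` is a multiplication operator, namely
Clifford multiplication by `df`; everything else follows from pointwise properties of the latter.

*The commutator.* The Leibniz rule `d(fη) = f dη + df ∧ η` (`extD_mul`) gives `[d, M_f] = df ∧ ·`.
As `d^*` is `± ⋆ d ⋆`, its commutator with `M_f` is `± ⋆ (df ∧ ⋆ ·)`, and by linear algebra in one
tangent space this is `-i_{∇f}` (`hodgeStar_wedge_hodgeStar`). To apply the Leibniz rule to `⋆η`,
the Hodge star has to be known to preserve smoothness. It is therefore computed: it is the
contraction with the volume form (`starForm`, `hodgeStar_eq_starForm`), whose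
components are rational in the matrix `g_{ij}`, in `√(det g_{ij})` and in the components of `η`
(`contDiffAt_inChart_hodgeStar`).

*The bound.* For a real vector `a`, the map `θ ↦ a ∧ θ - i_a θ` multiplies lengths by `|a|`, by
Cartan's identity (`normGraded_cliff`). So Clifford multiplication by `df` is bounded on `L^p` when
`|df|` is essentially bounded, and for real `f` it multiplies pointwise norms by `|df|`
(`ptNorm_gradCliff_of_real`). In the real case the norm of the operator is then that of
multiplication by `|df|`, and forms of degree `0` that are indicator functions show that it is the
essential supremum (`norm_gradCliffLp_of_real`). This uses that the Riemannian measure is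
σ-finite, which holds because it agrees with `√(det g_{ij}) dy` on the chart domains
(`riemVolume_le_chartVolume`).

*Uniqueness.* For `p < ∞` the smooth forms with compact support are dense in `L^p`
(`mem_approxForms`). An `L^p`-form is close to its restriction to a compact set, which is a finite
sum of restrictions to sets inside chart domains. There the form is a combination of coordinate
forms, cut off to be smooth on `M`, with `L^p`-functions as coefficients; and these functions are
approximated by continuous functions with compact support in `L^p`, and the latter uniformly by
smooth functions.
-/

noncomputable section

set_option linter.unusedSectionVars false

namespace HodgeDirac

/-! ### The exterior product of alternating forms -/

section Wedge

variable {V : Type*} [NormedAddCommGroup V] [InnerProductSpace ℝ V] [FiniteDimensional ℝ V]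

/-- The identification of the first `k` and the last `l` positions among `m = k + l` positions. -/
def blockEquiv {k l m : ℕ} (h : k + l = m) : Fin k ⊕ Fin l ≃ Fin m :=
  finSumFinEquiv.trans (finCongr h)

theorem blockEquiv_inl {k l m : ℕ} (h : k + l = m) (i : Fin k) :
    (blockEquiv h (Sum.inl i) : ℕ) = i := by simp [blockEquiv]

theorem blockEquiv_inr {k l m : ℕ} (h : k + l = m) (i : Fin l) :
    (blockEquiv h (Sum.inr i) : ℕ) = k + i := by simp [blockEquiv]

/-- The wedge product is, up to the factor `k! l!`, the antisymmetrization of the product. -/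
theorem factorial_mul_wedge {k l m : ℕ} (h : k + l = m) (α : CForm V k) (β : CForm V l)
    (v : Fin m → V) :
    ((k ! * l ! : ℕ) : ℂ) * wedge h α β v = ∑ σ : Equiv.Perm (Fin k ⊕ Fin l),
      ((Equiv.Perm.sign σ : ℤ) : ℂ) * (α (fun i => v (blockEquiv h (σ (Sum.inl i)))) *
        β (fun i => v (blockEquiv h (σ (Sum.inr i))))) := by
  have key := congrArg (fun F => (LinearMap.mul' ℝ ℂ) (F fun x => v (blockEquiv h x)))
    (MultilinearMap.domCoprod_alternization_eq α.toAlternatingMap β.toAlternatingMap)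
  simp only [Fintype.card_fin, AlternatingMap.smul_apply, MultilinearMap.alternatization_apply,
    map_sum, map_nsmul] at key
  rw [nsmul_eq_mul] at key
  refine Eq.trans ?_ (key.symm.trans ?_)
  · rfl
  · refine Finset.sum_congr rfl fun σ _ => ?_
    rw [Units.smul_def, map_zsmul, zsmul_eq_mul]
    rfl

/-- The wedge product of a `1`-form and a form, as an alternating sum. -/
theorem wedge_one_apply {k : ℕ} (α : CForm V 1) (β : CForm V k) (v : Fin (k + 1) → V) :
    wedge (Nat.add_comm 1 k) α β v =
      ∑ i : Fin (k + 1), (-1) ^ (i : ℕ) * (α (fun _ => v i) * β (i.removeNth v)) := by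
  let A : V →ₗ[ℝ] V [⋀^Fin k]→ₗ[ℝ] ℂ :=
    { toFun := fun w => α (fun _ => w) • β.toAlternatingMap
      map_add' := fun w w' => by
        have h := α.map_update_add (fun _ => 0) 0 w w'
        simp only [Function.update_eq_const_of_subsingleton] at h
        rw [← add_smul]
        exact congrArg (· • β.toAlternatingMap) h
      map_smul' := fun c w => by
        have h := α.map_update_smul (fun _ => 0) 0 c w
        simp only [Function.update_eq_const_of_subsingleton] at h
        rw [RingHom.id_apply, ← smul_assoc]
        exact congrArg (· • β.toAlternatingMap) h }
  have hA (w : V) (u : Fin k → V) : A w u = α (fun _ => w) * β u := rfl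
  set T := AlternatingMap.alternatizeUncurryFin A with hTdef
  have hT (v : Fin (k + 1) → V) : T v =
      ∑ i : Fin (k + 1), (-1) ^ (i : ℕ) * (α (fun _ => v i) * β (i.removeNth v)) := by
    rw [hTdef, AlternatingMap.alternatizeUncurryFin_apply]
    refine Finset.sum_congr rfl fun i _ => ?_
    rw [hA, zsmul_eq_mul]; simp
  -- `T₀` is the summand that does not move the first vector. The antisymmetrization of `T₀` over
  -- all permutations is `k!` times the wedge product, by `factorial_mul_wedge`; as `T` is the sum
  -- of the transforms of `T₀` by the cycles `c i` and is itself alternating, it is also `k!` times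
  -- `T`.
  let T₀ : (Fin (k + 1) → V) → ℂ := fun v => α (fun _ => v 0) * β (Fin.tail v)
  let c : Fin (k + 1) → Equiv.Perm (Fin (k + 1)) := fun i => i.cycleRange.symm
  have hc (i : Fin (k + 1)) : ((Equiv.Perm.sign (c i) : ℤ) : ℂ) = (-1) ^ (i : ℕ) := by
    simp [c, Fin.sign_cycleRange]
  have hT' (v : Fin (k + 1) → V) :
      T v = ∑ i, ((Equiv.Perm.sign (c i) : ℤ) : ℂ) * T₀ (v ∘ c i) := by
    rw [hT]
    refine Finset.sum_congr rfl fun i _ => ?_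
    rw [hc]
    simp only [T₀, c, Function.comp_apply, Fin.cycleRange_symm_zero]
    congr 3
    funext j
    simp [Fin.removeNth, Fin.tail]
  have hW : ((k ! : ℕ) : ℂ) * wedge (Nat.add_comm 1 k) α β v =
      ∑ σ : Equiv.Perm (Fin (k + 1)), ((Equiv.Perm.sign σ : ℤ) : ℂ) * T₀ (v ∘ σ) := by
    have h1 := factorial_mul_wedge (Nat.add_comm 1 k) α β v
    rw [Nat.factorial_one, one_mul] at h1
    rw [h1]
    refine Fintype.sum_equiv (blockEquiv (Nat.add_comm 1 k)).permCongr _ _ fun σ => ?_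
    have h0 : (0 : Fin (k + 1)) = blockEquiv (Nat.add_comm 1 k) (Sum.inl 0) := by
      ext; simp [blockEquiv_inl]
    have hs (j : Fin k) : j.succ = blockEquiv (Nat.add_comm 1 k) (Sum.inr j) := by
      ext; simp [blockEquiv_inr, Nat.add_comm]
    rw [Equiv.Perm.sign_permCongr]
    have htail : Fin.tail (v ∘ (blockEquiv (Nat.add_comm 1 k)).permCongr σ) =
        fun i => v (blockEquiv (Nat.add_comm 1 k) (σ (Sum.inr i))) := by
      funext j
      simp [Fin.tail, hs]
    simp only [T₀, Function.comp_apply]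
    rw [htail, h0]
    simp only [Equiv.permCongr_apply, Equiv.symm_apply_apply]
    congr 4
    funext j
    rw [Subsingleton.elim j 0]
  have hsum : (((k + 1)! : ℕ) : ℂ) * T v = ((k + 1 : ℕ) : ℂ) *
      ∑ σ : Equiv.Perm (Fin (k + 1)), ((Equiv.Perm.sign σ : ℤ) : ℂ) * T₀ (v ∘ σ) := by
    have hconst : ∑ σ : Equiv.Perm (Fin (k + 1)), ((Equiv.Perm.sign σ : ℤ) : ℂ) * T (v ∘ σ) =
        (((k + 1)! : ℕ) : ℂ) * T v := by
      have : ∀ σ : Equiv.Perm (Fin (k + 1)),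
          ((Equiv.Perm.sign σ : ℤ) : ℂ) * T (v ∘ σ) = T v := fun σ => by
        rw [AlternatingMap.map_perm, Units.smul_def, zsmul_eq_mul, ← mul_assoc]
        rcases Int.units_eq_one_or (Equiv.Perm.sign σ) with h | h <;> simp [h]
      rw [Finset.sum_congr rfl fun σ _ => this σ]
      simp [Fintype.card_perm]
    rw [← hconst]
    simp only [hT', Finset.mul_sum]
    rw [Finset.sum_comm]
    have (i : Fin (k + 1)) : ∑ σ : Equiv.Perm (Fin (k + 1)), ((Equiv.Perm.sign σ : ℤ) : ℂ) *
        (((Equiv.Perm.sign (c i) : ℤ) : ℂ) * T₀ ((v ∘ σ) ∘ c i)) =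
        ∑ σ : Equiv.Perm (Fin (k + 1)), ((Equiv.Perm.sign σ : ℤ) : ℂ) * T₀ (v ∘ σ) := by
      refine Fintype.sum_equiv (Equiv.mulRight (c i)) _ _ fun σ => ?_
      simp only [Equiv.coe_mulRight, Equiv.Perm.sign_mul, Units.val_mul, Int.cast_mul, mul_assoc]
      rfl
    rw [Finset.sum_congr rfl fun i _ => this i]
    simp [Finset.mul_sum]
  rw [← hT]
  have hk : ((k ! : ℕ) : ℂ) ≠ 0 := by exact_mod_cast k.factorial_ne_zero
  have hk1 : ((k + 1 : ℕ) : ℂ) ≠ 0 := by exact_mod_cast k.succ_ne_zero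
  rw [← hW, Nat.factorial_succ, Nat.cast_mul, mul_assoc] at hsum
  exact (mul_left_cancel₀ hk (mul_left_cancel₀ hk1 hsum)).symm

end Wedge

/-! ### Extensions of injective tuples to permutations -/

section Tuples

/-- An injection of a block extends to a bijection. -/
theorem exists_equiv_inl_eq {k l : ℕ} {ι : Type*} [Fintype ι] (hc : Fintype.card ι = k + l)
    {t : Fin k → ι} (ht : Function.Injective t) :
    ∃ σ : Fin k ⊕ Fin l ≃ ι, ∀ i, σ (Sum.inl i) = t i := by
  classical
  have h1 : Fintype.card (Fin l) = Fintype.card ((Set.range t)ᶜ : Set ι) := by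
    rw [Fintype.card_compl_set, hc, Set.card_range_of_injective ht]
    simp
  refine ⟨(Equiv.sumCongr (Equiv.ofInjective t ht) (Fintype.equivOfCardEq h1)).trans
    (Equiv.Set.sumCompl (Set.range t)), fun i => ?_⟩
  simp

theorem exists_equiv_inr_eq {k l : ℕ} {ι : Type*} [Fintype ι] (hc : Fintype.card ι = k + l)
    {t : Fin l → ι} (ht : Function.Injective t) :
    ∃ σ : Fin k ⊕ Fin l ≃ ι, ∀ i, σ (Sum.inr i) = t i := by
  obtain ⟨σ, hσ⟩ := exists_equiv_inl_eq (k := l) (l := k) (by omega) ht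
  exact ⟨(Equiv.sumComm _ _).trans σ, fun i => by simp [hσ]⟩

/-- Each injective tuple is the first block of `l!` permutations. -/
theorem sum_perm_inl {k l : ℕ} (F : (Fin k → Fin k ⊕ Fin l) → ℂ)
    (hF : ∀ t, ¬ Function.Injective t → F t = 0) :
    ∑ σ : Equiv.Perm (Fin k ⊕ Fin l), F (fun i => σ (Sum.inl i)) = (l ! : ℂ) * ∑ t, F t := by
  classical
  rw [← Finset.sum_fiberwise Finset.univ
    (fun σ : Equiv.Perm (Fin k ⊕ Fin l) => fun i => σ (Sum.inl i)), Finset.mul_sum]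
  refine Finset.sum_congr rfl fun t _ => ?_
  rw [Finset.sum_congr rfl fun σ hσ => congrArg F (Finset.mem_filter.1 hσ).2, Finset.sum_const,
    nsmul_eq_mul]
  by_cases ht : Function.Injective t
  swap
  · rw [hF t ht, mul_zero, mul_zero]
  congr 1
  obtain ⟨σ₀, hσ₀⟩ := exists_equiv_inl_eq (k := k) (l := l) (by simp) ht
  have hcard : l ! = (Finset.univ : Finset (Equiv.Perm (Fin l))).card := by
    rw [Finset.card_univ, Fintype.card_perm, Fintype.card_fin]
  rw [hcard]
  congr 1
  refine (Finset.card_bij (fun τ _ => σ₀ * Equiv.Perm.sumCongr 1 τ) (fun τ _ => ?_)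
    (fun τ _ τ' _ h => ?_) fun σ hσ => ?_).symm
  · refine Finset.mem_filter.2 ⟨Finset.mem_univ _, ?_⟩
    funext i
    simp [hσ₀]
  · exact (Prod.mk.inj (Equiv.Perm.sumCongrHom_injective (a₁ := (1, τ)) (a₂ := (1, τ'))
      (mul_left_cancel h))).2
  · have hσ' (i : Fin k) : (σ₀⁻¹ * σ : Equiv.Perm _) (Sum.inl i) = Sum.inl i := by
      have := congrFun (Finset.mem_filter.1 hσ).2 i
      simp only [Equiv.Perm.coe_mul, Function.comp_apply] at this ⊢
      rw [this, ← hσ₀]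
      exact σ₀.symm_apply_apply _
    obtain ⟨⟨τ₁, τ⟩, hτ⟩ := Equiv.Perm.mem_sumCongrHom_range_of_perm_mapsTo_inl
      (σ := σ₀⁻¹ * σ) (by rintro _ ⟨i, rfl⟩; exact ⟨i, (hσ' i).symm⟩)
    have hτ₁ : τ₁ = 1 := by
      ext i
      have := hσ' i
      rw [← hτ] at this
      simpa [Fin.ext_iff] using this
    refine ⟨τ, Finset.mem_univ _, ?_⟩
    rw [hτ₁] at hτ
    exact (congrArg (σ₀ * ·) hτ).trans (mul_inv_cancel_left _ _)

end Tuples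

/-! ### The Hodge star as the contraction of the volume form -/

section HodgeStar

variable {V : Type*} [NormedAddCommGroup V] [InnerProductSpace ℝ V] [FiniteDimensional ℝ V]

/-- A sum over the tuples of vectors of an orthonormal basis, in terms of an arbitrary basis and the
inverse of its Gram matrix. -/
theorem sum_tuple_eq_gram {ι : Type*} [Fintype ι] [DecidableEq ι] {k : ℕ}
    (b : Module.Basis ι ℝ V)
    (A B : MultilinearMap ℝ (fun _ : Fin k => V) ℂ) :
    ∑ t : Fin k → Fin (Module.finrank ℝ V), A (fun j => stdOrthonormalBasis ℝ V (t j)) *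
        B (fun j => stdOrthonormalBasis ℝ V (t j)) =
      ∑ s : Fin k → ι, ∑ s' : Fin k → ι,
        ((∏ j, (Matrix.of fun i l => inner ℝ (b i) (b l))⁻¹ (s j) (s' j) : ℝ) : ℂ) *
          (A (fun j => b (s j)) * B (fun j => b (s' j))) := by
  set e := stdOrthonormalBasis ℝ V
  set C : Matrix (Fin (Module.finrank ℝ V)) ι ℝ := Matrix.of fun i j => b.repr (e i) j
  have hn : Module.finrank ℝ V = Fintype.card ι := Module.finrank_eq_card_basis b
  have hC : (Matrix.of fun i l => (inner ℝ (b i) (b l) : ℝ))⁻¹ = C.transpose * C := by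
    set D : Matrix ι (Fin (Module.finrank ℝ V)) ℝ := Matrix.of fun i j => e.repr (b i) j
    have hG : (Matrix.of fun i l => (inner ℝ (b i) (b l) : ℝ)) = D * D.transpose := by
      ext i l
      rw [Matrix.of_apply, Matrix.mul_apply, ← e.sum_inner_mul_inner]
      refine Finset.sum_congr rfl fun m _ => ?_
      simp [D, e.repr_apply_apply, real_inner_comm]
    have hCD : C * D = 1 := by
      ext i l
      have := congrArg (fun v => e.repr v l) (b.sum_repr (e i))
      simp only [map_sum, map_smul] at this
      simpa [Matrix.mul_apply, C, D, Matrix.one_apply, PiLp.single_apply, eq_comm] using this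
    have hDC : D * C = 1 := (Matrix.mul_eq_one_comm_of_card_eq _ _ _ (by simp [hn])).1 hCD
    refine Matrix.inv_eq_right_inv ?_
    rw [hG, Matrix.mul_assoc, ← Matrix.mul_assoc D.transpose, ← Matrix.transpose_mul, hCD]
    simpa using hDC
  rw [hC]
  have hexp (F : MultilinearMap ℝ (fun _ : Fin k => V) ℂ)
      (t : Fin k → Fin (Module.finrank ℝ V)) : F (fun j => e (t j)) =
      ∑ s : Fin k → ι, ((∏ j, C (t j) (s j) : ℝ) : ℂ) * F (fun j => b (s j)) := by
    have hv : (fun j => e (t j)) = fun j => ∑ i, C (t j) i • b i := by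
      funext j; exact (b.sum_repr (e (t j))).symm
    rw [hv, F.map_sum (fun j i => C (t j) i • b i)]
    refine Finset.sum_congr rfl fun s _ => ?_
    rw [F.map_smul_univ (fun j => C (t j) (s j)) (fun j => b (s j)), Complex.real_smul]
  have hterm (t : Fin k → Fin (Module.finrank ℝ V)) :
      A (fun j => e (t j)) * B (fun j => e (t j)) =
      ∑ s : Fin k → ι, ∑ s' : Fin k → ι, ((∏ j, C (t j) (s j) * C (t j) (s' j) : ℝ) : ℂ) *
        (A (fun j => b (s j)) * B (fun j => b (s' j))) := by
    rw [hexp A, hexp B, Finset.sum_mul_sum]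
    refine Finset.sum_congr rfl fun s _ => Finset.sum_congr rfl fun s' _ => ?_
    rw [Finset.prod_mul_distrib, Complex.ofReal_mul]
    ring
  rw [Finset.sum_congr rfl fun t _ => hterm t, Finset.sum_comm]
  refine Finset.sum_congr rfl fun s _ => ?_
  rw [Finset.sum_comm]
  refine Finset.sum_congr rfl fun s' _ => ?_
  rw [← Finset.sum_mul, ← Complex.ofReal_sum]
  congr 2
  exact ((Finset.prod_congr rfl fun j _ => Matrix.mul_apply).trans
    (Fintype.prod_sum fun j i => C i (s j) * C i (s' j))).symm

/-- Sums over the tuples of vectors of an orthonormal basis do not depend on the basis. -/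
theorem sum_tuple_eq_orthonormal {ι : Type*} [Fintype ι] {k : ℕ}
    (e : OrthonormalBasis ι ℝ V) (A B : MultilinearMap ℝ (fun _ : Fin k => V) ℂ) :
    ∑ t : Fin k → Fin (Module.finrank ℝ V), A (fun j => stdOrthonormalBasis ℝ V (t j)) *
        B (fun j => stdOrthonormalBasis ℝ V (t j)) =
      ∑ s : Fin k → ι, A (fun j => e (s j)) * B (fun j => e (s j)) := by
  classical
  have hG : (Matrix.of fun i l => (inner ℝ (e.toBasis i) (e.toBasis l) : ℝ)) = 1 := by
    ext i l
    simp [Matrix.one_apply, orthonormal_iff_ite.1 e.orthonormal i l]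
  rw [sum_tuple_eq_gram e.toBasis, hG, inv_one]
  refine Finset.sum_congr rfl fun s _ => ?_
  rw [Finset.sum_eq_single s]
  · simp
  · intro s' _ hs
    obtain ⟨j, hj⟩ := Function.ne_iff.1 hs
    rw [Finset.prod_eq_zero (Finset.mem_univ j)] <;> simp [Ne.symm hj]
  · simp

theorem pairing_eq_orthonormal {ι : Type*} [Fintype ι] {k : ℕ}
    (e : OrthonormalBasis ι ℝ V) (α β : CForm V k) :
    pairing α β = (k ! : ℂ)⁻¹ * ∑ s : Fin k → ι, α (fun j => e (s j)) * β (fun j => e (s j)) := by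
  rw [pairing]
  exact congrArg _ (sum_tuple_eq_orthonormal e α.toMultilinearMap β.toMultilinearMap)

variable {d : ℕ} [Fact (Module.finrank ℝ V = d)] (o : Orientation ℝ V (Fin d))

/-- The volume form with its arguments split into two blocks, with complex values. -/
def volBlock {k l : ℕ} (h : k + l = d) : V [⋀^(Fin k ⊕ Fin l)]→ₗ[ℝ] ℂ :=
  (Complex.ofRealCLM.toLinearMap.compAlternatingMap o.volumeForm).domDomCongr (blockEquiv h).symm

theorem volBlock_apply {k l : ℕ} (h : k + l = d) (v : Fin k ⊕ Fin l → V) :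
    volBlock o h v = ((o.volumeForm fun i => v ((blockEquiv h).symm i) : ℝ) : ℂ) := rfl

theorem volForm_apply (v : Fin d → V) : volForm o v = ((o.volumeForm v : ℝ) : ℂ) := rfl

/-- An alternating map with the arguments of its first block fixed. -/
def fixLeft {k l : ℕ} (F : V [⋀^(Fin k ⊕ Fin l)]→ₗ[ℝ] ℂ) (u : Fin k → V) : V [⋀^Fin l]→ₗ[ℝ] ℂ :=
  { F.toMultilinearMap.currySum u with
    map_eq_zero_of_eq' := fun v i j hv hij =>
      F.map_eq_zero_of_eq (Sum.elim u v) (i := Sum.inr i) (j := Sum.inr j) hv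
        (Sum.inr_injective.ne hij) }

/-- The contraction of the volume form with `β`; this is the Hodge dual of `β`. -/
def starForm {k l : ℕ} (h : k + l = d) (β : CForm V k) : CForm V l :=
  (k ! : ℂ)⁻¹ • ∑ t : Fin k → Fin (Module.finrank ℝ V),
    β (fun j => stdOrthonormalBasis ℝ V (t j)) •
      CForm.ofAlternating (fixLeft (volBlock o h) fun j => stdOrthonormalBasis ℝ V (t j))

theorem currySum_volBlock {k l : ℕ} (h : k + l = d) (u : Fin k → V) (w : Fin l → V) :
    (((volBlock o h).toMultilinearMap.domDomCongr (Equiv.sumComm _ _)).currySum w) u =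
      volBlock o h (Sum.elim u w) := by
  change volBlock o h _ = _
  congr 1
  funext i
  cases i <;> rfl

/-- Both factors are written as multilinear maps of the tuple, as `sum_tuple_eq_gram` requires. -/
theorem starForm_apply {k l : ℕ} (h : k + l = d) (β : CForm V k) (w : Fin l → V) :
    starForm o h β w = (k ! : ℂ)⁻¹ * ∑ t : Fin k → Fin (Module.finrank ℝ V),
      β.toMultilinearMap (fun j => stdOrthonormalBasis ℝ V (t j)) *
        ((volBlock o h).toMultilinearMap.domDomCongr (Equiv.sumComm _ _)).currySum w
          (fun j => stdOrthonormalBasis ℝ V (t j)) := by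
  simp only [currySum_volBlock, starForm, ContinuousAlternatingMap.smul_apply,
    ContinuousAlternatingMap.sum_apply, smul_eq_mul]
  rfl

theorem starForm_apply_orthonormal {ι : Type*} [Fintype ι] {k l : ℕ} (h : k + l = d)
    (e : OrthonormalBasis ι ℝ V) (β : CForm V k) (w : Fin l → V) :
    starForm o h β w = (k ! : ℂ)⁻¹ * ∑ s : Fin k → ι,
      β (fun j => e (s j)) * volBlock o h (Sum.elim (fun j => e (s j)) w) := by
  rw [starForm_apply, sum_tuple_eq_orthonormal e]
  simp only [currySum_volBlock]
  rfl

theorem starForm_apply_gram {ι : Type*} [Fintype ι] [DecidableEq ι] {k l : ℕ} (h : k + l = d)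
    (b : Module.Basis ι ℝ V) (β : CForm V k) (w : Fin l → V) :
    starForm o h β w = (k ! : ℂ)⁻¹ * ∑ s : Fin k → ι, ∑ s' : Fin k → ι,
      ((∏ j, (Matrix.of fun i l => inner ℝ (b i) (b l))⁻¹ (s j) (s' j) : ℝ) : ℂ) *
        (β (fun j => b (s j)) * volBlock o h (Sum.elim (fun j => b (s' j)) w)) := by
  rw [starForm_apply, sum_tuple_eq_gram b]
  simp only [currySum_volBlock]
  rfl

/-- On an orthonormal basis that is split into two blocks, the dual form takes on the second block
the value of the form on the first block, up to orientation. -/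
theorem starForm_orthonormal_inr {k l : ℕ} (h : k + l = d)
    (e : OrthonormalBasis (Fin k ⊕ Fin l) ℝ V) (β : CForm V k) :
    starForm o h β (fun j => e (Sum.inr j)) = β (fun j => e (Sum.inl j)) * volBlock o h e := by
  rw [starForm_apply_orthonormal o h e]
  have hsum : ∑ s : Fin k → Fin k ⊕ Fin l, β (fun j => e (s j)) *
        volBlock o h (Sum.elim (fun j => e (s j)) fun j => e (Sum.inr j)) =
      ∑ τ : Equiv.Perm (Fin k), β (fun j => e (Sum.inl (τ j))) *
        volBlock o h (Sum.elim (fun j => e (Sum.inl (τ j))) fun j => e (Sum.inr j)) := by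
    symm
    refine Finset.sum_of_injOn (fun τ : Equiv.Perm (Fin k) => fun j => Sum.inl (τ j)) ?_ ?_ ?_ ?_
    · intro τ _ τ' _ hτ
      ext j
      exact congrArg Fin.val (Sum.inl_injective (congrFun hτ j))
    · intro _ _; simp
    · intro s _ hs
      by_contra hne
      have h1 : ∀ j, ∃ i, s j = Sum.inl i := by
        intro j
        rcases hj : s j with i | i
        · exact ⟨i, rfl⟩
        · refine absurd ?_ (right_ne_zero_of_mul hne)
          exact (volBlock o h).map_eq_zero_of_eq _ (i := Sum.inl j) (j := Sum.inr i)
            (by simp [hj]) (by simp)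
      choose τ hτ using h1
      have hinj : Function.Injective τ := by
        intro i j hij
        by_contra hij'
        refine absurd ?_ (left_ne_zero_of_mul hne)
        exact β.map_eq_zero_of_eq _ (i := i) (j := j) (by simp [hτ, hij]) hij'
      refine hs ⟨Equiv.ofBijective τ (Finite.injective_iff_bijective.1 hinj), by simp, ?_⟩
      funext j
      simp [hτ]
    · intro _ _; rfl
  have hterm (τ : Equiv.Perm (Fin k)) : β (fun j => e (Sum.inl (τ j))) *
      volBlock o h (Sum.elim (fun j => e (Sum.inl (τ j))) fun j => e (Sum.inr j)) =
      β (fun j => e (Sum.inl j)) * volBlock o h e := by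
    have h1 : β (fun j => e (Sum.inl (τ j))) =
        ((Equiv.Perm.sign τ : ℤ) : ℂ) * β (fun j => e (Sum.inl j)) := by
      have := β.toAlternatingMap.map_perm (fun j => e (Sum.inl j)) τ
      rw [Units.smul_def, zsmul_eq_mul] at this
      exact this
    have h2 : volBlock o h (Sum.elim (fun j => e (Sum.inl (τ j))) fun j => e (Sum.inr j)) =
        ((Equiv.Perm.sign τ : ℤ) : ℂ) * volBlock o h e := by
      have := (volBlock o h).map_perm e (Equiv.Perm.sumCongr τ 1)
      rw [Units.smul_def, zsmul_eq_mul, Equiv.Perm.sign_sumCongr, Equiv.Perm.sign_one,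
        mul_one] at this
      rw [← this]
      congr 1
      funext i
      cases i <;> rfl
    rw [h1, h2]
    rcases Int.units_eq_one_or (Equiv.Perm.sign τ) with hs | hs <;> simp [hs]
  rw [hsum, Finset.sum_congr rfl fun τ _ => hterm τ, Finset.sum_const, Finset.card_univ,
    Fintype.card_perm, Fintype.card_fin, nsmul_eq_mul, ← mul_assoc, inv_mul_cancel₀, one_mul]
  exact_mod_cast k.factorial_ne_zero

theorem volBlock_orthonormal_mul_self {k l : ℕ} (h : k + l = d)
    (e : OrthonormalBasis (Fin k ⊕ Fin l) ℝ V) : volBlock o h e * volBlock o h e = 1 := by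
  have h1 := o.abs_volumeForm_apply_of_orthonormal (e.reindex (blockEquiv h))
  have h2 : volBlock o h e = ((o.volumeForm (e.reindex (blockEquiv h)) : ℝ) : ℂ) := by
    rw [volBlock_apply]
    congr 3
    funext i
    simp
  rw [h2, ← Complex.ofReal_mul, ← abs_mul_abs_self, h1]
  simp

/-- An orthonormal basis that is split into two blocks. -/
def blockBasis {k l : ℕ} (h : k + l = d) : OrthonormalBasis (Fin k ⊕ Fin l) ℝ V :=
  (stdOrthonormalBasis ℝ V).reindex
    ((finCongr (Fact.out : Module.finrank ℝ V = d)).trans (blockEquiv h).symm)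

theorem cform_ext {ι : Type*} {k : ℕ} (b : Module.Basis ι ℝ V) {α β : CForm V k}
    (h : ∀ t : Fin k → ι, Function.Injective t → α (fun j => b (t j)) = β fun j => b (t j)) :
    α = β :=
  ContinuousAlternatingMap.toAlternatingMap_injective (b.ext_alternating h)

/-- A form is determined by its values on the second blocks of orthonormal bases. -/
theorem cform_ext_inr {k l : ℕ} (h : k + l = d) {α β : CForm V l}
    (hαβ : ∀ e : OrthonormalBasis (Fin k ⊕ Fin l) ℝ V,
      α (fun j => e (Sum.inr j)) = β fun j => e (Sum.inr j)) : α = β := by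
  refine cform_ext (blockBasis (V := V) h).toBasis fun t ht => ?_
  obtain ⟨σ, hσ⟩ := exists_equiv_inr_eq (k := k) (by simp) ht
  simpa [hσ] using hαβ ((blockBasis h).reindex σ.symm)

/-- In an orthonormal basis `e` split into two blocks, `α ∧ ⋆β` is a sum over the permutations `σ`
of `e`, and by `starForm_orthonormal_inr` the summand is `α β` on the first block of `e ∘ σ`, times
the volume of `e`, the signs having cancelled. -/
theorem isHodgeDual_starForm {k l : ℕ} (h : k + l = d) (β : CForm V k) :
    IsHodgeDual o h β (starForm o h β) := by
  intro α
  let e₀ := (stdOrthonormalBasis ℝ V).reindex (finCongr (Fact.out : Module.finrank ℝ V = d))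
  refine cform_ext e₀.toBasis fun t ht => ?_
  let ϖ : Equiv.Perm (Fin d) := Equiv.ofBijective t (Finite.injective_iff_bijective.1 ht)
  let e : OrthonormalBasis (Fin k ⊕ Fin l) ℝ V := e₀.reindex (ϖ.symm.trans (blockEquiv h).symm)
  have he (i : Fin k ⊕ Fin l) : e₀.toBasis (t (blockEquiv h i)) = e i := by
    simp [e, ϖ]
  have hvol : o.volumeForm (fun j => e₀.toBasis (t j)) = volBlock o h e := by
    rw [volBlock_apply]
    congr 2
    funext j
    rw [← he, Equiv.apply_symm_apply]
  have h1 := factorial_mul_wedge h α (starForm o h β) (fun j => e₀.toBasis (t j))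
  simp only [he] at h1
  have hterm (σ : Equiv.Perm (Fin k ⊕ Fin l)) : ((Equiv.Perm.sign σ : ℤ) : ℂ) *
      (α (fun i => e (σ (Sum.inl i))) * starForm o h β (fun i => e (σ (Sum.inr i)))) =
      volBlock o h e * (α (fun i => e (σ (Sum.inl i))) * β (fun i => e (σ (Sum.inl i)))) := by
    have h2 := starForm_orthonormal_inr o h (e.reindex σ.symm) β
    simp only [OrthonormalBasis.reindex_apply, Equiv.symm_symm] at h2
    have h3 := (volBlock o h).map_perm e σ
    rw [Units.smul_def, zsmul_eq_mul] at h3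
    have h4 : volBlock o h (e.reindex σ.symm) = volBlock o h (e ∘ σ) := by
      congr 1
      funext i
      simp
    rw [h2, h4, h3]
    rcases Int.units_eq_one_or (Equiv.Perm.sign σ) with hs | hs <;> simp [hs] <;> ring
  rw [Finset.sum_congr rfl fun σ _ => hterm σ, ← Finset.mul_sum,
    sum_perm_inl (fun t => α (fun i => e (t i)) * β (fun i => e (t i)))] at h1
  · rw [ContinuousAlternatingMap.smul_apply, volForm_apply, hvol, pairing_eq_orthonormal e,
      smul_eq_mul]
    have hk : (k ! : ℂ) ≠ 0 := by exact_mod_cast k.factorial_ne_zero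
    have hl : (l ! : ℂ) ≠ 0 := by exact_mod_cast l.factorial_ne_zero
    push_cast at h1
    field_simp
    refine mul_left_cancel₀ hl ?_
    linear_combination h1
  · intro t ht
    simp only [Function.Injective, not_forall] at ht
    obtain ⟨i, j, hij, hne⟩ := ht
    rw [α.map_eq_zero_of_eq _ (i := i) (j := j) (by simp [hij]) hne, zero_mul]

theorem wedge_sub_right {k l m : ℕ} (h : k + l = m) (α : CForm V k) (β γ : CForm V l) :
    wedge h α (β - γ) = wedge h α β - wedge h α γ := by
  ext v
  have hkl : ((k ! * l ! : ℕ) : ℂ) ≠ 0 := by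
    exact_mod_cast (Nat.mul_pos k.factorial_pos l.factorial_pos).ne'
  refine mul_left_cancel₀ hkl ?_
  rw [ContinuousAlternatingMap.sub_apply, mul_sub, factorial_mul_wedge, factorial_mul_wedge,
    factorial_mul_wedge, ← Finset.sum_sub_distrib]
  refine Finset.sum_congr rfl fun σ _ => ?_
  rw [ContinuousAlternatingMap.sub_apply]
  ring

/-- The wedge pairing is nondegenerate: `⋆γ̄ ∧ γ` is up to sign the multiple `|γ|²` of the volume
form. -/
theorem eq_zero_of_forall_wedge_eq_zero {k l : ℕ} (h : k + l = d) {γ : CForm V l}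
    (hγ : ∀ α : CForm V k, wedge h α γ = 0) : γ = 0 := by
  -- the orientation is only needed to have a dual form at hand
  obtain ⟨o⟩ : Nonempty (Orientation ℝ V (Fin d)) :=
    ⟨((stdOrthonormalBasis ℝ V).reindex
      (finCongr (Fact.out : Module.finrank ℝ V = d))).toBasis.orientation⟩
  have h' : l + k = d := by omega
  let γc : CForm V l := Complex.conjCLE.toContinuousLinearMap.compContinuousAlternatingMap γ
  have hγc (v : Fin l → V) : γc v = (starRingEnd ℂ) (γ v) := rfl
  refine cform_ext_inr h fun e => ?_
  let e' : OrthonormalBasis (Fin l ⊕ Fin k) ℝ V := e.reindex (Equiv.sumComm _ _)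
  have h1 := factorial_mul_wedge h (starForm o h' γc) γ (fun j => e ((blockEquiv h).symm j))
  rw [hγ, show (0 : CForm V d) (fun j => e ((blockEquiv h).symm j)) = 0 from rfl, mul_zero] at h1
  simp only [Equiv.symm_apply_apply] at h1
  have hterm (σ : Equiv.Perm (Fin k ⊕ Fin l)) : ((Equiv.Perm.sign σ : ℤ) : ℂ) *
      (starForm o h' γc (fun i => e (σ (Sum.inl i))) * γ (fun i => e (σ (Sum.inr i)))) =
      volBlock o h' e' * ((‖γ (fun i => e (σ (Sum.inr i)))‖ ^ 2 : ℝ) : ℂ) := by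
    have h2 := starForm_orthonormal_inr o h' ((e.reindex σ.symm).reindex (Equiv.sumComm _ _)) γc
    simp only [OrthonormalBasis.reindex_apply, Equiv.symm_symm, Equiv.sumComm_symm,
      Equiv.sumComm_apply, Sum.swap_inr, Sum.swap_inl] at h2
    have h3 := (volBlock o h').map_perm e'
      ((Equiv.sumComm (Fin k) (Fin l)).permCongr σ)
    rw [Units.smul_def, zsmul_eq_mul, Equiv.Perm.sign_permCongr] at h3
    have h4 : volBlock o h' ((e.reindex σ.symm).reindex (Equiv.sumComm _ _)) =
        volBlock o h' (e' ∘ (Equiv.sumComm (Fin k) (Fin l)).permCongr σ) := by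
      congr 1
      funext i
      simp [e']
    rw [h2, h4, h3, hγc]
    have h5 : ((‖γ (fun i => e (σ (Sum.inr i)))‖ ^ 2 : ℝ) : ℂ) =
        (starRingEnd ℂ) (γ (fun i => e (σ (Sum.inr i)))) * γ (fun i => e (σ (Sum.inr i))) := by
      rw [← Complex.normSq_eq_norm_sq, Complex.normSq_eq_conj_mul_self]
    rw [h5]
    rcases Int.units_eq_one_or (Equiv.Perm.sign σ) with hs | hs <;> simp [hs] <;> ring
  rw [Finset.sum_congr rfl fun σ _ => hterm σ, ← Finset.mul_sum, ← Complex.ofReal_sum] at h1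
  have h6 : volBlock o h' e' ≠ 0 := fun h0 => by
    have := volBlock_orthonormal_mul_self o h' e'
    rw [h0] at this
    simp at this
  have h7 := Complex.ofReal_eq_zero.1 ((mul_eq_zero.1 h1.symm).resolve_left h6)
  have h8 := (Finset.sum_eq_zero_iff_of_nonneg fun _ _ => sq_nonneg _).1 h7 1 (Finset.mem_univ _)
  simpa using h8

/-- The Hodge dual is unique, so the form selected by the choice operator in `hodgeStar` is the
explicit one. -/
theorem hodgeStar_eq_starForm {k l : ℕ} (h : k + l = d) (β : CForm V k) :
    hodgeStar o h β = starForm o h β := by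
  have h1 : IsHodgeDual o h β (hodgeStar o h β) :=
    Classical.epsilon_spec ⟨_, isHodgeDual_starForm o h β⟩
  refine sub_eq_zero.1 (eq_zero_of_forall_wedge_eq_zero h fun α => ?_)
  rw [wedge_sub_right, h1 α, isHodgeDual_starForm o h β α, sub_self]

theorem coe_finRotate_pow (n j : ℕ) (x : Fin (n + 1)) :
    (((finRotate (n + 1)) ^ j) x : ℕ) = (x + j) % (n + 1) := by
  induction j with
  | zero => simp [Nat.mod_eq_of_lt x.2]
  | succ j ih =>
    rw [pow_succ', Equiv.Perm.mul_apply, finRotate_apply, Fin.val_add, ih, Fin.val_one',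
      ← Nat.add_mod, add_assoc]

/-- The permutation that turns `(v₀, …, v_l, w₁, …, w_k)` into
`(v_i, w₁, …, w_k, v₀, …, v̂_i, …, v_l)`. -/
def shufflePerm (k l : ℕ) (i : Fin (l + 1)) : Equiv.Perm (Fin (k + l + 1)) :=
  finRotate (k + l + 1) ^ (l + 1) *
    (Fin.cycleRange (⟨k + i, by omega⟩ : Fin (k + l + 1))).symm

theorem sign_shufflePerm (k l : ℕ) (i : Fin (l + 1)) :
    ((Equiv.Perm.sign (shufflePerm k l i) : ℤ) : ℂ) = (-1) ^ ((k + l) * (l + 1) + (k + i)) := by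
  simp [shufflePerm, Fin.sign_cycleRange, sign_finRotate, pow_add, pow_mul]

theorem shufflePerm_zero {k l : ℕ} (h1 : k + 1 + l = k + l + 1) (h2 : l + 1 + k = k + l + 1)
    (i : Fin (l + 1)) :
    shufflePerm k l i (blockEquiv h1 (Sum.inl 0)) = blockEquiv h2 (Sum.inl i) := by
  have h0 : blockEquiv h1 (Sum.inl 0) = 0 := by ext; simp [blockEquiv_inl]
  ext
  rw [h0, shufflePerm, Equiv.Perm.mul_apply, coe_finRotate_pow, Fin.cycleRange_symm_zero,
    blockEquiv_inl]
  have hi : (i : ℕ) < k + l + 1 := by omega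
  rw [show (k + (i : ℕ) + (l + 1)) = i + (k + l + 1) by omega, Nat.add_mod_right,
    Nat.mod_eq_of_lt hi]

theorem shufflePerm_succ {k l : ℕ} (h1 : k + 1 + l = k + l + 1) (h2 : l + 1 + k = k + l + 1)
    (i : Fin (l + 1)) (j : Fin k) :
    shufflePerm k l i (blockEquiv h1 (Sum.inl j.succ)) = blockEquiv h2 (Sum.inr j) := by
  have h0 : blockEquiv h1 (Sum.inl j.succ) = (⟨j, by omega⟩ : Fin (k + l)).succ := by
    ext; simp [blockEquiv_inl]
  ext
  rw [h0, shufflePerm, Equiv.Perm.mul_apply, coe_finRotate_pow, Fin.cycleRange_symm_succ,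
    blockEquiv_inr, Fin.succAbove_of_castSucc_lt _ _ (by simp [Fin.lt_def]; omega)]
  simp only [Fin.val_castSucc]
  rw [Nat.mod_eq_of_lt (by omega)]
  omega

theorem shufflePerm_inr {k l : ℕ} (h1 : k + 1 + l = k + l + 1) (h2 : l + 1 + k = k + l + 1)
    (i : Fin (l + 1)) (j : Fin l) :
    shufflePerm k l i (blockEquiv h1 (Sum.inr j)) = blockEquiv h2 (Sum.inl (i.succAbove j)) := by
  have h0 : blockEquiv h1 (Sum.inr j) = (⟨k + j, by omega⟩ : Fin (k + l)).succ := by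
    ext; simp [blockEquiv_inr]; omega
  ext
  rw [h0, shufflePerm, Equiv.Perm.mul_apply, coe_finRotate_pow, Fin.cycleRange_symm_succ,
    blockEquiv_inl]
  have h3 : ((Fin.succAbove (⟨k + i, by omega⟩ : Fin (k + l + 1)) ⟨k + j, by omega⟩ :
      Fin (k + l + 1)) : ℕ) = k + i.succAbove j := by
    simp only [Fin.succAbove, Fin.lt_def, Fin.val_castSucc]
    split_ifs <;> simp <;> omega
  have hlt := (i.succAbove j).2
  rw [h3, show k + (i.succAbove j : ℕ) + (l + 1) = i.succAbove j + (k + l + 1) by omega,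
    Nat.add_mod_right, Nat.mod_eq_of_lt (by omega)]

/-- The interior product is, up to sign, conjugate to the exterior product under the Hodge
star. -/
theorem starForm_wedge_starForm {k l : ℕ} (h1 : k + 1 + l = d) (h2 : l + 1 + k = d)
    (e : OrthonormalBasis (Fin (l + 1) ⊕ Fin k) ℝ V) (α : CForm V 1) (β : CForm V (k + 1)) :
    (-1 : ℂ) ^ (d * ((k + 1) + 1) + 1) *
      starForm o h2 (wedge (Nat.add_comm 1 l) α (starForm o h1 β)) (fun j => e (Sum.inr j)) =
    -∑ x, α (fun _ => e x) * β (Fin.cons (e x) fun j => e (Sum.inr j)) := by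
  obtain rfl : d = k + l + 1 := by omega
  rw [starForm_orthonormal_inr, wedge_one_apply]
  have hzero (j : Fin k) : β (Fin.cons (e (Sum.inr j)) fun j => e (Sum.inr j)) = 0 :=
    β.map_eq_zero_of_eq _ (i := 0) (j := j.succ) (by simp) (Fin.succ_ne_zero j).symm
  have hE (i : Fin (l + 1)) :
      starForm o h1 β (i.removeNth fun j => e (Sum.inl j)) =
        β (Fin.cons (e (Sum.inl i)) fun j => e (Sum.inr j)) *
          ((-1) ^ ((k + l) * (l + 1) + (k + i)) * volBlock o h2 e) := by
    let E : OrthonormalBasis (Fin (k + 1) ⊕ Fin l) ℝ V := e.reindex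
      (((blockEquiv h1).trans (shufflePerm k l i)).trans (blockEquiv h2).symm).symm
    have hE' (y) : E y = e ((blockEquiv h2).symm (shufflePerm k l i (blockEquiv h1 y))) := by
      simp [E]
    have h3 := starForm_orthonormal_inr o h1 E β
    have h4 : (fun j => E (Sum.inr j)) = i.removeNth fun j => e (Sum.inl j) := by
      funext j
      rw [hE', shufflePerm_inr h1 h2, Equiv.symm_apply_apply]
      rfl
    have h5 : (fun j => E (Sum.inl j)) = Fin.cons (e (Sum.inl i)) fun j => e (Sum.inr j) := by
      funext j
      refine Fin.cases ?_ (fun j => ?_) j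
      · rw [hE', shufflePerm_zero h1 h2, Equiv.symm_apply_apply, Fin.cons_zero]
      · rw [hE', shufflePerm_succ h1 h2, Equiv.symm_apply_apply, Fin.cons_succ]
    have h6 : volBlock o h1 E = (-1) ^ ((k + l) * (l + 1) + (k + i)) * volBlock o h2 e := by
      have h7 := o.volumeForm.map_perm (fun x => e ((blockEquiv h2).symm x)) (shufflePerm k l i)
      rw [Units.smul_def, zsmul_eq_mul] at h7
      rw [← sign_shufflePerm, volBlock_apply, volBlock_apply]
      simp only [hE', Equiv.apply_symm_apply]
      rw [← Complex.ofReal_intCast, ← Complex.ofReal_mul, ← h7]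
      rfl
    rw [← h4, h3, h5, h6]
  simp only [hE]
  rw [Fintype.sum_sum_type]
  simp only [hzero, mul_zero, Finset.sum_const_zero, add_zero]
  rw [Finset.sum_mul, Finset.mul_sum, ← Finset.sum_neg_distrib]
  refine Finset.sum_congr rfl fun i _ => ?_
  have hv := volBlock_orthonormal_mul_self o h2 e
  -- the sign in the definition of `d^*` makes the product of all signs independent of the degrees
  have hs : (-1 : ℂ) ^ ((k + l + 1) * ((k + 1) + 1) + 1) * ((-1) ^ (i : ℕ) *
      (-1) ^ ((k + l) * (l + 1) + (k + i))) = -1 := by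
    rw [← pow_add, ← pow_add]
    refine Odd.neg_one_pow ?_
    simp only [← Nat.not_even_iff_odd, Nat.even_add, Nat.even_mul, Nat.even_add_one]
    tauto
  linear_combination (α (fun _ => e (Sum.inl i)) *
    β (Fin.cons (e (Sum.inl i)) fun j => e (Sum.inr j))) * (hs +
    (-1 : ℂ) ^ ((k + l + 1) * ((k + 1) + 1) + 1) * ((-1) ^ (i : ℕ) *
      (-1) ^ ((k + l) * (l + 1) + (k + i))) * hv)

theorem interiorProd_apply (a : V) {k : ℕ} (η : CForm V (k + 1)) (v : Fin k → V) :
    interiorProd a η v = η (Fin.cons a v) := rfl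

theorem interiorProd_sum_smul {ι : Type*} [Fintype ι] (c : ι → ℝ) (b : ι → V) {k : ℕ}
    (η : CForm V (k + 1)) (v : Fin k → V) :
    interiorProd (∑ i, c i • b i) η v = ∑ i, (c i : ℂ) * η (Fin.cons (b i) v) := by
  let L : V →ₗ[ℝ] ℂ :=
    { toFun := fun w => η (Fin.cons w v)
      map_add' := fun w w' => η.toMultilinearMap.cons_add v w w'
      map_smul' := fun c w => η.toMultilinearMap.cons_smul v c w }
  have h : L (∑ i, c i • b i) = ∑ i, c i • L (b i) := by simp only [map_sum, map_smul]
  refine h.trans (Finset.sum_congr rfl fun i _ => ?_)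
  rw [Complex.real_smul]
  rfl

theorem sum_inner_mul_cons {ι : Type*} [Fintype ι] (e : OrthonormalBasis ι ℝ V) (a : V) {k : ℕ}
    (η : CForm V (k + 1)) (v : Fin k → V) :
    ∑ x, ((inner ℝ a (e x) : ℝ) : ℂ) * η (Fin.cons (e x) v) = η (Fin.cons a v) := by
  rw [← interiorProd_apply]
  conv_rhs => rw [← e.sum_repr' a, interiorProd_sum_smul]
  exact Finset.sum_congr rfl fun x _ => by rw [real_inner_comm]

/-- If the complex covector `α` corresponds to the complex vector `a + i b`, then the Hodge star
turns the exterior product with `α` into the interior product with `a + i b`. -/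
theorem hodgeStar_wedge_hodgeStar {k l : ℕ} (h1 : k + 1 + l = d) (h2 : l + 1 + k = d)
    (α : CForm V 1) (a b : V)
    (hα : ∀ v, α (fun _ => v) = ((inner ℝ a v : ℝ) : ℂ) + Complex.I * ((inner ℝ b v : ℝ) : ℂ))
    (β : CForm V (k + 1)) :
    (-1 : ℂ) ^ (d * ((k + 1) + 1) + 1) •
      hodgeStar o h2 (wedge (Nat.add_comm 1 l) α (hodgeStar o h1 β)) =
    -(interiorProd a β + Complex.I • interiorProd b β) := by
  rw [hodgeStar_eq_starForm, hodgeStar_eq_starForm]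
  refine cform_ext_inr h2 fun e => ?_
  rw [ContinuousAlternatingMap.smul_apply, smul_eq_mul, starForm_wedge_starForm,
    ContinuousAlternatingMap.neg_apply, ContinuousAlternatingMap.add_apply,
    ContinuousAlternatingMap.smul_apply, interiorProd_apply, interiorProd_apply,
    ← sum_inner_mul_cons e a, ← sum_inner_mul_cons e b, smul_eq_mul, Finset.mul_sum,
    ← Finset.sum_add_distrib]
  congr 1
  refine Finset.sum_congr rfl fun x _ => ?_
  rw [hα]
  ring

end HodgeStar

/-! ### Clifford multiplication by a vector -/

section Clifford

variable {V : Type*} [NormedAddCommGroup V] [InnerProductSpace ℝ V] [FiniteDimensional ℝ V]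

/-- The complex covector that corresponds to a real vector. -/
def covec (a : V) : CForm V 1 :=
  ContinuousAlternatingMap.ofSubsingleton ℝ V ℂ (0 : Fin 1)
    (Complex.ofRealCLM.comp (innerSL ℝ a))

theorem covec_apply (a : V) (v : Fin 1 → V) : covec a v = ((inner ℝ a (v 0) : ℝ) : ℂ) := rfl

/-- The real part of the Hermitian product of two forms. -/
def reInner {k : ℕ} (α β : CForm V k) : ℝ :=
  (k ! : ℝ)⁻¹ * ∑ t : Fin k → Fin (Module.finrank ℝ V),
    (α (fun j => stdOrthonormalBasis ℝ V (t j)) *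
      star (β fun j => stdOrthonormalBasis ℝ V (t j))).re

theorem normSqForm_eq_reInner {k : ℕ} (α : CForm V k) : normSqForm α = reInner α α := by
  rw [normSqForm, reInner]
  congr 1
  refine Finset.sum_congr rfl fun t _ => ?_
  simp [← Complex.normSq_eq_norm_sq, Complex.mul_conj]

theorem reInner_comm {k : ℕ} (α β : CForm V k) : reInner α β = reInner β α := by
  rw [reInner, reInner]
  congr 1
  refine Finset.sum_congr rfl fun t _ => ?_
  simp [mul_comm]

theorem reInner_zero_right {k : ℕ} (α : CForm V k) : reInner α 0 = 0 := by
  have (v : Fin k → V) : (0 : CForm V k) v = 0 := rfl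
  simp [reInner, this]

theorem reInner_sub_right {k : ℕ} (α β γ : CForm V k) :
    reInner α (β - γ) = reInner α β - reInner α γ := by
  simp only [reInner, ContinuousAlternatingMap.sub_apply, star_sub, mul_sub, Complex.sub_re,
    Finset.sum_sub_distrib]

theorem reInner_smul_right {k : ℕ} (c : ℝ) (α β : CForm V k) :
    reInner α (c • β) = c * reInner α β := by
  simp only [reInner, ContinuousAlternatingMap.smul_apply, Finset.mul_sum, star_smul,
    mul_smul_comm, Complex.smul_re, smul_eq_mul]
  refine Finset.sum_congr rfl fun t _ => ?_
  simp
  ring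

theorem normSqForm_sub {k : ℕ} (α β : CForm V k) :
    normSqForm (α - β) = normSqForm α + normSqForm β - 2 * reInner α β := by
  rw [normSqForm_eq_reInner, normSqForm_eq_reInner, normSqForm_eq_reInner, reInner_sub_right,
    reInner_comm _ α, reInner_comm _ β, reInner_sub_right, reInner_sub_right, reInner_comm β α]
  ring

theorem normSqForm_neg {k : ℕ} (α : CForm V k) : normSqForm (-α) = normSqForm α := by
  simp [normSqForm]

theorem cform_eq_zero_of_finrank_lt {k : ℕ} (hk : Module.finrank ℝ V < k) (α : CForm V k) :
    α = 0 := by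
  refine cform_ext (stdOrthonormalBasis ℝ V).toBasis fun t ht => ?_
  have := Fintype.card_le_of_injective t ht
  simp at this
  omega

theorem cons_insertNth_eq {k : ℕ} (η : CForm V (k + 1)) (i : Fin (k + 1)) (x : V) (v : Fin k → V) :
    η (i.insertNth x v) = (-1) ^ (i : ℕ) * η (Fin.cons x v) := by
  have h := η.toAlternatingMap.map_insertNth i x v
  rw [zsmul_eq_mul] at h
  push_cast at h
  exact h

/-- The exterior product with `a` is adjoint to the interior product with `a`. -/
theorem reInner_wedge_covec (a : V) {k : ℕ} (θ : CForm V k) (η : CForm V (k + 1)) :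
    reInner (wedge (Nat.add_comm 1 k) (covec a) θ) η = reInner θ (interiorProd a η) := by
  set e := stdOrthonormalBasis ℝ V with he
  have h1 (i : Fin (k + 1)) : ∑ t : Fin (k + 1) → Fin (Module.finrank ℝ V),
      ((-1) ^ (i : ℕ) * (covec a (fun _ => e (t i)) * θ (i.removeNth fun j => e (t j))) *
        star (η fun j => e (t j))).re =
      ∑ s : Fin k → Fin (Module.finrank ℝ V),
        (θ (fun j => e (s j)) * star (η (Fin.cons a fun j => e (s j)))).re := by
    rw [← (Fin.insertNthEquiv (fun _ => Fin (Module.finrank ℝ V)) i).sum_comp,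
      Fintype.sum_prod_type, Finset.sum_comm]
    refine Finset.sum_congr rfl fun s _ => ?_
    rw [← sum_inner_mul_cons e a, star_sum, Finset.mul_sum, Complex.re_sum]
    refine Finset.sum_congr rfl fun m _ => ?_
    have h2 : (fun j => e ((Fin.insertNthEquiv (fun _ => Fin (Module.finrank ℝ V)) i) (m, s) j)) =
        i.insertNth (e m) fun j => e (s j) := by
      refine (Fin.eq_insertNth_iff).2 ⟨?_, ?_⟩
      · simp [Fin.insertNthEquiv]
      · funext j
        simp [Fin.insertNthEquiv, Fin.removeNth]
    have h3 : (Fin.insertNthEquiv (fun _ => Fin (Module.finrank ℝ V)) i) (m, s) i = m := by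
      simp [Fin.insertNthEquiv]
    rw [h2, h3, cons_insertNth_eq, covec_apply, Fin.removeNth_insertNth, star_mul', star_mul']
    congr 1
    have h4 : (-1 : ℂ) ^ (i : ℕ) * star ((-1 : ℂ) ^ (i : ℕ)) = 1 := by
      simp [← mul_pow]
    have h5 : star (((inner ℝ a (e m) : ℝ) : ℂ)) = ((inner ℝ a (e m) : ℝ) : ℂ) :=
      Complex.conj_ofReal _
    rw [h5]
    linear_combination (((inner ℝ a (e m) : ℝ) : ℂ)) * θ (fun j => e (s j)) *
      star (η (Fin.cons (e m) fun j => e (s j))) * h4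
  rw [reInner, reInner]
  simp only [wedge_one_apply, Finset.sum_mul, Complex.re_sum, ← he]
  rw [Finset.sum_comm, Finset.sum_congr rfl fun i _ => h1 i, Finset.sum_const, Finset.card_univ,
    Fintype.card_fin, nsmul_eq_mul, Nat.factorial_succ, Nat.cast_mul, mul_inv]
  simp only [interiorProd_apply]
  have hk : ((k + 1 : ℕ) : ℝ) ≠ 0 := by positivity
  field_simp

theorem interiorProd_interiorProd (a : V) {k : ℕ} (η : CForm V (k + 2)) :
    interiorProd a (interiorProd a η) = 0 := by
  ext v
  exact η.map_eq_zero_of_eq (Fin.cons a (Fin.cons a v)) (i := 0) (j := 1) rfl (by simp)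

theorem interiorProd_wedge_covec_zero (a : V) (θ : CForm V 0) :
    interiorProd a (wedge (Nat.add_comm 1 0) (covec a) θ) = (‖a‖ ^ 2) • θ := by
  ext v
  rw [interiorProd_apply, wedge_one_apply]
  simp [covec_apply]

/-- Cartan's identity `i_a (a ∧ θ) + a ∧ i_a θ = |a|² θ`. -/
theorem interiorProd_wedge_covec_succ (a : V) {k : ℕ} (θ : CForm V (k + 1)) :
    interiorProd a (wedge (Nat.add_comm 1 (k + 1)) (covec a) θ) =
      (‖a‖ ^ 2) • θ - wedge (Nat.add_comm 1 k) (covec a) (interiorProd a θ) := by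
  ext v
  rw [interiorProd_apply, wedge_one_apply, ContinuousAlternatingMap.sub_apply, wedge_one_apply,
    Fin.sum_univ_succ, sub_eq_add_neg, ← Finset.sum_neg_distrib]
  congr 1
  · simp [covec_apply]
  · refine Finset.sum_congr rfl fun j _ => ?_
    have h : j.succ.removeNth (Fin.cons a v : Fin (k + 2) → V) = Fin.cons a (j.removeNth v) := by
      funext i
      refine Fin.cases ?_ (fun i => ?_) i <;> simp [Fin.removeNth]
    rw [h, interiorProd_apply, Fin.cons_succ, Fin.val_succ, pow_succ]
    ring

theorem normSqForm_wedge_covec_zero (a : V) (θ : CForm V 0) :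
    normSqForm (wedge (Nat.add_comm 1 0) (covec a) θ) = ‖a‖ ^ 2 * normSqForm θ := by
  rw [normSqForm_eq_reInner, reInner_wedge_covec, interiorProd_wedge_covec_zero,
    reInner_smul_right, normSqForm_eq_reInner]

theorem normSqForm_wedge_add_interiorProd (a : V) {k : ℕ} (θ : CForm V (k + 1)) :
    normSqForm (wedge (Nat.add_comm 1 (k + 1)) (covec a) θ) + normSqForm (interiorProd a θ) =
      ‖a‖ ^ 2 * normSqForm θ := by
  rw [normSqForm_eq_reInner, reInner_wedge_covec, interiorProd_wedge_covec_succ,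
    reInner_sub_right, reInner_smul_right, normSqForm_eq_reInner, normSqForm_eq_reInner,
    reInner_comm θ (wedge _ _ _), reInner_wedge_covec]
  ring

/-- Clifford multiplication by a real vector, `θ ↦ a ∧ θ - i_a θ`. -/
def cliff (a : V) (θ : ∀ k, CForm V k) : ∀ k, CForm V k
  | 0 => -interiorProd a (θ 1)
  | k + 1 => wedge (Nat.add_comm 1 k) (covec a) (θ k) - interiorProd a (θ (k + 2))

/-- Clifford multiplication by `a` multiplies lengths by `|a|`. In each degree the two parts
`a ∧ θ_k` and `i_a θ_{k+2}` are orthogonal since `i_a i_a = 0`; in the sum over all degrees, the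
parts that come from the same `θ_k` add up to `|a|² |θ_k|²` by Cartan's identity. -/
theorem normGraded_cliff (a : V) (θ : ∀ k, CForm V k) :
    normGraded (cliff a θ) = ‖a‖ * normGraded θ := by
  set n := Module.finrank ℝ V with hn
  let A : ℕ → ℝ := fun k => normSqForm (wedge (Nat.add_comm 1 k) (covec a) (θ k))
  let B : ℕ → ℝ := fun k => normSqForm (interiorProd a (θ (k + 1)))
  have hz {k : ℕ} : normSqForm (0 : CForm V k) = 0 := by
    rw [normSqForm_eq_reInner, reInner_zero_right]
  -- the two boundary terms vanish, because there are no forms of degree `n + 1`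
  have hA : A n = 0 := by
    change normSqForm (wedge _ _ _) = 0
    rw [cform_eq_zero_of_finrank_lt (by omega) (wedge _ _ _), hz]
  have hB : B n = 0 := by
    change normSqForm (interiorProd a _) = 0
    have h0 : interiorProd a (0 : CForm V (n + 1)) = 0 := by ext v; rfl
    rw [cform_eq_zero_of_finrank_lt (by omega) (θ (n + 1)), h0, hz]
  have hsucc (k : ℕ) : normSqForm (cliff a θ (k + 1)) = A k + B (k + 1) := by
    change normSqForm (wedge _ _ _ - interiorProd a _) = _
    rw [normSqForm_sub, reInner_wedge_covec, interiorProd_interiorProd, reInner_zero_right]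
    ring
  have hzero : normSqForm (cliff a θ 0) = B 0 := normSqForm_neg _
  have hsum : ∑ k ∈ Finset.range (n + 1), normSqForm (cliff a θ k) =
      ‖a‖ ^ 2 * ∑ k ∈ Finset.range (n + 1), normSqForm (θ k) := by
    calc ∑ k ∈ Finset.range (n + 1), normSqForm (cliff a θ k)
        = ∑ k ∈ Finset.range n, A k + ∑ k ∈ Finset.range (n + 1), B k := by
          rw [Finset.sum_range_succ', Finset.sum_range_succ' B, hzero]
          simp only [hsucc, Finset.sum_add_distrib]
          ring
      _ = ∑ k ∈ Finset.range (n + 1), A k + ∑ k ∈ Finset.range n, B k := by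
          rw [Finset.sum_range_succ A, Finset.sum_range_succ B, hA, hB]
          ring
      _ = ∑ k ∈ Finset.range n, ‖a‖ ^ 2 * normSqForm (θ (k + 1)) + ‖a‖ ^ 2 * normSqForm (θ 0) := by
          rw [Finset.sum_range_succ' A, show A 0 = _ from normSqForm_wedge_covec_zero a (θ 0),
            add_right_comm, ← Finset.sum_add_distrib]
          congr 1
          exact Finset.sum_congr rfl fun k _ => normSqForm_wedge_add_interiorProd a (θ (k + 1))
      _ = _ := by
        rw [← Finset.mul_sum, ← mul_add, Finset.sum_range_succ' (fun k => normSqForm (θ k))]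
  rw [normGraded, normGraded, hsum, Real.sqrt_mul (sq_nonneg _), Real.sqrt_sq (norm_nonneg _)]

theorem normGraded_add_le (θ η : ∀ k, CForm V k) :
    normGraded (θ + η) ≤ normGraded θ + normGraded η := by
  simp only [normGraded_eq, map_add]
  exact norm_add_le _ _

theorem normGraded_smul (c : ℂ) (θ : ∀ k, CForm V k) :
    normGraded (c • θ) = ‖c‖ * normGraded θ := by
  simp only [normGraded_eq, map_smul, norm_smul]

theorem normSqForm_one (α : CForm V 1) (a b : V)
    (hα : ∀ v, α (fun _ => v) = ((inner ℝ a v : ℝ) : ℂ) + Complex.I * ((inner ℝ b v : ℝ) : ℂ)) :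
    normSqForm α = ‖a‖ ^ 2 + ‖b‖ ^ 2 := by
  set e := stdOrthonormalBasis ℝ V with he
  rw [normSqForm, ← he, ← (Equiv.funUnique (Fin 1) (Fin (Module.finrank ℝ V))).symm.sum_comp,
    ← e.sum_sq_norm_inner_left a, ← e.sum_sq_norm_inner_left b, ← Finset.sum_add_distrib]
  simp only [Nat.factorial_one, Nat.cast_one, inv_one, one_mul]
  refine Finset.sum_congr rfl fun m _ => ?_
  have h := hα (e m)
  have h' : (fun j => e ((Equiv.funUnique (Fin 1) (Fin (Module.finrank ℝ V))).symm m j)) =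
    fun _ => e m := rfl
  rw [h', h, ← Complex.normSq_eq_norm_sq, mul_comm Complex.I, Complex.normSq_add_mul_I]
  simp

end Clifford

/-! ### Differential forms in charts -/

section Chart

variable {d : ℕ} {M : Type*} [TopologicalSpace M] [ChartedSpace (EuclideanSpace ℝ (Fin d)) M]

/-- The derivative at `x` of the chart at `x₀`, as an endomorphism of the model space: every tangent
space is, as a type, the model space. -/
def chartD (x₀ x : M) : EuclideanSpace ℝ (Fin d) →L[ℝ] EuclideanSpace ℝ (Fin d) :=
  mfderiv (𝓡 d) 𝓘(ℝ, EuclideanSpace ℝ (Fin d)) (extChartAt (𝓡 d) x₀) x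

/-- The derivative at `y` of the inverse of the chart at `x₀`, as an endomorphism of the model
space. -/
def symmD (x₀ : M) (y : EuclideanSpace ℝ (Fin d)) :
    EuclideanSpace ℝ (Fin d) →L[ℝ] EuclideanSpace ℝ (Fin d) :=
  mfderiv 𝓘(ℝ, EuclideanSpace ℝ (Fin d)) (𝓡 d) (extChartAt (𝓡 d) x₀).symm y

/-- The derivative of a function, as a linear map on the model space. -/
def funD {F : Type*} [NormedAddCommGroup F] [NormedSpace ℝ F] (f : M → F) (x : M) :
    EuclideanSpace ℝ (Fin d) →L[ℝ] F :=
  mfderiv (𝓡 d) 𝓘(ℝ, F) f x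

/-- The value of a form at a point, as a form on the model space. -/
def formAt {k : ℕ} (η : KForm d M k) (x : M) : CForm (EuclideanSpace ℝ (Fin d)) k := η x

theorem inChart_apply (x₀ : M) {k : ℕ} (η : KForm d M k) (y : EuclideanSpace ℝ (Fin d))
    (u : Fin k → EuclideanSpace ℝ (Fin d)) :
    inChart x₀ η y u = formAt η ((extChartAt (𝓡 d) x₀).symm y) fun j => symmD x₀ y (u j) := rfl

theorem inChart_single_extChartAt (x₀ : M) {k : ℕ} (η : KForm d M k) {x : M}
    (hx : x ∈ (extChartAt (𝓡 d) x₀).source) (t : Fin k → Fin d) :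
    inChart x₀ η (extChartAt (𝓡 d) x₀ x) (fun j => EuclideanSpace.single (t j) (1 : ℝ)) =
      η x fun j => coordField x₀ (t j) x := by
  rw [inChart_apply, (extChartAt (𝓡 d) x₀).left_inv hx]
  rfl

theorem inChart_single (x₀ : M) {k : ℕ} (η : KForm d M k) {y : EuclideanSpace ℝ (Fin d)}
    (hy : y ∈ (extChartAt (𝓡 d) x₀).target) (t : Fin k → Fin d) :
    inChart x₀ η y (fun j => EuclideanSpace.single (t j) (1 : ℝ)) =
      η ((extChartAt (𝓡 d) x₀).symm y) fun j =>
        coordField x₀ (t j) ((extChartAt (𝓡 d) x₀).symm y) := by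
  rw [← inChart_single_extChartAt x₀ η ((extChartAt (𝓡 d) x₀).map_target hy),
    (extChartAt (𝓡 d) x₀).right_inv hy]

theorem inChart_mulOp (x₀ : M) (f : M → ℂ) {k : ℕ} (η : KForm d M k) :
    inChart x₀ (fun x => f x • η x) =
      fun y => f ((extChartAt (𝓡 d) x₀).symm y) • inChart x₀ η y := rfl

variable [IsManifold (𝓡 d) ∞ M]

theorem mdifferentiableAt_extChartAt_symm {x₀ : M} {y : EuclideanSpace ℝ (Fin d)}
    (hy : y ∈ (extChartAt (𝓡 d) x₀).target) :
    MDifferentiableAt 𝓘(ℝ, EuclideanSpace ℝ (Fin d)) (𝓡 d) (extChartAt (𝓡 d) x₀).symm y := by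
  have h := mdifferentiableWithinAt_extChartAt_symm (I := 𝓡 d) hy
  rwa [ModelWithCorners.range_eq_univ, mdifferentiableWithinAt_univ] at h

theorem symmD_chartD {x₀ x : M} (hx : x ∈ (extChartAt (𝓡 d) x₀).source)
    (v : EuclideanSpace ℝ (Fin d)) :
    symmD x₀ (extChartAt (𝓡 d) x₀ x) (chartD x₀ x v) = v := by
  have h := mfderivWithin_extChartAt_symm_comp_mfderiv_extChartAt' (I := 𝓡 d) hx
  rw [ModelWithCorners.range_eq_univ, mfderivWithin_univ] at h
  exact congrArg (fun L => L v) h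

theorem inChart_chartD {x₀ x : M} (hx : x ∈ (extChartAt (𝓡 d) x₀).source) {k : ℕ}
    (η : KForm d M k) (v : Fin k → EuclideanSpace ℝ (Fin d)) :
    inChart x₀ η (extChartAt (𝓡 d) x₀ x) (fun j => chartD x₀ x (v j)) = formAt η x v := by
  rw [inChart_apply, (extChartAt (𝓡 d) x₀).left_inv hx]
  simp only [symmD_chartD hx]

theorem fderiv_comp_symm {F : Type*} [NormedAddCommGroup F] [NormedSpace ℝ F] {f : M → F}
    {x₀ x : M} (hx : x ∈ (extChartAt (𝓡 d) x₀).source)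
    (hf : MDifferentiableAt (𝓡 d) 𝓘(ℝ, F) f x) (v : EuclideanSpace ℝ (Fin d)) :
    fderiv ℝ (fun y => f ((extChartAt (𝓡 d) x₀).symm y)) (extChartAt (𝓡 d) x₀ x) v =
      funD f x (symmD x₀ (extChartAt (𝓡 d) x₀ x) v) := by
  have hx' := (extChartAt (𝓡 d) x₀).left_inv hx
  have h := mfderiv_comp (I := 𝓘(ℝ, EuclideanSpace ℝ (Fin d))) (I' := 𝓡 d) (I'' := 𝓘(ℝ, F))
    (extChartAt (𝓡 d) x₀ x) (g := f) (f := (extChartAt (𝓡 d) x₀).symm) (by rwa [hx'])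
    (mdifferentiableAt_extChartAt_symm ((extChartAt (𝓡 d) x₀).map_source hx))
  rw [mfderiv_eq_fderiv] at h
  have h2 : funD (d := d) f ((extChartAt (𝓡 d) x₀).symm (extChartAt (𝓡 d) x₀ x)) =
      funD (d := d) f x := by rw [hx']
  rw [← h2]
  exact congrArg (fun L => L v) h

theorem differentiableAt_comp_symm {F : Type*} [NormedAddCommGroup F] [NormedSpace ℝ F] {f : M → F}
    {x₀ x : M} (hx : x ∈ (extChartAt (𝓡 d) x₀).source)
    (hf : MDifferentiableAt (𝓡 d) 𝓘(ℝ, F) f x) :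
    DifferentiableAt ℝ (fun y => f ((extChartAt (𝓡 d) x₀).symm y)) (extChartAt (𝓡 d) x₀ x) := by
  have hx' := (extChartAt (𝓡 d) x₀).left_inv hx
  exact MDifferentiableAt.differentiableAt (MDifferentiableAt.comp (I' := 𝓡 d) (g := f)
    (extChartAt (𝓡 d) x₀ x) (by rwa [hx'])
    (mdifferentiableAt_extChartAt_symm ((extChartAt (𝓡 d) x₀).map_source hx)))

theorem contDiffOn_comp_symm {g : M → ℂ}
    (hg : ContMDiff (𝓡 d) 𝓘(ℝ, ℂ) ∞ g) (x₀ : M) :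
    ContDiffOn ℝ ∞ (fun y => g ((extChartAt (𝓡 d) x₀).symm y)) (extChartAt (𝓡 d) x₀).target := by
  rw [← contMDiffOn_iff_contDiffOn]
  exact hg.comp_contMDiffOn (contMDiffOn_extChartAt_symm x₀)

/-- The Leibniz rule for the exterior derivative. -/
theorem extD_mul [RiemannianBundle (fun x : M => TangentSpace (𝓡 d) x)] {f : M → ℂ} {x : M}
    (hf : MDifferentiableAt (𝓡 d) 𝓘(ℝ, ℂ) f x) {k : ℕ} (η : KForm d M k)
    (hη : DifferentiableAt ℝ (inChart x η) (extChartAt (𝓡 d) x x)) :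
    extD (fun y => f y • η y) x =
      f x • extD η x + wedge (Nat.add_comm 1 k) (diff f x) (η x) := by
  have hx : x ∈ (extChartAt (𝓡 d) x).source := mem_extChartAt_source x
  have hF := differentiableAt_comp_symm hx hf
  ext v
  refine Eq.trans ?_ (congrArg (f x • extD η x v + ·)
    (wedge_one_apply (diff (d := d) f x) (η x) v)).symm
  have main (v : Fin (k + 1) → EuclideanSpace ℝ (Fin d)) :
      extDeriv (inChart x fun y => f y • η y) (extChartAt (𝓡 d) x x) (fun j => chartD x x (v j)) =
        f x • extDeriv (inChart x η) (extChartAt (𝓡 d) x x) (fun j => chartD x x (v j)) +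
          ∑ i : Fin (k + 1), (-1) ^ (i : ℕ) * (funD f x (v i) * formAt η x (i.removeNth v)) := by
    rw [inChart_mulOp, extDeriv_apply (hF.fun_smul hη), extDeriv_apply hη, Finset.smul_sum,
      ← Finset.sum_add_distrib]
    refine Finset.sum_congr rfl fun i _ => ?_
    set w := i.removeNth fun j => chartD x x (v j) with hw
    have hw' : inChart x η (extChartAt (𝓡 d) x x) w = formAt η x (i.removeNth v) :=
      inChart_chartD hx η (i.removeNth v)
    have hg : DifferentiableAt ℝ (fun y => inChart x η y w) (extChartAt (𝓡 d) x x) :=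
      hη.continuousAlternatingMap_apply_const w
    have h1 := fderiv_fun_mul hF hg
    have h2 : fderiv ℝ (fun y => f ((extChartAt (𝓡 d) x).symm y)) (extChartAt (𝓡 d) x x)
        (chartD x x (v i)) = funD f x (v i) := by
      rw [fderiv_comp_symm hx hf, symmD_chartD hx]
    have h3 := congrArg (fun L => L (chartD x x (v i))) h1
    simp only [add_apply, smul_apply, smul_eq_mul, h2, hw',
      (extChartAt (𝓡 d) x).left_inv hx] at h3
    simp only [zsmul_eq_mul, smul_eq_mul]
    refine (congrArg _ h3).trans ?_
    push_cast
    ring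
  exact main v

end Chart

/-! ### Components of forms on the model space -/

section Components

/-- The value of an alternating map on rearranged vectors is a multiple of its value on these
vectors; this is the factor. -/
def tupleSign {d : ℕ} (q : Fin d → Fin d) : ℝ :=
  if h : Function.Injective q then
    ((Equiv.Perm.sign (Equiv.ofBijective q (Finite.injective_iff_bijective.1 h)) : ℤ) : ℝ) else 0

theorem map_comp_eq_tupleSign {d : ℕ} {V : Type*} [AddCommGroup V] [Module ℝ V]
    (F : V [⋀^Fin d]→ₗ[ℝ] ℝ) (v : Fin d → V) (q : Fin d → Fin d) :
    F (fun j => v (q j)) = tupleSign q * F v := by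
  by_cases h : Function.Injective q
  · have h1 := F.map_perm v (Equiv.ofBijective q (Finite.injective_iff_bijective.1 h))
    rw [Units.smul_def, zsmul_eq_mul] at h1
    rw [tupleSign, dif_pos h, ← h1]
    rfl
  · rw [tupleSign, dif_neg h, zero_mul]
    simp only [Function.Injective, not_forall] at h
    obtain ⟨i, j, hij, hne⟩ := h
    exact F.map_eq_zero_of_eq _ (i := i) (j := j) (by simp [hij]) hne

theorem exists_dual_forms (d k : ℕ) : ∃ a : (Fin k → Fin d) → CForm (EuclideanSpace ℝ (Fin d)) k,
    ∀ α : CForm (EuclideanSpace ℝ (Fin d)) k,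
      α = ∑ t, α (fun j => EuclideanSpace.single (t j) (1 : ℝ)) • a t := by
  let ev : CForm (EuclideanSpace ℝ (Fin d)) k →ₗ[ℂ] ((Fin k → Fin d) → ℂ) :=
    { toFun := fun α t => α fun j => EuclideanSpace.single (t j) (1 : ℝ)
      map_add' := fun _ _ => rfl
      map_smul' := fun _ _ => rfl }
  have hinj : LinearMap.ker ev = ⊥ := by
    refine LinearMap.ker_eq_bot'.2 fun α hα => ?_
    refine cform_ext (EuclideanSpace.basisFun (Fin d) ℝ).toBasis fun t _ => ?_
    simp only [OrthonormalBasis.coe_toBasis, EuclideanSpace.basisFun_apply]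
    exact congrFun hα t
  obtain ⟨L, hL⟩ := ev.exists_leftInverse_of_injective hinj
  refine ⟨fun t => L (Pi.single t 1), fun α => ?_⟩
  have h1 : L (ev α) = α := congrArg (fun f => f α) hL
  conv_lhs => rw [← h1, ← Finset.univ_sum_single (ev α), map_sum]
  refine Finset.sum_congr rfl fun t _ => ?_
  rw [← map_smul, ← Pi.single_smul, smul_eq_mul, mul_one]
  rfl

/-- Forms on the model space such that every form is the combination of them that has its values on
the tuples of standard basis vectors as coefficients. -/
def dualForm {d k : ℕ} (t : Fin k → Fin d) : CForm (EuclideanSpace ℝ (Fin d)) k :=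
  (exists_dual_forms d k).choose t

theorem eq_sum_dualForm {d k : ℕ} (α : CForm (EuclideanSpace ℝ (Fin d)) k) :
    α = ∑ t, α (fun j => EuclideanSpace.single (t j) (1 : ℝ)) • dualForm t :=
  (exists_dual_forms d k).choose_spec α

/-- A family of forms is smooth if its components are. -/
theorem contDiffAt_of_components {d k : ℕ} {n : WithTop ℕ∞}
    {F : EuclideanSpace ℝ (Fin d) → CForm (EuclideanSpace ℝ (Fin d)) k}
    {y : EuclideanSpace ℝ (Fin d)}
    (h : ∀ t : Fin k → Fin d,
      ContDiffAt ℝ n (fun z => F z fun j => EuclideanSpace.single (t j) (1 : ℝ)) y) :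
    ContDiffAt ℝ n F y := by
  have h1 : F = fun z => ∑ t : Fin k → Fin d,
      F z (fun j => EuclideanSpace.single (t j) (1 : ℝ)) • dualForm t :=
    funext fun z => eq_sum_dualForm (F z)
  rw [h1]
  exact ContDiffAt.sum fun t _ => (h t).smul contDiffAt_const

theorem contDiffAt_component {d k : ℕ} {n : WithTop ℕ∞}
    {F : EuclideanSpace ℝ (Fin d) → CForm (EuclideanSpace ℝ (Fin d)) k}
    {y : EuclideanSpace ℝ (Fin d)} (h : ContDiffAt ℝ n F y)
    (v : Fin k → EuclideanSpace ℝ (Fin d)) : ContDiffAt ℝ n (fun z => F z v) y :=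
  (ContinuousAlternatingMap.apply ℝ (EuclideanSpace ℝ (Fin d)) ℂ v).contDiff.contDiffAt.comp y h

end Components

/-! ### The volume form in coordinates -/

section GramDet

variable {V : Type*} [NormedAddCommGroup V] [InnerProductSpace ℝ V] [FiniteDimensional ℝ V]
variable {d : ℕ} [Fact (Module.finrank ℝ V = d)]

theorem det_gram_eq_sq (e : OrthonormalBasis (Fin d) ℝ V) (b : Fin d → V) :
    (Matrix.of fun i l => (inner ℝ (b i) (b l) : ℝ)).det = e.toBasis.det b ^ 2 := by
  have hG : (Matrix.of fun i l => (inner ℝ (b i) (b l) : ℝ)) =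
      (e.toBasis.toMatrix b).transpose * e.toBasis.toMatrix b := by
    ext i l
    rw [Matrix.of_apply, Matrix.mul_apply, ← e.sum_inner_mul_inner]
    refine Finset.sum_congr rfl fun m _ => ?_
    simp [Module.Basis.toMatrix_apply, e.repr_apply_apply, real_inner_comm]
  rw [hG, Matrix.det_mul, Matrix.det_transpose, Module.Basis.det_apply, sq]

variable (V d) in
theorem exists_orthonormalBasis_fin : Nonempty (OrthonormalBasis (Fin d) ℝ V) :=
  ⟨(stdOrthonormalBasis ℝ V).reindex (finCongr (Fact.out : Module.finrank ℝ V = d))⟩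

theorem det_gram_pos (b : Module.Basis (Fin d) ℝ V) :
    0 < (Matrix.of fun i l => (inner ℝ (b i) (b l) : ℝ)).det := by
  obtain ⟨e⟩ := exists_orthonormalBasis_fin V d
  rw [det_gram_eq_sq e]
  exact (sq_pos_iff (a := e.toBasis.det b)).2 (e.toBasis.isUnit_det b).ne_zero

/-- The volume form on a positively oriented basis is the square root of its Gram determinant. -/
theorem volumeForm_eq_sqrt_det_gram (o : Orientation ℝ V (Fin d)) (b : Module.Basis (Fin d) ℝ V)
    (hb : b.orientation = o) :
    o.volumeForm b = √(Matrix.of fun i l => (inner ℝ (b i) (b l) : ℝ)).det := by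
  obtain ⟨e⟩ := exists_orthonormalBasis_fin V d
  rw [det_gram_eq_sq e, Real.sqrt_sq_eq_abs]
  by_cases he : e.toBasis.orientation = o
  · rw [o.volumeForm_robust e he, abs_of_pos]
    rw [← Module.Basis.orientation_eq_iff_det_pos, he, hb]
  · rw [o.volumeForm_robust_neg e he, AlternatingMap.neg_apply, abs_of_nonpos]
    refine not_lt.1 fun hlt => he ?_
    rw [← hb]
    exact (Module.Basis.orientation_eq_iff_det_pos _ _).2 hlt

end GramDet

section CoordBasis

variable {d : ℕ} {M : Type*} [TopologicalSpace M] [ChartedSpace (EuclideanSpace ℝ (Fin d)) M]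
  [RiemannianBundle (fun x : M => TangentSpace (𝓡 d) x)] [IsManifold (𝓡 d) ∞ M]

/-- The coordinate vector fields at a point, as a basis. -/
def coordBasis (x₀ : M) {x : M} (hx : x ∈ (extChartAt (𝓡 d) x₀).source) :
    Module.Basis (Fin d) ℝ (TSpace d x) :=
  (trivializationAt (EuclideanSpace ℝ (Fin d)) (TangentSpace (𝓡 d)) x₀).basisAt
    (EuclideanSpace.basisFun (Fin d) ℝ).toBasis
    (show x ∈ (chartAt (EuclideanSpace ℝ (Fin d)) x₀).source by rwa [extChartAt_source] at hx)

theorem coordBasis_apply (x₀ : M) {x : M} (hx : x ∈ (extChartAt (𝓡 d) x₀).source) (i : Fin d) :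
    coordBasis x₀ hx i = coordField x₀ i x :=
  (coordField_eq_localFrame x₀ i (by rwa [extChartAt_source] at hx)).symm

theorem gram_eq_of_coordBasis (x₀ : M) {x : M} (hx : x ∈ (extChartAt (𝓡 d) x₀).source) :
    (Matrix.of fun i l => (inner ℝ (coordBasis x₀ hx i) (coordBasis x₀ hx l) : ℝ)) =
      gram x₀ x := by
  simp only [coordBasis_apply]
  rfl

theorem gram_det_pos (x₀ : M) {x : M} (hx : x ∈ (extChartAt (𝓡 d) x₀).source) :
    0 < (gram (d := d) x₀ x).det := by
  rw [← gram_eq_of_coordBasis x₀ hx]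
  exact det_gram_pos _

/-- Near the centre of a chart, the volume form takes the value `±√(det g_{ij})` on the coordinate
vector fields, with a constant sign. -/
theorem exists_volumeForm_coordField
    (o : TangentOrientation d M) (x₀ : M) : ∃ ε : ℝ, ∀ᶠ x in 𝓝 x₀,
      (o.orient x).volumeForm (fun i => coordField x₀ i x) = ε * √(gram (d := d) x₀ x).det := by
  obtain ⟨s, hs⟩ := o.locallyConstant x₀
  let s₀ := (EuclideanSpace.basisFun (Fin d) ℝ).toBasis.orientation
  have hsrc : ∀ᶠ x in 𝓝 x₀, x ∈ (extChartAt (𝓡 d) x₀).source :=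
    extChartAt_source_mem_nhds x₀
  have key (x : M) (hx : x ∈ (extChartAt (𝓡 d) x₀).source)
      (h : ∀ hx : x ∈ (trivializationAt (EuclideanSpace ℝ (Fin d)) (TangentSpace (𝓡 d)) x₀).baseSet,
        Orientation.map (Fin d) ((trivializationAt (EuclideanSpace ℝ (Fin d)) (TangentSpace (𝓡 d))
          x₀).continuousLinearEquivAt ℝ x hx).toLinearEquiv (o.orient x) = s) :
      ∃ T : TSpace d x ≃ₗ[ℝ] EuclideanSpace ℝ (Fin d),
        o.orient x = Orientation.map (Fin d) T.symm s ∧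
        (coordBasis x₀ hx).orientation = Orientation.map (Fin d) T.symm s₀ := by
    have hx' : x ∈ (trivializationAt (EuclideanSpace ℝ (Fin d)) (TangentSpace (𝓡 d)) x₀).baseSet :=
      show x ∈ (chartAt (EuclideanSpace ℝ (Fin d)) x₀).source by rwa [extChartAt_source] at hx
    refine ⟨((trivializationAt (EuclideanSpace ℝ (Fin d)) (TangentSpace (𝓡 d))
      x₀).continuousLinearEquivAt ℝ x hx').toLinearEquiv, ?_, ?_⟩
    · rw [← Orientation.map_symm, Equiv.eq_symm_apply]
      exact h hx'
    · exact Module.Basis.orientation_map _ _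
  rcases (EuclideanSpace.basisFun (Fin d) ℝ).toBasis.orientation_eq_or_eq_neg s with h | h
  · refine ⟨1, ?_⟩
    filter_upwards [hs, hsrc] with x h1 hx
    obtain ⟨T, hT1, hT2⟩ := key x hx h1
    have := volumeForm_eq_sqrt_det_gram (o.orient x) (coordBasis x₀ hx) (by rw [hT1, hT2, h])
    rw [gram_eq_of_coordBasis x₀ hx] at this
    rw [one_mul, ← this]
    simp only [← coordBasis_apply x₀ hx]
  · refine ⟨-1, ?_⟩
    filter_upwards [hs, hsrc] with x h1 hx
    obtain ⟨T, hT1, hT2⟩ := key x hx h1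
    have h2 : (coordBasis x₀ hx).orientation = -o.orient x := by
      rw [hT1, hT2, h, ← Orientation.map_neg]
      exact congrArg _ (neg_neg s₀).symm
    have := volumeForm_eq_sqrt_det_gram (-o.orient x) (coordBasis x₀ hx) h2
    rw [gram_eq_of_coordBasis x₀ hx, Orientation.volumeForm_neg_orientation,
      AlternatingMap.neg_apply] at this
    rw [neg_one_mul, ← this, neg_neg]
    simp only [← coordBasis_apply x₀ hx]

end CoordBasis

/-! ### Smoothness of the Hodge star -/

section Linear

variable {V : Type*} [NormedAddCommGroup V] [InnerProductSpace ℝ V] [FiniteDimensional ℝ V]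
variable {d : ℕ} [Fact (Module.finrank ℝ V = d)] (o : Orientation ℝ V (Fin d))

theorem hodgeStar_add {k l : ℕ} (h : k + l = d) (β γ : CForm V k) :
    hodgeStar o h (β + γ) = hodgeStar o h β + hodgeStar o h γ := by
  ext w
  rw [ContinuousAlternatingMap.add_apply, hodgeStar_eq_starForm, hodgeStar_eq_starForm,
    hodgeStar_eq_starForm, starForm_apply, starForm_apply, starForm_apply, ← mul_add,
    ← Finset.sum_add_distrib]
  exact congrArg _ (Finset.sum_congr rfl fun t _ => add_mul _ _ _)

theorem hodgeStar_smul {k l : ℕ} (h : k + l = d) (c : ℂ) (β : CForm V k) :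
    hodgeStar o h (c • β) = c • hodgeStar o h β := by
  simp only [hodgeStar_eq_starForm, starForm, ContinuousAlternatingMap.smul_apply, smul_assoc,
    ← Finset.smul_sum]
  rw [smul_comm]

end Linear

section MatrixSmooth

variable {E : Type*} [NormedAddCommGroup E] [NormedSpace ℝ E] {n : WithTop ℕ∞} {ι : Type*}
  [Fintype ι] [DecidableEq ι] {A : E → Matrix ι ι ℝ} {y : E}

theorem contDiffAt_matrix_det (hA : ∀ i j, ContDiffAt ℝ n (fun z => A z i j) y) :
    ContDiffAt ℝ n (fun z => (A z).det) y := by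
  simp only [Matrix.det_apply]
  exact ContDiffAt.sum fun σ _ => (contDiffAt_prod fun i _ => hA _ _).const_smul _

theorem contDiffAt_matrix_inv (hA : ∀ i j, ContDiffAt ℝ n (fun z => A z i j) y)
    (hdet : (A y).det ≠ 0) (i j : ι) : ContDiffAt ℝ n (fun z => (A z)⁻¹ i j) y := by
  have h : (fun z => (A z)⁻¹ i j) = fun z => (A z).det⁻¹ * (A z).adjugate i j := by
    funext z
    simp [Matrix.inv_def]
  rw [h]
  refine ((contDiffAt_matrix_det hA).inv hdet).mul ?_
  simp only [Matrix.adjugate_apply]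
  refine contDiffAt_matrix_det fun i' j' => ?_
  by_cases hi : i' = j
  · subst hi
    simpa using contDiffAt_const
  · simpa [Matrix.updateRow_ne hi] using hA i' j'

end MatrixSmooth

section Commutator

variable {d : ℕ} {M : Type*} [TopologicalSpace M] [ChartedSpace (EuclideanSpace ℝ (Fin d)) M]
  [RiemannianBundle (fun x : M => TangentSpace (𝓡 d) x)] [IsManifold (𝓡 d) ∞ M]

/-- The complex covector `df` corresponds to the complex vector `∇f`. -/
theorem diff_eq_inner_grad {f : M → ℂ} {x : M} (hf : MDifferentiableAt (𝓡 d) 𝓘(ℝ, ℂ) f x)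
    (v : TSpace d x) : diff (d := d) f x (fun _ => v) =
      ((inner ℝ (grad (fun y => (f y).re) x) v : ℝ) : ℂ) +
        Complex.I * ((inner ℝ (grad (fun y => (f y).im) x) v : ℝ) : ℂ) := by
  have hgrad (u : M → ℝ) : inner ℝ (grad u x) v = funD (d := d) u x v :=
    InnerProductSpace.toDual_symm_apply
  have hL (L : ℂ →L[ℝ] ℝ) : funD (d := d) (fun y => L (f y)) x v =
      L (diff (d := d) f x fun _ => v) := by
    have h := mfderiv_comp (I := 𝓡 d) (I' := 𝓘(ℝ, ℂ)) (I'' := 𝓘(ℝ, ℝ)) x (g := L) (f := f)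
      L.mdifferentiableAt hf
    rw [L.mfderiv_eq] at h
    exact congrArg (fun T => T v) h
  rw [hgrad, hgrad]
  have h1 := hL Complex.reCLM
  have h2 := hL Complex.imCLM
  simp only [Complex.reCLM_apply, Complex.imCLM_apply] at h1 h2
  rw [h1, h2, mul_comm, Complex.re_add_im]

variable [IsContMDiffRiemannianBundle (𝓡 d) ∞ (EuclideanSpace ℝ (Fin d))
    (fun x : M => TangentSpace (𝓡 d) x)]

theorem contDiffOn_gram (x₀ : M) (i j : Fin d) :
    ContDiffOn ℝ ∞ (fun y => gram (d := d) x₀ ((extChartAt (𝓡 d) x₀).symm y) i j)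
      (extChartAt (𝓡 d) x₀).target := by
  have h (i : Fin d) := ((trivializationAt (EuclideanSpace ℝ (Fin d)) (TangentSpace (𝓡 d))
    x₀).contMDiffOn_localFrame_baseSet (I := 𝓡 d) (n := ∞)
      (EuclideanSpace.basisFun (Fin d) ℝ).toBasis i)
  have h1 : ContMDiffOn (𝓡 d) 𝓘(ℝ, ℝ) ∞ (fun x => gram (d := d) x₀ x i j)
      (chartAt (EuclideanSpace ℝ (Fin d)) x₀).source := by
    refine (ContMDiffOn.inner_bundle (h i) (h j)).congr fun x hx => ?_
    simp only [gram, Matrix.of_apply]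
    rw [coordField_eq_localFrame x₀ i hx, coordField_eq_localFrame x₀ j hx,
      Bundle.Trivialization.localFrame_apply_of_mem_baseSet _ _ hx,
      Bundle.Trivialization.localFrame_apply_of_mem_baseSet _ _ hx]
  rw [← contMDiffOn_iff_contDiffOn]
  refine h1.comp (contMDiffOn_extChartAt_symm x₀) fun y hy => ?_
  have := (extChartAt (𝓡 d) x₀).map_target hy
  rwa [extChartAt_source] at this

theorem contDiffAt_gram (x₀ : M) (i j : Fin d) {y : EuclideanSpace ℝ (Fin d)}
    (hy : y ∈ (extChartAt (𝓡 d) x₀).target) :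
    ContDiffAt ℝ ∞ (fun y => gram (d := d) x₀ ((extChartAt (𝓡 d) x₀).symm y) i j) y :=
  (contDiffOn_gram x₀ i j).contDiffAt ((isOpen_extChartAt_target x₀).mem_nhds hy)

theorem gram_det_symm_pos (x₀ : M) {y : EuclideanSpace ℝ (Fin d)}
    (hy : y ∈ (extChartAt (𝓡 d) x₀).target) :
    0 < (gram (d := d) x₀ ((extChartAt (𝓡 d) x₀).symm y)).det :=
  gram_det_pos x₀ ((extChartAt (𝓡 d) x₀).map_target hy)

/-- The Hodge star operator preserves smoothness. -/
theorem contDiffAt_inChart_hodgeStar (o : TangentOrientation d M) (x₀ : M) {k l : ℕ}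
    (h : k + l = d) {η : KForm d M k}
    (hη : ContDiffAt ℝ ∞ (inChart x₀ η) (extChartAt (𝓡 d) x₀ x₀)) :
    ContDiffAt ℝ ∞ (inChart x₀ fun x => hodgeStar (o.orient x) h (η x))
      (extChartAt (𝓡 d) x₀ x₀) := by
  obtain ⟨ε, hε⟩ := exists_volumeForm_coordField o x₀
  have hy₀ : extChartAt (𝓡 d) x₀ x₀ ∈ (extChartAt (𝓡 d) x₀).target := mem_extChartAt_target x₀
  have hcont : Tendsto (extChartAt (𝓡 d) x₀).symm (𝓝 (extChartAt (𝓡 d) x₀ x₀)) (𝓝 x₀) := by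
    have := continuousAt_extChartAt_symm (I := 𝓡 d) x₀
    rwa [ContinuousAt, extChartAt_to_inv] at this
  have hG := fun i j => contDiffAt_gram x₀ i j hy₀
  have hpos := gram_det_symm_pos x₀ hy₀
  refine contDiffAt_of_components fun r => ?_
  let q (s' : Fin k → Fin d) : Fin d → Fin d := fun j => Sum.elim s' r ((blockEquiv h).symm j)
  refine ContDiffAt.congr_of_eventuallyEq (f := fun y => (k ! : ℂ)⁻¹ * ∑ s : Fin k → Fin d,
    ∑ s' : Fin k → Fin d,
      ((∏ j, (gram (d := d) x₀ ((extChartAt (𝓡 d) x₀).symm y))⁻¹ (s j) (s' j) : ℝ) : ℂ) *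
        (inChart x₀ η y (fun j => EuclideanSpace.single (s j) (1 : ℝ)) *
          ((tupleSign (q s') * (ε * √(gram (d := d) x₀ ((extChartAt (𝓡 d) x₀).symm y)).det) : ℝ) :
            ℂ))) ?_ ?_
  · refine contDiffAt_const.mul (ContDiffAt.sum fun s _ => ContDiffAt.sum fun s' _ => ?_)
    refine ContDiffAt.mul ?_ (ContDiffAt.mul (contDiffAt_component hη _) ?_)
    · have hprod : ContDiffAt ℝ ∞ (fun y => ∏ j, (gram (d := d) x₀
          ((extChartAt (𝓡 d) x₀).symm y))⁻¹ (s j) (s' j)) (extChartAt (𝓡 d) x₀ x₀) :=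
        contDiffAt_prod fun j _ => contDiffAt_matrix_inv hG hpos.ne' _ _
      exact Complex.ofRealCLM.contDiff.contDiffAt.comp _ hprod
    · exact Complex.ofRealCLM.contDiff.contDiffAt.comp _
        (contDiffAt_const.mul (contDiffAt_const.mul ((contDiffAt_matrix_det hG).sqrt hpos.ne')))
  · filter_upwards [(isOpen_extChartAt_target x₀).mem_nhds hy₀, hcont.eventually hε] with y hy hvol
    set x := (extChartAt (𝓡 d) x₀).symm y with hx
    have hxs : x ∈ (extChartAt (𝓡 d) x₀).source := (extChartAt (𝓡 d) x₀).map_target hy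
    rw [inChart_single x₀ _ hy, hodgeStar_eq_starForm, ← hx,
      starForm_apply_gram _ h (coordBasis x₀ hxs), gram_eq_of_coordBasis]
    congr 1
    refine Finset.sum_congr rfl fun s _ => Finset.sum_congr rfl fun s' _ => ?_
    rw [inChart_single x₀ _ hy, ← hx, volBlock_apply, ← hvol, ← map_comp_eq_tupleSign]
    simp only [coordBasis_apply]
    congr 4
    funext j
    simp only [q]
    cases (blockEquiv h).symm j <;> rfl

/-- The Leibniz rule for the codifferential: `d^*` is up to sign `⋆ d ⋆`, the Leibniz rule for `d`
produces `⋆ (df ∧ ⋆η)`, and this is an interior product by `hodgeStar_wedge_hodgeStar`. -/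
theorem coD_mul (o : TangentOrientation d M) {f : M → ℂ} {x : M}
    (hf : MDifferentiableAt (𝓡 d) 𝓘(ℝ, ℂ) f x) {k : ℕ} {η : KForm d M (k + 1)}
    (hη : ContDiffAt ℝ ∞ (inChart x η) (extChartAt (𝓡 d) x x)) :
    coD o (fun y => f y • η y) x = f x • coD o η x -
      (interiorProd (grad (fun y => (f y).re) x) (η x) +
        Complex.I • interiorProd (grad (fun y => (f y).im) x) (η x)) := by
  by_cases hk : k + 1 ≤ d
  · have h1 := (contDiffAt_inChart_hodgeStar o x
      (show (k + 1) + (d - (k + 1)) = d by omega) hη).differentiableAt (by simp)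
    rw [coD, coD, dif_pos hk, dif_pos hk]
    simp only [hodgeStar_smul]
    rw [extD_mul hf _ h1, hodgeStar_add, hodgeStar_smul, smul_add,
      hodgeStar_wedge_hodgeStar (o.orient x) _ _ _ _ _ (diff_eq_inner_grad hf), smul_comm,
      ← sub_eq_add_neg]
  · have h0 : η x = 0 := cform_eq_zero_of_finrank_lt
      (by rw [(Fact.out : Module.finrank ℝ (TSpace d x) = d)]; omega) _
    have h2 (a : TSpace d x) : interiorProd a (0 : CForm (TSpace d x) (k + 1)) = 0 := by
      ext v; rfl
    rw [coD, coD, dif_neg hk, dif_neg hk, h0, h2, h2]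
    ext v
    change (0 : ℂ) = f x * 0 - (0 + Complex.I * 0)
    ring

/-- The Leibniz rules for `d` and `d^*`: all terms that contain derivatives of `η` cancel. -/
theorem commutator_eq (o : TangentOrientation d M) {f : M → ℂ}
    (hf : ContMDiff (𝓡 d) 𝓘(ℝ, ℂ) ∞ f) {η : Form d M} (hη : IsSmooth η) :
    commutator o f η = wedgeDiff f η - interiorGrad f η := by
  have hη' (k : ℕ) (x : M) : ContDiffAt ℝ ∞ (inChart x (η k)) (extChartAt (𝓡 d) x x) :=
    (hη k x).contDiffAt ((isOpen_extChartAt_target x).mem_nhds (mem_extChartAt_target x))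
  have hf' (x : M) : MDifferentiableAt (𝓡 d) 𝓘(ℝ, ℂ) f x := hf.mdifferentiableAt (by simp)
  funext k x
  rcases k with _ | k
  · change coD o (fun y => f y • η 1 y) x - f x • coD o (η 1) x = 0 - interiorGrad f η 0 x
    rw [coD_mul o (hf' x) (hη' 1 x), interiorGrad]
    abel
  · change extD (fun y => f y • η k y) x + coD o (fun y => f y • η (k + 2) y) x -
      f x • (extD (η k) x + coD o (η (k + 2)) x) =
      wedge (Nat.add_comm 1 k) (diff f x) (η k x) - interiorGrad f η (k + 1) x
    rw [coD_mul o (hf' x) (hη' (k + 2) x),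
      extD_mul (hf' x) (η k) ((hη' k x).differentiableAt (by simp)), interiorGrad, smul_add]
    abel

end Commutator

/-! ### The Riemannian measure -/

section Measure

variable {d : ℕ} {M : Type*} [TopologicalSpace M] [ChartedSpace (EuclideanSpace ℝ (Fin d)) M]
  [IsManifold (𝓡 d) ∞ M]

/-- The derivative of the change of coordinates from the chart at `x₁` to the chart at `x₀`. -/
theorem hasFDerivAt_coordChange {x₀ x₁ : M} {y : EuclideanSpace ℝ (Fin d)}
    (hy : y ∈ (extChartAt (𝓡 d) x₁).target)
    (hy₀ : (extChartAt (𝓡 d) x₁).symm y ∈ (extChartAt (𝓡 d) x₀).source) :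
    HasFDerivAt (fun z => extChartAt (𝓡 d) x₀ ((extChartAt (𝓡 d) x₁).symm z))
      ((chartD x₀ ((extChartAt (𝓡 d) x₁).symm y)).comp (symmD x₁ y)) y := by
  have h1 := (mdifferentiableAt_extChartAt_symm hy).hasMFDerivAt
  have h2 : MDifferentiableAt (𝓡 d) 𝓘(ℝ, EuclideanSpace ℝ (Fin d)) (extChartAt (𝓡 d) x₀)
      ((extChartAt (𝓡 d) x₁).symm y) :=
    mdifferentiableAt_extChartAt (by rwa [extChartAt_source] at hy₀)
  exact (h2.hasMFDerivAt.comp y h1).hasFDerivAt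

variable [RiemannianBundle (fun x : M => TangentSpace (𝓡 d) x)]

theorem gram_eq_transpose_mul (x₀ x₁ : M) {x : M} (hx₀ : x ∈ (extChartAt (𝓡 d) x₀).source)
    {J : EuclideanSpace ℝ (Fin d) →L[ℝ] EuclideanSpace ℝ (Fin d)}
    (hJ : J = (chartD x₀ x).comp (symmD x₁ (extChartAt (𝓡 d) x₁ x))) :
    gram (d := d) x₁ x = (LinearMap.toMatrix (EuclideanSpace.basisFun (Fin d) ℝ).toBasis
        (EuclideanSpace.basisFun (Fin d) ℝ).toBasis J.toLinearMap).transpose * gram x₀ x *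
      LinearMap.toMatrix (EuclideanSpace.basisFun (Fin d) ℝ).toBasis
        (EuclideanSpace.basisFun (Fin d) ℝ).toBasis J.toLinearMap := by
  set A := LinearMap.toMatrix (EuclideanSpace.basisFun (Fin d) ℝ).toBasis
        (EuclideanSpace.basisFun (Fin d) ℝ).toBasis J.toLinearMap with hA
  have hb (i : Fin d) : coordField x₁ i x = ∑ j, A j i • coordField x₀ j x := by
    have h1 : symmD x₁ (extChartAt (𝓡 d) x₁ x) (EuclideanSpace.single i (1 : ℝ)) =
        ∑ j, A j i • symmD x₀ (extChartAt (𝓡 d) x₀ x) (EuclideanSpace.single j (1 : ℝ)) := by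
      have h2 : J (EuclideanSpace.single i (1 : ℝ)) =
          ∑ j, A j i • EuclideanSpace.single j (1 : ℝ) := by
        have := (EuclideanSpace.basisFun (Fin d) ℝ).toBasis.sum_repr
          (J (EuclideanSpace.single i (1 : ℝ)))
        rw [← this]
        refine Finset.sum_congr rfl fun j _ => ?_
        simp [hA, LinearMap.toMatrix_apply]
      have h3 := congrArg (symmD x₀ (extChartAt (𝓡 d) x₀ x)) h2
      rw [hJ, map_sum] at h3
      simp only [ContinuousLinearMap.comp_apply, symmD_chartD hx₀, map_smul] at h3
      exact h3
    exact h1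
  ext i l
  rw [gram, Matrix.of_apply, hb, hb, sum_inner, Matrix.mul_apply]
  simp only [inner_sum, Matrix.mul_apply, Finset.sum_mul, inner_smul_left, inner_smul_right,
    Matrix.transpose_apply, gram, Matrix.of_apply]
  rw [Finset.sum_comm]
  refine Finset.sum_congr rfl fun j _ => Finset.sum_congr rfl fun m _ => ?_
  simp
  ring

/-- The transformation law of the Riemannian density under a change of coordinates. -/
theorem sqrt_det_gram_eq (x₀ x₁ : M) {x : M} (hx₀ : x ∈ (extChartAt (𝓡 d) x₀).source) :
    √(gram (d := d) x₁ x).det =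
      |((chartD x₀ x).comp (symmD x₁ (extChartAt (𝓡 d) x₁ x))).det| *
        √(gram (d := d) x₀ x).det := by
  rw [gram_eq_transpose_mul x₀ x₁ hx₀ rfl, Matrix.det_mul, Matrix.det_mul, Matrix.det_transpose,
    LinearMap.det_toMatrix, mul_right_comm, Real.sqrt_mul (mul_self_nonneg _),
    Real.sqrt_mul_self_eq_abs]

variable [MeasurableSpace M] [BorelSpace M]

theorem measurableSet_preimage_symm_inter (x₀ : M) {A : Set M} (hA : MeasurableSet A) :
    MeasurableSet ((extChartAt (𝓡 d) x₀).symm ⁻¹' A ∩ (extChartAt (𝓡 d) x₀).target) := by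
  have hc := continuousOn_extChartAt_symm (I := 𝓡 d) x₀
  have hT := (isOpen_extChartAt_target (I := 𝓡 d) x₀).measurableSet
  have h1 := hc.domRestrict.measurable hA
  have h2 := (MeasurableEmbedding.subtype_coe hT).measurableSet_image.2 h1
  convert h2 using 1
  ext y
  simp [and_comm]

theorem chartVolume_apply (x₀ : M) {A : Set M} (hA : MeasurableSet A) :
    chartVolume (d := d) x₀ A =
      ∫⁻ y in (extChartAt (𝓡 d) x₀).symm ⁻¹' A ∩ (extChartAt (𝓡 d) x₀).target,
        ENNReal.ofReal √(gram (d := d) x₀ ((extChartAt (𝓡 d) x₀).symm y)).det := by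
  have hc := continuousOn_extChartAt_symm (I := 𝓡 d) x₀
  have hT := (isOpen_extChartAt_target (I := 𝓡 d) x₀).measurableSet
  have hm : AEMeasurable (extChartAt (𝓡 d) x₀).symm
      ((volume.restrict (extChartAt (𝓡 d) x₀).target).withDensity fun y =>
        ENNReal.ofReal √(gram (d := d) x₀ ((extChartAt (𝓡 d) x₀).symm y)).det) :=
    (hc.aemeasurable hT).mono_ac (withDensity_absolutelyContinuous _ _)
  rw [chartVolume, Measure.map_apply_of_aemeasurable hm hA, withDensity_apply',
    Measure.restrict_restrict' hT]

/-- On the domain of a chart, the volumes defined by all other charts are dominated by its own; this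
is the change of variables formula. -/
theorem chartVolume_inter_source_le (x₀ x₁ : M) {A : Set M} (hA : MeasurableSet A) :
    chartVolume (d := d) x₁ (A ∩ (extChartAt (𝓡 d) x₀).source) ≤ chartVolume (d := d) x₀ A := by
  have hA' : MeasurableSet (A ∩ (extChartAt (𝓡 d) x₀).source) :=
    hA.inter (isOpen_extChartAt_source x₀).measurableSet
  rw [chartVolume_apply x₁ hA', chartVolume_apply x₀ hA]
  set s := (extChartAt (𝓡 d) x₁).symm ⁻¹' (A ∩ (extChartAt (𝓡 d) x₀).source) ∩
    (extChartAt (𝓡 d) x₁).target with hs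
  have hsm : MeasurableSet s := measurableSet_preimage_symm_inter x₁ hA'
  let ψ : EuclideanSpace ℝ (Fin d) → EuclideanSpace ℝ (Fin d) :=
    fun z => extChartAt (𝓡 d) x₀ ((extChartAt (𝓡 d) x₁).symm z)
  let J : EuclideanSpace ℝ (Fin d) → EuclideanSpace ℝ (Fin d) →L[ℝ] EuclideanSpace ℝ (Fin d) :=
    fun y => (chartD x₀ ((extChartAt (𝓡 d) x₁).symm y)).comp (symmD x₁ y)
  have hψ : ∀ y ∈ s, HasFDerivWithinAt ψ (J y) s y := fun y hy =>
    (hasFDerivAt_coordChange hy.2 hy.1.2).hasFDerivWithinAt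
  have hψs (y) (hy : y ∈ s) : (extChartAt (𝓡 d) x₀).symm (ψ y) = (extChartAt (𝓡 d) x₁).symm y :=
    (extChartAt (𝓡 d) x₀).left_inv hy.1.2
  have hinj : InjOn ψ s := fun y hy z hz hyz => by
    have h1 := congrArg (extChartAt (𝓡 d) x₀).symm hyz
    rw [hψs y hy, hψs z hz] at h1
    exact (extChartAt (𝓡 d) x₁).symm.injOn hy.2 hz.2 h1
  calc ∫⁻ y in s, ENNReal.ofReal √(gram (d := d) x₁ ((extChartAt (𝓡 d) x₁).symm y)).det
      = ∫⁻ y in s, ENNReal.ofReal |(J y).det| *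
          ENNReal.ofReal √(gram (d := d) x₀ ((extChartAt (𝓡 d) x₀).symm (ψ y))).det := by
        refine setLIntegral_congr_fun hsm fun y hy => ?_
        rw [hψs y hy, sqrt_det_gram_eq x₀ x₁ hy.1.2, (extChartAt (𝓡 d) x₁).right_inv hy.2,
          ENNReal.ofReal_mul (abs_nonneg _)]
    _ = ∫⁻ z in ψ '' s, ENNReal.ofReal √(gram (d := d) x₀ ((extChartAt (𝓡 d) x₀).symm z)).det :=
        (lintegral_image_eq_lintegral_abs_det_fderiv_mul volume hsm hψ hinj fun z =>
          ENNReal.ofReal √(gram (d := d) x₀ ((extChartAt (𝓡 d) x₀).symm z)).det).symm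
    _ ≤ _ := by
        refine lintegral_mono_set ?_
        rintro _ ⟨y, hy, rfl⟩
        refine ⟨?_, (extChartAt (𝓡 d) x₀).map_source hy.1.2⟩
        rw [mem_preimage, hψs y hy]
        exact hy.1.1

/-- On the domain of a chart, the Riemannian measure is at most (and hence equal to) the measure
`√(det g_{ij}) dy`. -/
theorem riemVolume_le_chartVolume (x₀ : M) {A : Set M} (hA : MeasurableSet A)
    (hAs : A ⊆ (extChartAt (𝓡 d) x₀).source) : riemVolume d M A ≤ chartVolume (d := d) x₀ A := by
  set S := (extChartAt (𝓡 d) x₀).source with hS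
  have hSm : MeasurableSet S := (isOpen_extChartAt_source x₀).measurableSet
  -- a measure that is infinite outside of the chart domain dominates all chart volumes
  have h : riemVolume d M ≤ chartVolume (d := d) x₀ + (⊤ : Measure M).restrict Sᶜ := by
    refine iSup_le fun x₁ => Measure.le_iff.2 fun B hB => ?_
    rw [← measure_inter_add_sdiff B hSm, Measure.add_apply]
    refine add_le_add (chartVolume_inter_source_le x₀ x₁ hB) ?_
    rw [Measure.restrict_apply hB]
    exact le_top (a := chartVolume (d := d) x₁) _
  refine (h A).trans ?_
  rw [Measure.add_apply, Measure.restrict_apply hA,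
    (disjoint_compl_right_iff_subset.2 hAs).inter_eq]
  simp

variable [IsContMDiffRiemannianBundle (𝓡 d) ∞ (EuclideanSpace ℝ (Fin d))
    (fun x : M => TangentSpace (𝓡 d) x)]

instance isLocallyFiniteMeasure_riemVolume : IsLocallyFiniteMeasure (riemVolume d M) := by
  refine ⟨fun x₀ => ?_⟩
  have hT := isOpen_extChartAt_target (I := 𝓡 d) x₀
  obtain ⟨r, hr, hrT⟩ := Metric.nhds_basis_closedBall.mem_iff.1
    (hT.mem_nhds (mem_extChartAt_target (I := 𝓡 d) x₀))
  set B := Metric.closedBall (extChartAt (𝓡 d) x₀ x₀) r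
  have hBn : extChartAt (𝓡 d) x₀ ⁻¹' Metric.ball (extChartAt (𝓡 d) x₀ x₀) r ∈ 𝓝 x₀ :=
    (continuousAt_extChartAt x₀).preimage_mem_nhds (Metric.ball_mem_nhds _ hr)
  obtain ⟨U, hUsub, hUo, hxU⟩ := mem_nhds_iff.1
    (inter_mem hBn (extChartAt_source_mem_nhds (I := 𝓡 d) x₀))
  refine ⟨U, hUo.mem_nhds hxU, (riemVolume_le_chartVolume x₀ hUo.measurableSet
    fun x hx => (hUsub hx).2).trans_lt ?_⟩
  rw [chartVolume_apply x₀ hUo.measurableSet]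
  have hcont : ContinuousOn (fun y => √(gram (d := d) x₀ ((extChartAt (𝓡 d) x₀).symm y)).det) B :=
    fun y hy => ((contDiffAt_matrix_det fun i j =>
      contDiffAt_gram x₀ i j (hrT hy)).continuousAt.sqrt).continuousWithinAt
  have hint := hcont.integrableOn_compact (μ := volume) (isCompact_closedBall _ _)
  refine (lintegral_mono_set (t := B) ?_).trans_lt ?_
  · rintro y ⟨hyU, hyT⟩
    have := (hUsub hyU).1
    rw [mem_preimage, (extChartAt (𝓡 d) x₀).right_inv hyT] at this
    exact Metric.ball_subset_closedBall this
  · have h1 := hint.hasFiniteIntegral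
    refine lt_of_eq_of_lt ?_ h1
    refine lintegral_congr fun y => ?_
    rw [Real.enorm_of_nonneg (Real.sqrt_nonneg _)]

end Measure

/-! ### Clifford multiplication by a differential -/

section InteriorProd

variable {V : Type*} [NormedAddCommGroup V] [InnerProductSpace ℝ V] [FiniteDimensional ℝ V]

/-- The expansion of a vector in a basis, by raising the index of its inner products with the basis
vectors. -/
theorem eq_sum_gram_inv_smul {ι : Type*} [Fintype ι] [DecidableEq ι] (b : Module.Basis ι ℝ V)
    (hdet : (Matrix.of fun i l => (inner ℝ (b i) (b l) : ℝ)).det ≠ 0) (a : V) :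
    a = ∑ i, (∑ j, (Matrix.of fun i l => (inner ℝ (b i) (b l) : ℝ))⁻¹ i j * inner ℝ a (b j)) •
      b i := by
  set G := Matrix.of fun i l => (inner ℝ (b i) (b l) : ℝ) with hG
  have h1 : (fun j => (inner ℝ a (b j) : ℝ)) = G.mulVec fun l => b.repr a l := by
    funext j
    conv_lhs => rw [← b.sum_repr a, sum_inner]
    rw [Matrix.mulVec, dotProduct]
    refine Finset.sum_congr rfl fun l _ => ?_
    rw [inner_smul_left, hG, Matrix.of_apply, real_inner_comm]
    simp [mul_comm]
  have h2 (i : ι) : ∑ j, G⁻¹ i j * inner ℝ a (b j) = b.repr a i := by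
    have h3 : G⁻¹.mulVec (G.mulVec fun l => b.repr a l) = fun l => b.repr a l := by
      rw [Matrix.mulVec_mulVec, Matrix.nonsing_inv_mul _ (isUnit_iff_ne_zero.2 hdet),
        Matrix.one_mulVec]
    rw [← h1] at h3
    exact congrFun h3 i
  simp only [h2]
  exact (b.sum_repr a).symm

theorem interiorProd_add (a : V) {k : ℕ} (η θ : CForm V (k + 1)) :
    interiorProd a (η + θ) = interiorProd a η + interiorProd a θ := by
  ext v; rfl

theorem interiorProd_smul (a : V) {k : ℕ} (c : ℂ) (η : CForm V (k + 1)) :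
    interiorProd a (c • η) = c • interiorProd a η := by
  ext v; rfl

theorem wedge_one_add {k : ℕ} (α : CForm V 1) (β γ : CForm V k) :
    wedge (Nat.add_comm 1 k) α (β + γ) =
      wedge (Nat.add_comm 1 k) α β + wedge (Nat.add_comm 1 k) α γ := by
  ext v
  simp only [wedge_one_apply, ContinuousAlternatingMap.add_apply, mul_add, Finset.sum_add_distrib]

theorem wedge_one_smul {k : ℕ} (α : CForm V 1) (c : ℂ) (β : CForm V k) :
    wedge (Nat.add_comm 1 k) α (c • β) = c • wedge (Nat.add_comm 1 k) α β := by
  ext v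
  simp only [wedge_one_apply, ContinuousAlternatingMap.smul_apply, smul_eq_mul, Finset.mul_sum]
  exact Finset.sum_congr rfl fun i _ => by ring

/-- Exterior product with a complex covector minus interior product with the corresponding complex
vector, in terms of the real and imaginary parts. -/
theorem wedge_sub_interiorProd_eq_cliff {α : CForm V 1} {a b : V}
    (hα : ∀ v, α (fun _ => v) = ((inner ℝ a v : ℝ) : ℂ) + Complex.I * ((inner ℝ b v : ℝ) : ℂ))
    (θ : ∀ k, CForm V k) (k : ℕ) :
    wedge (Nat.add_comm 1 k) α (θ k) -
        (interiorProd a (θ (k + 2)) + Complex.I • interiorProd b (θ (k + 2))) =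
      cliff a θ (k + 1) + Complex.I • cliff b θ (k + 1) := by
  have h : wedge (Nat.add_comm 1 k) α (θ k) = wedge (Nat.add_comm 1 k) (covec a) (θ k) +
      Complex.I • wedge (Nat.add_comm 1 k) (covec b) (θ k) := by
    ext v
    simp only [wedge_one_apply, ContinuousAlternatingMap.add_apply,
      ContinuousAlternatingMap.smul_apply, smul_eq_mul, Finset.mul_sum]
    rw [← Finset.sum_add_distrib]
    refine Finset.sum_congr rfl fun i _ => ?_
    rw [hα, covec_apply, covec_apply]
    ring
  rw [h]
  simp only [cliff, smul_sub]
  abel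

theorem neg_interiorProd_eq_cliff (a b : V) (θ : ∀ k, CForm V k) :
    -(interiorProd a (θ 1) + Complex.I • interiorProd b (θ 1)) =
      cliff a θ 0 + Complex.I • cliff b θ 0 := by
  simp only [cliff, smul_neg, neg_add]

end InteriorProd

section Pointwise

variable {d : ℕ} {M : Type*} [TopologicalSpace M] [ChartedSpace (EuclideanSpace ℝ (Fin d)) M]
  [RiemannianBundle (fun x : M => TangentSpace (𝓡 d) x)]

/-- Clifford multiplication by the differential of `f`: the multiplication operator
`η ↦ df ∧ η - i_{∇f} η` on forms without any regularity. -/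
def gradCliff (f : M → ℂ) (η : Form d M) : Form d M := wedgeDiff f η - interiorGrad f η

theorem gradCliff_zero_apply (f : M → ℂ) (η : Form d M) (x : M) :
    gradCliff f η 0 x = -(interiorProd (grad (fun y => (f y).re) x) (η 1 x) +
      Complex.I • interiorProd (grad (fun y => (f y).im) x) (η 1 x)) :=
  zero_sub _

theorem gradCliff_succ_apply (f : M → ℂ) (η : Form d M) (k : ℕ) (x : M) :
    gradCliff f η (k + 1) x = wedge (Nat.add_comm 1 k) (diff f x) (η k x) -
      (interiorProd (grad (fun y => (f y).re) x) (η (k + 2) x) +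
        Complex.I • interiorProd (grad (fun y => (f y).im) x) (η (k + 2) x)) := rfl

theorem gradCliff_add (f : M → ℂ) (η θ : Form d M) :
    gradCliff f (η + θ) = gradCliff f η + gradCliff f θ := by
  funext k x
  rcases k with _ | k
  · simp only [Pi.add_apply, gradCliff_zero_apply, interiorProd_add, smul_add]
    abel
  · simp only [Pi.add_apply, gradCliff_succ_apply, interiorProd_add, wedge_one_add, smul_add]
    abel

theorem gradCliff_smul (f : M → ℂ) (c : ℂ) (η : Form d M) :
    gradCliff f (c • η) = c • gradCliff f η := by
  funext k x
  rcases k with _ | k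
  · simp only [Pi.smul_apply, gradCliff_zero_apply, interiorProd_smul, smul_add, smul_neg,
      smul_comm Complex.I c]
  · simp only [Pi.smul_apply, gradCliff_succ_apply, interiorProd_smul, wedge_one_smul, smul_add,
      smul_sub, smul_comm Complex.I c]

variable [IsManifold (𝓡 d) ∞ M]

theorem gradCliff_eq_cliff {f : M → ℂ} {x : M} (hf : MDifferentiableAt (𝓡 d) 𝓘(ℝ, ℂ) f x)
    (η : Form d M) : (fun k => gradCliff f η k x) =
      cliff (grad (fun y => (f y).re) x) (fun k => η k x) +
        Complex.I • cliff (grad (fun y => (f y).im) x) (fun k => η k x) := by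
  funext k
  rcases k with _ | k
  · exact (gradCliff_zero_apply f η x).trans (neg_interiorProd_eq_cliff (V := TSpace d x)
      (grad (fun y => (f y).re) x) (grad (fun y => (f y).im) x) (fun k => η k x))
  · exact (gradCliff_succ_apply f η k x).trans (wedge_sub_interiorProd_eq_cliff (V := TSpace d x)
      (α := diff f x) (a := grad (fun y => (f y).re) x) (b := grad (fun y => (f y).im) x)
      (diff_eq_inner_grad hf) (fun k => η k x) k)

theorem normForm_diff {f : M → ℂ} {x : M} (hf : MDifferentiableAt (𝓡 d) 𝓘(ℝ, ℂ) f x) :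
    normForm (diff (d := d) f x) =
      √(‖grad (d := d) (fun y => (f y).re) x‖ ^ 2 + ‖grad (d := d) (fun y => (f y).im) x‖ ^ 2) := by
  exact congrArg Real.sqrt (normSqForm_one (V := TSpace d x) (diff f x)
    (grad (fun y => (f y).re) x) (grad (fun y => (f y).im) x) (diff_eq_inner_grad hf))

/-- For a complex function, the real and the imaginary part of `df` are treated separately; the
constant `2` has no significance. -/
theorem ptNorm_gradCliff_le {f : M → ℂ} {x : M} (hf : MDifferentiableAt (𝓡 d) 𝓘(ℝ, ℂ) f x)
    (η : Form d M) :
    ptNorm (gradCliff f η) x ≤ 2 * normForm (diff (d := d) f x) * ptNorm η x := by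
  rw [ptNorm, gradCliff_eq_cliff hf]
  refine (normGraded_add_le _ _).trans ?_
  rw [normGraded_smul, Complex.norm_I, one_mul, normGraded_cliff, normGraded_cliff, ← add_mul]
  refine mul_le_mul_of_nonneg_right ?_ (ptNorm_nonneg η x)
  rw [two_mul, normForm_diff hf]
  exact add_le_add (Real.le_sqrt_of_sq_le (le_add_of_nonneg_right (sq_nonneg _)))
    (Real.le_sqrt_of_sq_le (le_add_of_nonneg_left (sq_nonneg _)))

theorem grad_zero (x : M) : grad (d := d) (fun _ : M => (0 : ℝ)) x = 0 := by
  rw [grad, mfderiv_const]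
  exact map_zero _

/-- For a real function, Clifford multiplication by `df` multiplies lengths by `|df|`. -/
theorem ptNorm_gradCliff_of_real {f : M → ℂ} (hre : ∀ x, (f x).im = 0) {x : M}
    (hf : MDifferentiableAt (𝓡 d) 𝓘(ℝ, ℂ) f x) (η : Form d M) :
    ptNorm (gradCliff f η) x = normForm (diff (d := d) f x) * ptNorm η x := by
  have h0 : (fun y => (f y).im) = fun _ => (0 : ℝ) := funext hre
  have h1 : cliff (grad (d := d) (fun y => (f y).im) x) (fun k => η k x) = 0 := by
    rw [h0, grad_zero]
    funext k
    have hi {m : ℕ} (θ : CForm (TSpace d x) (m + 1)) : interiorProd (0 : TSpace d x) θ = 0 := by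
      ext v
      exact θ.map_coord_zero (m := Fin.cons 0 v) 0 rfl
    rcases k with _ | k
    · simp only [cliff, hi, neg_zero]
      rfl
    · have hw : wedge (Nat.add_comm 1 k) (covec (0 : TSpace d x)) (η k x) = 0 := by
        ext v
        rw [wedge_one_apply]
        exact Finset.sum_eq_zero fun i _ => by simp [covec_apply]
      simp only [cliff, hi, hw, sub_zero]
      rfl
  have h3 : Complex.I • (0 : ∀ k, CForm (TSpace d x) k) = 0 :=
    funext fun k => smul_zero (A := CForm (TSpace d x) k) Complex.I
  rw [ptNorm, gradCliff_eq_cliff hf, h1, h3, add_zero, normGraded_cliff, normForm_diff hf,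
    h0, grad_zero]
  simp [ptNorm]

end Pointwise

/-! ### Measurability -/

section Measurable

variable {d : ℕ} {M : Type*} [TopologicalSpace M] [ChartedSpace (EuclideanSpace ℝ (Fin d)) M]
  [RiemannianBundle (fun x : M => TangentSpace (𝓡 d) x)] [IsManifold (𝓡 d) ∞ M]

theorem continuousOn_comp_extChartAt {F : Type*} [TopologicalSpace F] (x₀ : M)
    {g : EuclideanSpace ℝ (Fin d) → F} (hg : ContinuousOn g (extChartAt (𝓡 d) x₀).target) :
    ContinuousOn (fun x => g (extChartAt (𝓡 d) x₀ x)) (extChartAt (𝓡 d) x₀).source :=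
  hg.comp (continuousOn_extChartAt x₀) (extChartAt (𝓡 d) x₀).mapsTo

theorem IsSmooth.continuousOn_component {η : Form d M} (hη : IsSmooth η) (k : ℕ) (x₀ : M)
    (t : Fin k → Fin d) : ContinuousOn (fun x => η k x fun j => coordField x₀ (t j) x)
      (extChartAt (𝓡 d) x₀).source := by
  refine (continuousOn_comp_extChartAt x₀ (g := fun y => inChart x₀ (η k) y
    fun j => EuclideanSpace.single (t j) (1 : ℝ)) ?_).congr fun x hx =>
      (inChart_single_extChartAt x₀ (η k) hx t).symm
  exact (ContinuousAlternatingMap.apply ℝ (EuclideanSpace ℝ (Fin d)) ℂ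
    _).continuous.comp_continuousOn (hη k x₀).continuousOn

theorem continuousOn_diff_coordField {f : M → ℂ} (hf : ContMDiff (𝓡 d) 𝓘(ℝ, ℂ) ∞ f) (x₀ : M)
    (i : Fin d) : ContinuousOn (fun x => diff (d := d) f x fun _ => coordField x₀ i x)
      (extChartAt (𝓡 d) x₀).source := by
  have h2 := ((contDiffOn_comp_symm hf x₀).continuousOn_fderiv_of_isOpen
    (isOpen_extChartAt_target x₀) (by simp)).clm_apply
      (continuousOn_const (c := EuclideanSpace.single i (1 : ℝ)))
  exact (continuousOn_comp_extChartAt x₀ h2).congr fun x hx =>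
    (fderiv_comp_symm hx (hf.mdifferentiableAt (by simp)) _).symm

variable [IsContMDiffRiemannianBundle (𝓡 d) ∞ (EuclideanSpace ℝ (Fin d))
    (fun x : M => TangentSpace (𝓡 d) x)]

theorem continuousOn_gram_inv (x₀ : M) (i j : Fin d) :
    ContinuousOn (fun x => (gram (d := d) x₀ x)⁻¹ i j) (extChartAt (𝓡 d) x₀).source := by
  refine (continuousOn_comp_extChartAt x₀ (g := fun y =>
    (gram (d := d) x₀ ((extChartAt (𝓡 d) x₀).symm y))⁻¹ i j) fun y hy =>
      (contDiffAt_matrix_inv (fun i j => contDiffAt_gram x₀ i j hy)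
        (gram_det_symm_pos x₀ hy).ne' i j).continuousAt.continuousWithinAt).congr fun x hx => ?_
  simp only [(extChartAt (𝓡 d) x₀).left_inv hx]

/-- The interior product with the gradient in coordinates. -/
theorem interiorGrad_coordField {f : M → ℂ} {x : M}
    (hf : MDifferentiableAt (𝓡 d) 𝓘(ℝ, ℂ) f x) {x₀ : M} (hx : x ∈ (extChartAt (𝓡 d) x₀).source)
    {k : ℕ} (η : CForm (TSpace d x) (k + 1)) (t : Fin k → Fin d) :
    (interiorProd (grad (fun y => (f y).re) x) η +
      Complex.I • interiorProd (grad (fun y => (f y).im) x) η)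
        (fun j => coordField x₀ (t j) x) =
    ∑ i, ∑ j, (((gram (d := d) x₀ x)⁻¹ i j : ℝ) : ℂ) *
      (diff (d := d) f x (fun _ => coordField x₀ j x)) *
        η (fun m => coordField x₀ ((Fin.cons i t : Fin (k + 1) → Fin d) m) x) := by
  have hdet := (gram_det_pos x₀ hx).ne'
  rw [← gram_eq_of_coordBasis x₀ hx] at hdet
  have key (a : TSpace d x) : interiorProd a η (fun j => coordField x₀ (t j) x) =
      ∑ i, ∑ j, (((gram (d := d) x₀ x)⁻¹ i j * inner ℝ a (coordField x₀ j x) : ℝ) : ℂ) *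
        η (fun m => coordField x₀ ((Fin.cons i t : Fin (k + 1) → Fin d) m) x) := by
    conv_lhs => rw [eq_sum_gram_inv_smul (coordBasis x₀ hx) hdet a]
    rw [interiorProd_sum_smul, gram_eq_of_coordBasis]
    refine Finset.sum_congr rfl fun i _ => ?_
    rw [Complex.ofReal_sum, Finset.sum_mul]
    refine Finset.sum_congr rfl fun j _ => ?_
    rw [coordBasis_apply, coordBasis_apply]
    congr 2
    funext m
    refine Fin.cases ?_ (fun m => ?_) m <;> simp
  rw [ContinuousAlternatingMap.add_apply, ContinuousAlternatingMap.smul_apply, key, key,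
    smul_eq_mul, Finset.mul_sum, ← Finset.sum_add_distrib]
  refine Finset.sum_congr rfl fun i _ => ?_
  rw [Finset.mul_sum, ← Finset.sum_add_distrib]
  refine Finset.sum_congr rfl fun j _ => ?_
  rw [diff_eq_inner_grad hf]
  push_cast
  ring

variable [MeasurableSpace M] [BorelSpace M]

theorem aemeasurable_of_continuousOn_source {F : Type*} [TopologicalSpace F] [MeasurableSpace F]
    [BorelSpace F] [TopologicalSpace.PseudoMetrizableSpace F] {x₀ : M} {g : M → F}
    (hg : ContinuousOn g (extChartAt (𝓡 d) x₀).source) :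
    AEMeasurable g ((riemVolume d M).restrict (extChartAt (𝓡 d) x₀).source) :=
  hg.aemeasurable (isOpen_extChartAt_source x₀).measurableSet

theorem IsSmooth.isMeas {η : Form d M} (hη : IsSmooth η) : IsMeas η := fun k x₀ t =>
  aemeasurable_of_continuousOn_source (hη.continuousOn_component k x₀ t)

theorem IsMeas.gradCliff {f : M → ℂ} (hf : ContMDiff (𝓡 d) 𝓘(ℝ, ℂ) ∞ f) {η : Form d M}
    (hη : IsMeas η) : IsMeas (gradCliff f η) := by
  intro k x₀ t
  have hf' (x : M) : MDifferentiableAt (𝓡 d) 𝓘(ℝ, ℂ) f x := hf.mdifferentiableAt (by simp)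
  have hS : MeasurableSet (extChartAt (𝓡 d) x₀).source :=
    (isOpen_extChartAt_source x₀).measurableSet
  have hdiff (i : Fin d) := aemeasurable_of_continuousOn_source
    (continuousOn_diff_coordField hf x₀ i)
  have hint : AEMeasurable (fun x => (interiorProd (grad (fun y => (f y).re) x) (η (k + 1) x) +
      Complex.I • interiorProd (grad (fun y => (f y).im) x) (η (k + 1) x))
        (fun j => coordField x₀ (t j) x))
      ((riemVolume d M).restrict (extChartAt (𝓡 d) x₀).source) := by
    refine AEMeasurable.congr (f := fun x => ∑ i, ∑ j, (((gram (d := d) x₀ x)⁻¹ i j : ℝ) : ℂ) *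
      (diff (d := d) f x (fun _ => coordField x₀ j x)) *
        η (k + 1) x (fun m => coordField x₀ ((Fin.cons i t : Fin (k + 1) → Fin d) m) x)) ?_ ?_
    · refine Finset.aemeasurable_fun_sum _ fun i _ => Finset.aemeasurable_fun_sum _ fun j _ => ?_
      refine AEMeasurable.mul (AEMeasurable.mul ?_ (hdiff j)) (hη _ _ _)
      exact Complex.measurable_ofReal.comp_aemeasurable
        (aemeasurable_of_continuousOn_source (continuousOn_gram_inv x₀ i j))
    · filter_upwards [ae_restrict_mem hS] with x hx
      exact (interiorGrad_coordField (hf' x) hx (η (k + 1) x) t).symm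
  rcases k with _ | k
  · refine hint.neg.congr (ae_of_all _ fun x => ?_)
    exact (congrArg (fun α : CForm (TSpace d x) 0 => α fun j => coordField x₀ (t j) x)
      (gradCliff_zero_apply f η x)).symm
  · have hw : AEMeasurable (fun x => wedge (Nat.add_comm 1 k) (diff f x) (η k x)
        (fun j => coordField x₀ (t j) x))
        ((riemVolume d M).restrict (extChartAt (𝓡 d) x₀).source) := by
      simp only [wedge_one_apply]
      refine Finset.aemeasurable_fun_sum _ fun i _ => AEMeasurable.const_mul ?_ _
      exact (hdiff (t i)).mul (hη k x₀ (i.removeNth t))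
    exact hw.sub hint

end Measurable

/-! ### The operator on `L^p` and its norm -/

section MultiplicationBound

/-- If multiplication by `g` is bounded by `c` in `L^p` on indicator functions, then `|g| ≤ c`
almost everywhere. -/
theorem eLpNorm_top_le_of_forall_indicator {α : Type*} [MeasurableSpace α] {μ : Measure α}
    [SigmaFinite μ] {g : α → ℝ} (hg : AEMeasurable g μ) {p : ℝ≥0∞} (hp0 : p ≠ 0) (hp : p ≠ ⊤)
    {c : ℝ≥0∞} (h : ∀ A, MeasurableSet A → μ A < ⊤ →
      eLpNorm (A.indicator g) p μ ≤ c * eLpNorm (A.indicator fun _ => (1 : ℝ)) p μ) :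
    eLpNorm g ⊤ μ ≤ c := by
  have hpos : 0 < p.toReal := ENNReal.toReal_pos hp0 hp
  have key : (fun x => ‖g x‖ₑ ^ p.toReal) ≤ᵐ[μ] fun _ => c ^ p.toReal := by
    refine ae_le_of_forall_setLIntegral_le_of_sigmaFinite₀ (hg.enorm.pow_const _) fun A hA hμ => ?_
    have h1 := ENNReal.rpow_le_rpow (h A hA hμ) hpos.le
    rw [ENNReal.mul_rpow_of_nonneg _ _ hpos.le, eLpNorm_indicator_eq_eLpNorm_restrict hA,
      eLpNorm_indicator_eq_eLpNorm_restrict hA, eLpNorm_eq_lintegral_rpow_enorm_toReal hp0 hp,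
      eLpNorm_eq_lintegral_rpow_enorm_toReal hp0 hp, ← ENNReal.rpow_mul, ← ENNReal.rpow_mul,
      one_div, inv_mul_cancel₀ hpos.ne', ENNReal.rpow_one, ENNReal.rpow_one] at h1
    simpa using h1
  rw [eLpNorm_exponent_top]
  refine eLpNormEssSup_le_of_ae_enorm_bound ?_
  filter_upwards [key] with x hx
  exact (ENNReal.rpow_le_rpow_iff hpos).1 hx

end MultiplicationBound

section Constant

variable {V : Type*} [NormedAddCommGroup V] [InnerProductSpace ℝ V] [FiniteDimensional ℝ V]

/-- The form of degree `0` with the value `c`, all other components being `0`. -/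
def constGraded (V : Type*) [NormedAddCommGroup V] [InnerProductSpace ℝ V] (c : ℂ) :
    ∀ k, CForm V k
  | 0 => ContinuousAlternatingMap.constOfIsEmpty ℝ V (Fin 0) c
  | _ + 1 => 0

theorem normGraded_constGraded (c : ℂ) : normGraded (constGraded V c) = ‖c‖ := by
  have h0 : normSqForm (constGraded V c 0) = ‖c‖ ^ 2 := by
    rw [normSqForm, Fintype.sum_unique]
    simp [constGraded]
  rw [normGraded, Finset.sum_range_succ', Finset.sum_eq_zero, zero_add, h0,
    Real.sqrt_sq (norm_nonneg c)]
  intro k _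
  simp [normSqForm, constGraded]

end Constant

section Operator

variable {d : ℕ} {M : Type*} [TopologicalSpace M] [ChartedSpace (EuclideanSpace ℝ (Fin d)) M]
  [RiemannianBundle (fun x : M => TangentSpace (𝓡 d) x)] [MeasurableSpace M]
  [SecondCountableTopology M] [BorelSpace M] [IsManifold (𝓡 d) ∞ M]
  [IsContMDiffRiemannianBundle (𝓡 d) ∞ (EuclideanSpace ℝ (Fin d))
    (fun x : M => TangentSpace (𝓡 d) x)]

/-- The function `c` as a form of degree `0`. -/
def scalarForm (c : M → ℂ) : Form d M := fun k x => constGraded (TSpace d x) (c x) k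

theorem ptNorm_scalarForm (c : M → ℂ) (x : M) : ptNorm (scalarForm (d := d) c) x = ‖c x‖ :=
  normGraded_constGraded (V := TSpace d x) (c x)

theorem isMeas_scalarForm {c : M → ℂ} (hc : Measurable c) : IsMeas (scalarForm (d := d) c) := by
  intro k x₀ t
  rcases k with _ | k
  · exact hc.aemeasurable
  · exact aemeasurable_const

theorem ae_normForm_diff_le {f : M → ℂ} (hS : supNormDiff (d := d) f < ⊤) :
    ∀ᵐ x ∂riemVolume d M, normForm (diff (d := d) f x) ≤ (supNormDiff (d := d) f).toReal := by
  have h := ae_le_eLpNormEssSup (f := fun x => normForm (diff (d := d) f x)) (μ := riemVolume d M)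
  rw [← eLpNorm_exponent_top] at h
  filter_upwards [h] with x hx
  have h2 := ENNReal.toReal_mono hS.ne hx
  rw [toReal_enorm] at h2
  exact (Real.le_norm_self _).trans h2

theorem eLpNorm_ptNorm_le_mul {η θ : Form d M} {c : ℝ} (p : ℝ≥0∞)
    (h : ∀ᵐ x ∂riemVolume d M, ptNorm η x ≤ c * ptNorm θ x) :
    eLpNorm (ptNorm η) p (riemVolume d M) ≤
      ENNReal.ofReal c * eLpNorm (ptNorm θ) p (riemVolume d M) := by
  refine eLpNorm_le_mul_eLpNorm_of_ae_le_mul (h.mono fun x hx => ?_) p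
  rwa [Real.norm_of_nonneg (ptNorm_nonneg _ _), Real.norm_of_nonneg (ptNorm_nonneg _ _)]

theorem ae_ptNorm_gradCliff_le {f : M → ℂ} (hf : ContMDiff (𝓡 d) 𝓘(ℝ, ℂ) ∞ f)
    (hS : supNormDiff (d := d) f < ⊤) (η : Form d M) :
    ∀ᵐ x ∂riemVolume d M,
      ptNorm (gradCliff f η) x ≤ (2 * (supNormDiff (d := d) f).toReal) * ptNorm η x := by
  filter_upwards [ae_normForm_diff_le hS] with x hx
  refine (ptNorm_gradCliff_le (hf.mdifferentiableAt (by simp)) η).trans ?_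
  have := ptNorm_nonneg η x
  gcongr

variable {p : ℝ≥0∞} [Fact (1 ≤ p)]

theorem norm_toLp {η : Form d M} (h : η ∈ lpForms d M p) :
    ‖toLp η h‖ = (eLpNorm (ptNorm η) p (riemVolume d M)).toReal := rfl

theorem toLp_surjective (ξ : LpForms d M p) : ∃ (η : Form d M) (h : η ∈ lpForms d M p),
    toLp η h = ξ := by
  obtain ⟨η, rfl⟩ := SeparationQuotient.surjective_mk ξ
  exact ⟨η.1, η.2, rfl⟩

theorem toLp_sub {η θ : Form d M} (hη : η ∈ lpForms d M p) (hθ : θ ∈ lpForms d M p) :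
    toLp η hη - toLp θ hθ = toLp (η - θ) (Submodule.sub_mem _ hη hθ) := rfl

theorem gradCliff_mem_lpForms {f : M → ℂ} (hf : ContMDiff (𝓡 d) 𝓘(ℝ, ℂ) ∞ f)
    (hS : supNormDiff (d := d) f < ⊤) {η : Form d M} (hη : η ∈ lpForms d M p) :
    gradCliff f η ∈ lpForms d M p :=
  ⟨hη.1.gradCliff hf, (eLpNorm_ptNorm_le_mul p (ae_ptNorm_gradCliff_le hf hS η)).trans_lt
    (ENNReal.mul_lt_top ENNReal.ofReal_lt_top hη.2)⟩

theorem norm_toLp_le_mul {η θ : Form d M} (hη : η ∈ lpForms d M p) (hθ : θ ∈ lpForms d M p)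
    {c : ℝ} (hc : 0 ≤ c) (h : ∀ᵐ x ∂riemVolume d M, ptNorm η x ≤ c * ptNorm θ x) :
    ‖toLp η hη‖ ≤ c * ‖toLp θ hθ‖ := by
  rw [norm_toLp, norm_toLp, ← ENNReal.toReal_ofReal hc, ← ENNReal.toReal_mul]
  exact ENNReal.toReal_mono (ENNReal.mul_lt_top ENNReal.ofReal_lt_top hθ.2).ne
    (eLpNorm_ptNorm_le_mul p h)

/-- Clifford multiplication by `df` on the forms with finite `L^p`-norm. -/
def gradCliffPreLp (f : M → ℂ) (hf : ContMDiff (𝓡 d) 𝓘(ℝ, ℂ) ∞ f)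
    (hS : supNormDiff (d := d) f < ⊤) : PreLp d M p →L[ℂ] PreLp d M p :=
  LinearMap.mkContinuous
    { toFun := fun η => (⟨gradCliff f η.1, gradCliff_mem_lpForms hf hS η.2⟩ : lpForms d M p)
      map_add' := fun η θ => Subtype.ext (gradCliff_add f η.1 θ.1)
      map_smul' := fun c η => Subtype.ext (gradCliff_smul f c η.1) }
    (2 * (supNormDiff (d := d) f).toReal) fun η =>
      norm_toLp_le_mul (gradCliff_mem_lpForms hf hS η.2) η.2 (by positivity)
        (ae_ptNorm_gradCliff_le hf hS η.1)

/-- Clifford multiplication by `df` as a bounded operator on `L^p(Ω^•(M))`. -/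
def gradCliffLp (f : M → ℂ) (hf : ContMDiff (𝓡 d) 𝓘(ℝ, ℂ) ∞ f)
    (hS : supNormDiff (d := d) f < ⊤) : LpForms d M p →L[ℂ] LpForms d M p :=
  SeparationQuotient.liftCLM ((SeparationQuotient.mkCLM ℂ (PreLp d M p)).comp
    (gradCliffPreLp f hf hS)) fun _ _ h =>
      SeparationQuotient.mk_eq_mk.2 (h.map (gradCliffPreLp f hf hS).continuous)

theorem gradCliffLp_toLp {f : M → ℂ} (hf : ContMDiff (𝓡 d) 𝓘(ℝ, ℂ) ∞ f)
    (hS : supNormDiff (d := d) f < ⊤) {η : Form d M} (hη : η ∈ lpForms d M p) :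
    gradCliffLp f hf hS (toLp η hη) = toLp (gradCliff f η) (gradCliff_mem_lpForms hf hS hη) := rfl

/-- Clifford multiplication by the differential of a real function scales pointwise norms by `|df|`,
so its norm on `L^p` is that of the multiplication by `|df|`, the essential supremum. -/
theorem norm_gradCliffLp_of_real {f : M → ℂ} (hf : ContMDiff (𝓡 d) 𝓘(ℝ, ℂ) ∞ f)
    (hre : ∀ x, (f x).im = 0) (hp : p ≠ ⊤) (hS : supNormDiff (d := d) f < ⊤) :
    ‖gradCliffLp (p := p) f hf hS‖ = (supNormDiff (d := d) f).toReal := by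
  have hpt (η : Form d M) (x : M) : ptNorm (gradCliff f η) x =
      normForm (diff (d := d) f x) * ptNorm η x :=
    ptNorm_gradCliff_of_real hre (hf.mdifferentiableAt (by simp)) η
  refine le_antisymm (ContinuousLinearMap.opNorm_le_bound _ ENNReal.toReal_nonneg fun ξ => ?_) ?_
  · obtain ⟨η, hη, rfl⟩ := toLp_surjective ξ
    rw [gradCliffLp_toLp]
    refine norm_toLp_le_mul _ hη ENNReal.toReal_nonneg ?_
    filter_upwards [ae_normForm_diff_le hS] with x hx
    rw [hpt]
    exact mul_le_mul_of_nonneg_right hx (ptNorm_nonneg η x)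
  set c := ‖gradCliffLp (p := p) f hf hS‖ with hc
  have hp0 : p ≠ 0 := (zero_lt_one.trans_le (Fact.out : 1 ≤ p)).ne'
  have hmeas : AEMeasurable (fun x => normForm (diff (d := d) f x)) (riemVolume d M) := by
    refine (aemeasurable_ptNorm ((isMeas_scalarForm (d := d) (M := M)
      (measurable_const (a := (1 : ℂ)))).gradCliff hf)).congr (ae_of_all _ fun x => ?_)
    rw [hpt, ptNorm_scalarForm, norm_one, mul_one]
  refine ENNReal.toReal_le_of_le_ofReal (norm_nonneg _)
    (eLpNorm_top_le_of_forall_indicator hmeas hp0 hp fun A hA hμ => ?_)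
  -- test the operator on the indicator function of `A`, as a form of degree `0`
  set η : Form d M := scalarForm (A.indicator fun _ => (1 : ℂ)) with hη
  have hη1 : ptNorm η = A.indicator fun _ => (1 : ℝ) := by
    funext x
    rw [hη, ptNorm_scalarForm]
    by_cases hx : x ∈ A <;> simp [hx]
  have hη2 : ptNorm (gradCliff f η) = A.indicator fun x => normForm (diff (d := d) f x) := by
    funext x
    rw [hpt, hη1]
    by_cases hx : x ∈ A <;> simp [hx]
  have hmem : η ∈ lpForms d M p := ⟨isMeas_scalarForm (measurable_const.indicator hA), by
    rw [hη1]
    exact (memLp_indicator_const p hA 1 (Or.inr hμ.ne)).eLpNorm_lt_top⟩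
  have h := (gradCliffLp f hf hS).le_opNorm (toLp η hmem)
  rw [gradCliffLp_toLp, norm_toLp, norm_toLp, hη1, hη2, ← hc] at h
  rw [← hη1, ← hη2] at h ⊢
  rw [← ENNReal.ofReal_toReal (gradCliff_mem_lpForms hf hS hmem).2.ne,
    ← ENNReal.ofReal_toReal hmem.2.ne, ← ENNReal.ofReal_mul (norm_nonneg _)]
  exact ENNReal.ofReal_le_ofReal h

end Operator

/-! ### Bounds for components -/

section Bound

variable {V : Type*} [NormedAddCommGroup V] [InnerProductSpace ℝ V] [FiniteDimensional ℝ V]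

theorem norm_apply_orthonormal_le {k : ℕ} (α : CForm V k)
    (t : Fin k → Fin (Module.finrank ℝ V)) :
    ‖α fun j => stdOrthonormalBasis ℝ V (t j)‖ ≤ √(k ! : ℝ) * normForm α := by
  have hk : (0 : ℝ) < k ! := by positivity
  rw [normForm, ← Real.sqrt_mul hk.le, normSqForm, ← mul_assoc, mul_inv_cancel₀ hk.ne', one_mul]
  refine Real.le_sqrt_of_sq_le ?_
  exact Finset.single_le_sum
    (f := fun t : Fin k → Fin (Module.finrank ℝ V) =>
      ‖α fun j => stdOrthonormalBasis ℝ V (t j)‖ ^ 2) (fun _ _ => sq_nonneg _) (Finset.mem_univ t)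

/-- The operator norm of a form is bounded by its Euclidean norm. -/
theorem norm_apply_le {k : ℕ} (α : CForm V k) (v : Fin k → V) :
    ‖α v‖ ≤ (Module.finrank ℝ V : ℝ) ^ k * √(k ! : ℝ) * (∏ j, ‖v j‖) * normForm α := by
  set e := stdOrthonormalBasis ℝ V with he
  have hexp : α v = ∑ s : Fin k → Fin (Module.finrank ℝ V),
      (∏ j, inner ℝ (e (s j)) (v j)) • α (fun j => e (s j)) := by
    have hv : v = fun j => ∑ i, (inner ℝ (e i) (v j) : ℝ) • e i := by
      funext j; exact (e.sum_repr' (v j)).symm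
    conv_lhs => rw [hv]
    exact (α.toMultilinearMap.map_sum (fun j i => (inner ℝ (e i) (v j) : ℝ) • e i)).trans
      (Finset.sum_congr rfl fun s _ =>
        α.toMultilinearMap.map_smul_univ (fun j => (inner ℝ (e (s j)) (v j) : ℝ))
          (fun j => e (s j)))
  have hterm (s : Fin k → Fin (Module.finrank ℝ V)) :
      ‖(∏ j, (inner ℝ (e (s j)) (v j) : ℝ)) • α (fun j => e (s j))‖ ≤
        (∏ j, ‖v j‖) * (√(k ! : ℝ) * normForm α) := by
    rw [norm_smul, norm_prod]
    refine mul_le_mul (Finset.prod_le_prod (fun _ _ => norm_nonneg _) fun j _ => ?_)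
      (norm_apply_orthonormal_le α s) (norm_nonneg _) (Finset.prod_nonneg fun _ _ => norm_nonneg _)
    refine (norm_inner_le_norm _ _).trans_eq ?_
    rw [e.norm_eq_one, one_mul]
  rw [hexp]
  refine (norm_sum_le _ _).trans ((Finset.sum_le_sum fun s _ => hterm s).trans_eq ?_)
  rw [Finset.sum_const, Finset.card_univ, Fintype.card_fun, Fintype.card_fin, Fintype.card_fin,
    nsmul_eq_mul]
  push_cast
  ring

theorem normForm_le_normGraded (θ : ∀ k, CForm V k) {k : ℕ} (hk : k ≤ Module.finrank ℝ V) :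
    normForm (θ k) ≤ normGraded θ :=
  Real.sqrt_le_sqrt (Finset.single_le_sum (f := fun k => normSqForm (θ k))
    (fun k _ => mul_nonneg (by positivity) (Finset.sum_nonneg fun _ _ => sq_nonneg _))
    (Finset.mem_range.2 (Nat.lt_succ_of_le hk)))

end Bound

/-! ### Smooth forms with support in a chart -/

section SmoothForms

variable {d : ℕ} {M : Type*} [TopologicalSpace M] [ChartedSpace (EuclideanSpace ℝ (Fin d)) M]

theorem isSmooth_single {k : ℕ} {κ : KForm d M k}
    (h : ∀ x₁, ContDiffOn ℝ ∞ (inChart x₁ κ) (extChartAt (𝓡 d) x₁).target) :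
    IsSmooth (Pi.single k κ : Form d M) := by
  intro m x₁
  by_cases hm : m = k
  · subst hm
    rw [Pi.single_eq_same]
    exact h x₁
  · rw [Pi.single_eq_of_ne hm]
    exact contDiffOn_const (c := (0 : CForm (EuclideanSpace ℝ (Fin d)) m))

theorem IsSmooth.add {η θ : Form d M} (hη : IsSmooth η) (hθ : IsSmooth θ) : IsSmooth (η + θ) :=
  fun k x₀ => (hη k x₀).add (hθ k x₀)

theorem IsSmooth.const_smul {η : Form d M} (hη : IsSmooth η) (c : ℂ) : IsSmooth (c • η) :=
  fun k x₀ => (contDiffOn_const (c := c)).smul (hη k x₀)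

theorem isSmooth_zero : IsSmooth (0 : Form d M) := fun k _ =>
  contDiffOn_const (c := (0 : CForm (EuclideanSpace ℝ (Fin d)) k))

theorem IsSmooth.mulOp [IsManifold (𝓡 d) ∞ M] {η : Form d M} (hη : IsSmooth η) {g : M → ℂ}
    (hg : ContMDiff (𝓡 d) 𝓘(ℝ, ℂ) ∞ g) : IsSmooth (mulOp g η) := fun k x₀ =>
  (contDiffOn_comp_symm hg x₀).smul (hη k x₀)

theorem IsCompactlySupported.mulOp {η : Form d M} (hη : IsCompactlySupported η) (g : M → ℂ) :
    IsCompactlySupported (mulOp g η) := by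
  obtain ⟨K, hK, h⟩ := hη
  exact ⟨K, hK, fun x hx k => by
    rw [HodgeDirac.mulOp, h x hx k]; exact smul_zero (A := CForm (TSpace d x) k) (g x)⟩

theorem IsCompactlySupported.add {η θ : Form d M} (hη : IsCompactlySupported η)
    (hθ : IsCompactlySupported θ) : IsCompactlySupported (η + θ) := by
  obtain ⟨K, hK, h⟩ := hη
  obtain ⟨L, hL, h'⟩ := hθ
  refine ⟨K ∪ L, hK.union hL, fun x hx k => ?_⟩
  rw [Pi.add_apply, Pi.add_apply, h x (fun hx' => hx (Or.inl hx')) k,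
    h' x (fun hx' => hx (Or.inr hx')) k, add_zero]

/-- The pull-back by the chart at `x₀` of the constant form `dualForm t`. -/
def chartForm (x₀ : M) {k : ℕ} (t : Fin k → Fin d) : KForm d M k := fun x =>
  (dualForm t).compContinuousLinearMap
    (mfderiv (𝓡 d) 𝓘(ℝ, EuclideanSpace ℝ (Fin d)) (extChartAt (𝓡 d) x₀) x)

theorem inChart_smul_chartForm_apply (x₀ x₁ : M) (χ : M → ℂ) {k : ℕ} (t : Fin k → Fin d)
    (y : EuclideanSpace ℝ (Fin d)) (u : Fin k → EuclideanSpace ℝ (Fin d)) :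
    inChart x₁ (fun x => χ x • chartForm x₀ t x) y u = χ ((extChartAt (𝓡 d) x₁).symm y) *
      dualForm t fun j =>
        (chartD x₀ ((extChartAt (𝓡 d) x₁).symm y)).comp (symmD x₁ y) (u j) := rfl

variable [IsManifold (𝓡 d) ∞ M]

/-- A cut-off function times a coordinate form is a smooth form on the whole manifold. -/
theorem contDiffOn_inChart_smul_chartForm (x₀ x₁ : M) {χ : M → ℂ}
    (hχ : ContMDiff (𝓡 d) 𝓘(ℝ, ℂ) ∞ χ) (hsupp : tsupport χ ⊆ (extChartAt (𝓡 d) x₀).source)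
    {k : ℕ} (t : Fin k → Fin d) :
    ContDiffOn ℝ ∞ (inChart x₁ (fun x => χ x • chartForm x₀ t x))
      (extChartAt (𝓡 d) x₁).target := by
  intro y hy
  refine ContDiffAt.contDiffWithinAt ?_
  have hnhds : (extChartAt (𝓡 d) x₁).target ∈ 𝓝 y := (isOpen_extChartAt_target x₁).mem_nhds hy
  have hcont : ContinuousAt (extChartAt (𝓡 d) x₁).symm y :=
    (continuousOn_extChartAt_symm x₁).continuousAt hnhds
  -- in the domain of the chart at `x₀` the pull-back is by the change of coordinates; outside of it
  -- the cut-off function vanishes near the point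
  by_cases hz : (extChartAt (𝓡 d) x₁).symm y ∈ (extChartAt (𝓡 d) x₀).source
  · have hev : ∀ᶠ y' in 𝓝 y, (extChartAt (𝓡 d) x₁).symm y' ∈ (extChartAt (𝓡 d) x₀).source :=
      hcont.eventually ((isOpen_extChartAt_source x₀).mem_nhds hz)
    set cc : EuclideanSpace ℝ (Fin d) → EuclideanSpace ℝ (Fin d) := fun z =>
      extChartAt (𝓡 d) x₀ ((extChartAt (𝓡 d) x₁).symm z) with hcc
    have hccs : ContDiffAt ℝ ∞ cc y := by
      rw [← contMDiffAt_iff_contDiffAt]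
      have h1 : ContMDiffAt (𝓡 d) 𝓘(ℝ, EuclideanSpace ℝ (Fin d)) ∞ (extChartAt (𝓡 d) x₀)
          ((extChartAt (𝓡 d) x₁).symm y) :=
        contMDiffAt_extChartAt' (by rwa [extChartAt_source] at hz)
      exact h1.comp y ((contMDiffOn_extChartAt_symm x₁).contMDiffAt hnhds)
    have hD : ContDiffAt ℝ ∞ (fderiv ℝ cc) y := hccs.fderiv_right (by simp)
    refine contDiffAt_of_components fun s => ?_
    have hmul : ContDiffAt ℝ ∞ (fun y' => dualForm t fun j =>
        fderiv ℝ cc y' (EuclideanSpace.single (s j) (1 : ℝ))) y :=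
      ((dualForm t).toContinuousMultilinearMap.contDiff.contDiffAt).comp y
        (contDiffAt_pi.2 fun j => hD.clm_apply contDiffAt_const)
    refine (((contDiffOn_comp_symm hχ x₁).contDiffAt hnhds).mul hmul).congr_of_eventuallyEq ?_
    filter_upwards [hev, hnhds] with y' hy' hy'1
    rw [inChart_smul_chartForm_apply, (hasFDerivAt_coordChange hy'1 hy').fderiv]
  · have hev : ∀ᶠ y' in 𝓝 y, (extChartAt (𝓡 d) x₁).symm y' ∈ (tsupport χ)ᶜ :=
      hcont.eventually ((isClosed_tsupport χ).isOpen_compl.mem_nhds fun h => hz (hsupp h))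
    refine contDiffAt_const (c := (0 : CForm (EuclideanSpace ℝ (Fin d)) k)).congr_of_eventuallyEq ?_
    filter_upwards [hev] with y' hy'
    ext u
    rw [inChart_smul_chartForm_apply, image_eq_zero_of_notMem_tsupport hy', zero_mul]
    rfl

theorem eq_sum_chartForm (x₀ : M) {x : M} (hx : x ∈ (extChartAt (𝓡 d) x₀).source) {k : ℕ}
    (η : KForm d M k) :
    η x = ∑ t : Fin k → Fin d, (η x fun j => coordField x₀ (t j) x) • chartForm x₀ t x := by
  have h1 := eq_sum_dualForm (inChart x₀ η (extChartAt (𝓡 d) x₀ x))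
  have h2 : ∀ v : Fin k → EuclideanSpace ℝ (Fin d), formAt η x v =
      ∑ t : Fin k → Fin d, (η x fun j => coordField x₀ (t j) x) *
        dualForm t fun j => chartD x₀ x (v j) := by
    intro v
    rw [← inChart_chartD hx, h1, ContinuousAlternatingMap.sum_apply]
    refine Finset.sum_congr rfl fun t _ => ?_
    rw [ContinuousAlternatingMap.smul_apply, inChart_single_extChartAt x₀ η hx, smul_eq_mul]
  ext v
  refine (h2 v).trans ?_
  rw [ContinuousAlternatingMap.sum_apply]
  rfl

end SmoothForms

/-! ### Continuity of the pointwise norm -/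

section Norm

variable {d : ℕ} {M : Type*} [TopologicalSpace M] [ChartedSpace (EuclideanSpace ℝ (Fin d)) M]
  [RiemannianBundle (fun x : M => TangentSpace (𝓡 d) x)]

theorem ptNorm_mulOp (g : M → ℂ) (η : Form d M) (x : M) :
    ptNorm (mulOp g η) x = ‖g x‖ * ptNorm η x :=
  normGraded_smul (V := TSpace d x) (g x) (fun k => η k x)

theorem IsMeas.mulOp [MeasurableSpace M] {η : Form d M} (hη : IsMeas η) {g : M → ℂ}
    (hg : AEMeasurable g (riemVolume d M)) : IsMeas (mulOp g η) := fun k x₀ t =>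
  hg.restrict.mul (hη k x₀ t)

variable [IsManifold (𝓡 d) ∞ M]
  [IsContMDiffRiemannianBundle (𝓡 d) ∞ (EuclideanSpace ℝ (Fin d))
    (fun x : M => TangentSpace (𝓡 d) x)]

theorem ptNorm_eq_gram (x₀ : M) {x : M} (hx : x ∈ (extChartAt (𝓡 d) x₀).source) (η : Form d M) :
    ptNorm η x = √(∑ k ∈ Finset.range (d + 1),
      (k ! : ℝ)⁻¹ * ∑ s : Fin k → Fin d, ∑ s' : Fin k → Fin d,
        (∏ j, (gram (d := d) x₀ x)⁻¹ (s j) (s' j)) *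
          (η k x (fun j => coordField x₀ (s j) x) *
            star (η k x fun j => coordField x₀ (s' j) x)).re) := by
  rw [ptNorm, normGraded, (Fact.out : Module.finrank ℝ (TSpace d x) = d)]
  congr 1
  refine Finset.sum_congr rfl fun k _ => ?_
  rw [normSqForm_eq_gram (coordBasis x₀ hx), gram_eq_of_coordBasis]
  simp only [coordBasis_apply]

theorem IsSmooth.continuous_ptNorm {η : Form d M} (hη : IsSmooth η) :
    Continuous (ptNorm η) := by
  refine continuous_iff_continuousAt.2 fun x₀ => ?_
  have h : ContinuousOn (ptNorm η) (extChartAt (𝓡 d) x₀).source := by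
    refine ContinuousOn.congr (f := fun x => √(∑ k ∈ Finset.range (d + 1),
      (k ! : ℝ)⁻¹ * ∑ s : Fin k → Fin d, ∑ s' : Fin k → Fin d,
        (∏ j, (gram (d := d) x₀ x)⁻¹ (s j) (s' j)) *
          (η k x (fun j => coordField x₀ (s j) x) *
            star (η k x fun j => coordField x₀ (s' j) x)).re)) ?_
        fun x hx => ptNorm_eq_gram x₀ hx η
    refine ContinuousOn.sqrt (continuousOn_finsetSum _ fun k _ => continuousOn_const.mul
      (continuousOn_finsetSum _ fun s _ => continuousOn_finsetSum _ fun s' _ =>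
        (continuousOn_finsetProd _ fun j _ => continuousOn_gram_inv x₀ _ _).mul
          (Complex.continuous_re.comp_continuousOn
            ((hη.continuousOn_component k x₀ s).mul (hη.continuousOn_component k x₀ s').star))))
  exact h.continuousAt ((isOpen_extChartAt_source x₀).mem_nhds (mem_extChartAt_source x₀))

/-- On a compact subset of a chart domain the components of a form are bounded by its norm. -/
theorem exists_norm_component_le (x₀ : M) {K : Set M} (hK : IsCompact K)
    (hKs : K ⊆ (extChartAt (𝓡 d) x₀).source) {k : ℕ} (hk : k ≤ d) (t : Fin k → Fin d) :
    ∃ c : ℝ, 0 ≤ c ∧ ∀ (η : Form d M), ∀ x ∈ K,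
      ‖η k x fun j => coordField x₀ (t j) x‖ ≤ c * ptNorm η x := by
  have hcont : ContinuousOn (fun x => ∏ j, √(gram (d := d) x₀ x (t j) (t j))) K := by
    refine continuousOn_finsetProd _ fun j _ => ContinuousOn.sqrt ?_
    refine (gram_continuousOn x₀ (t j) (t j)).mono ?_
    rwa [extChartAt_source] at hKs
  obtain ⟨B, hB⟩ := hK.exists_bound_of_continuousOn hcont
  refine ⟨(d : ℝ) ^ k * √(k ! : ℝ) * max B 0, by positivity, fun η x hx => ?_⟩
  have h1 := norm_apply_le (V := TSpace d x) (η k x) fun j => coordField x₀ (t j) x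
  rw [(Fact.out : Module.finrank ℝ (TSpace d x) = d)] at h1
  have h2 : ∏ j, ‖coordField x₀ (t j) x‖ ≤ max B 0 := by
    refine le_trans (le_of_eq ?_) (((Real.le_norm_self _).trans (hB x hx)).trans (le_max_left _ _))
    refine Finset.prod_congr rfl fun j _ => ?_
    rw [gram, Matrix.of_apply, real_inner_self_eq_norm_sq, Real.sqrt_sq (norm_nonneg _)]
  have h3 : normForm (η k x) ≤ ptNorm η x :=
    normForm_le_normGraded (V := TSpace d x) (fun k => η k x)
      (by rwa [(Fact.out : Module.finrank ℝ (TSpace d x) = d)])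
  refine h1.trans (mul_le_mul (mul_le_mul_of_nonneg_left h2 (by positivity)) h3
    (Real.sqrt_nonneg _) (by positivity))

end Norm

/-! ### Density of the smooth forms with compact support -/

section Density

variable {d : ℕ} {M : Type*} [TopologicalSpace M] [ChartedSpace (EuclideanSpace ℝ (Fin d)) M]
  [RiemannianBundle (fun x : M => TangentSpace (𝓡 d) x)] [MeasurableSpace M]
  [SecondCountableTopology M] [BorelSpace M] [IsManifold (𝓡 d) ∞ M]
  [IsContMDiffRiemannianBundle (𝓡 d) ∞ (EuclideanSpace ℝ (Fin d))
    (fun x : M => TangentSpace (𝓡 d) x)]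
  {p : ℝ≥0∞} [Fact (1 ≤ p)]

theorem eLpNorm_ptNorm_zero : eLpNorm (ptNorm (0 : Form d M)) p (riemVolume d M) = 0 := by
  rw [← zero_smul ℂ (0 : Form d M), eLpNorm_ptNorm_smul, enorm_zero, zero_mul]

variable (d M p) in
/-- The `L^p`-forms that are limits in `L^p` of smooth forms with compact support. -/
def approxForms : AddSubmonoid (Form d M) where
  carrier := {η | η ∈ lpForms d M p ∧ ∀ ε : ℝ≥0∞, ε ≠ 0 → ∃ θ ∈ lpForms d M p,
    IsSmooth θ ∧ IsCompactlySupported θ ∧ eLpNorm (ptNorm (η - θ)) p (riemVolume d M) ≤ ε}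
  zero_mem' := ⟨Submodule.zero_mem _, fun ε _ => ⟨0, Submodule.zero_mem _, isSmooth_zero,
    ⟨∅, isCompact_empty, fun _ _ _ => rfl⟩, by
      rw [sub_zero, eLpNorm_ptNorm_zero]; exact zero_le⟩⟩
  add_mem' {η η'} hη hη' := by
    refine ⟨Submodule.add_mem _ hη.1 hη'.1, fun ε hε => ?_⟩
    obtain ⟨θ, hθ, hs, hc, hle⟩ := hη.2 (ε / 2) (ENNReal.half_pos hε).ne'
    obtain ⟨θ', hθ', hs', hc', hle'⟩ := hη'.2 (ε / 2) (ENNReal.half_pos hε).ne'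
    refine ⟨θ + θ', Submodule.add_mem _ hθ hθ', hs.add hs', hc.add hc', ?_⟩
    rw [add_sub_add_comm]
    refine (eLpNorm_ptNorm_add_le Fact.out (Submodule.sub_mem _ hη.1 hθ).1
      (Submodule.sub_mem _ hη'.1 hθ').1).trans ?_
    exact (add_le_add hle hle').trans_eq (ENNReal.add_halves ε)

/-- `approxForms` is closed in `L^p`. -/
theorem mem_approxForms_of_forall {η : Form d M} (hη : η ∈ lpForms d M p)
    (h : ∀ ε : ℝ≥0∞, ε ≠ 0 → ∃ θ ∈ approxForms d M p,
      eLpNorm (ptNorm (η - θ)) p (riemVolume d M) ≤ ε) : η ∈ approxForms d M p := by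
  refine ⟨hη, fun ε hε => ?_⟩
  obtain ⟨θ, hθ, hle⟩ := h (ε / 2) (ENNReal.half_pos hε).ne'
  obtain ⟨θ', hθ', hs', hc', hle'⟩ := hθ.2 (ε / 2) (ENNReal.half_pos hε).ne'
  refine ⟨θ', hθ', hs', hc', ?_⟩
  rw [← sub_add_sub_cancel η θ θ']
  refine (eLpNorm_ptNorm_add_le Fact.out (Submodule.sub_mem _ hη hθ.1).1
    (Submodule.sub_mem _ hθ.1 hθ').1).trans ?_
  exact (add_le_add hle hle').trans_eq (ENNReal.add_halves ε)

theorem mulOp_sub (g h : M → ℂ) (η : Form d M) : mulOp g η - mulOp h η = mulOp (g - h) η := by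
  funext k x
  exact (sub_smul (M := CForm (TSpace d x) k) (g x) (h x) (η k x)).symm

theorem ptNorm_eq_zero {η : Form d M} {x : M} (h : ∀ k, η k x = 0) : ptNorm η x = 0 := by
  have h0 : (fun k => η k x) = fun k => (0 : CForm (TSpace d x) k) := funext h
  rw [ptNorm, h0]
  simp [normGraded, normSqForm]

theorem IsSmooth.mem_lpForms [T2Space M] {θ : Form d M} (hs : IsSmooth θ)
    (hc : IsCompactlySupported θ) : θ ∈ lpForms d M p := by
  obtain ⟨K, hK, h⟩ := hc
  refine ⟨hs.isMeas, (hs.continuous_ptNorm.memLp_of_hasCompactSupport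
    (HasCompactSupport.intro hK fun x hx => ptNorm_eq_zero (h x hx))).eLpNorm_lt_top⟩

theorem IsSmooth.exists_ptNorm_le {θ : Form d M} (hs : IsSmooth θ)
    (hc : IsCompactlySupported θ) : ∃ B : ℝ, ∀ x, ptNorm θ x ≤ B := by
  obtain ⟨K, hK, h⟩ := hc
  obtain ⟨B, hB⟩ := hK.exists_bound_of_continuousOn hs.continuous_ptNorm.continuousOn
  refine ⟨max B 0, fun x => ?_⟩
  by_cases hx : x ∈ K
  · exact ((Real.le_norm_self _).trans (hB x hx)).trans (le_max_left _ _)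
  · rw [ptNorm_eq_zero (h x hx)]
    exact le_max_right _ _

/-- A continuous function is a uniform limit of smooth functions. -/
theorem mulOp_mem_approxForms_of_continuous [T2Space M] {θ : Form d M} (hs : IsSmooth θ)
    (hc : IsCompactlySupported θ) {g : M → ℂ} (hg : Continuous g) :
    mulOp g θ ∈ approxForms d M p := by
  have := Manifold.locallyCompact_of_finiteDimensional (𝓡 d) (M := M)
  have hθ : θ ∈ lpForms d M p := hs.mem_lpForms hc
  have hmem (g : M → ℂ) (hg : Continuous g) : mulOp g θ ∈ lpForms d M p := by
    obtain ⟨K, hK, hz⟩ := id hc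
    obtain ⟨B, hB⟩ := hK.exists_bound_of_continuousOn hg.continuousOn
    refine ⟨hs.isMeas.mulOp hg.measurable.aemeasurable,
      (eLpNorm_ptNorm_le_mul (θ := θ) (c := B) p (ae_of_all _ fun x => ?_)).trans_lt
        (ENNReal.mul_lt_top ENNReal.ofReal_lt_top hθ.2)⟩
    rw [ptNorm_mulOp]
    by_cases hx : x ∈ K
    · exact mul_le_mul_of_nonneg_right (hB x hx) (ptNorm_nonneg _ _)
    · rw [ptNorm_eq_zero (hz x hx), mul_zero, mul_zero]
  refine ⟨hmem g hg, fun ε hε => ?_⟩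
  obtain ⟨δ, hδ, hle⟩ := ENNReal.exists_nnreal_pos_mul_lt hθ.2.ne hε
  obtain ⟨g', hg', -⟩ := hg.exists_contMDiff_approx (𝓡 d) ⊤
    (continuous_const (y := (δ : ℝ))) (fun _ => hδ)
  refine ⟨mulOp g' θ, hmem g' g'.contMDiff.continuous, hs.mulOp g'.contMDiff, hc.mulOp _, ?_⟩
  rw [mulOp_sub]
  refine (eLpNorm_ptNorm_le_mul (θ := θ) (c := δ) p (ae_of_all _ fun x => ?_)).trans ?_
  · rw [ptNorm_mulOp]
    refine mul_le_mul_of_nonneg_right ?_ (ptNorm_nonneg _ _)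
    rw [Pi.sub_apply, ← dist_eq_norm, dist_comm]
    exact (hg' x).le
  · rw [ENNReal.ofReal_coe_nnreal]
    exact hle.le

/-- The product of an `L^p`-function with a smooth form of compact support is a limit of such
forms. -/
theorem mulOp_mem_approxForms_of_memLp [T2Space M] (hp : p ≠ ⊤) {θ : Form d M} (hs : IsSmooth θ)
    (hc : IsCompactlySupported θ) {h : M → ℂ} (hh : MemLp h p (riemVolume d M)) :
    mulOp h θ ∈ approxForms d M p := by
  have := Manifold.locallyCompact_of_finiteDimensional (𝓡 d) (M := M)
  obtain ⟨B, hB⟩ := hs.exists_ptNorm_le hc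
  have hbound (g : M → ℂ) : eLpNorm (ptNorm (mulOp g θ)) p (riemVolume d M) ≤
      ENNReal.ofReal B * eLpNorm g p (riemVolume d M) := by
    refine eLpNorm_le_mul_eLpNorm_of_ae_le_mul (ae_of_all _ fun x => ?_) p
    rw [Real.norm_of_nonneg (ptNorm_nonneg _ _), ptNorm_mulOp, mul_comm]
    exact mul_le_mul_of_nonneg_right (hB x) (norm_nonneg _)
  refine mem_approxForms_of_forall ⟨hs.isMeas.mulOp hh.1.aemeasurable,
    (hbound h).trans_lt (ENNReal.mul_lt_top ENNReal.ofReal_lt_top hh.2)⟩ fun ε hε => ?_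
  obtain ⟨δ, hδ, hle⟩ := ENNReal.exists_nnreal_pos_mul_lt
    (ENNReal.ofReal_ne_top (r := B)) hε
  obtain ⟨g, -, hg, hgc, -⟩ := hh.exists_hasCompactSupport_eLpNorm_sub_le hp
    (ε := (δ : ℝ≥0∞)) (by exact_mod_cast hδ.ne')
  refine ⟨mulOp g θ, mulOp_mem_approxForms_of_continuous hs hc hgc, ?_⟩
  rw [mulOp_sub]
  refine (hbound _).trans (le_trans ?_ hle.le)
  rw [mul_comm]
  gcongr

theorem isCompactlySupported_single {k : ℕ} {χ : M → ℂ} (hχ : HasCompactSupport χ)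
    (κ : KForm d M k) :
    IsCompactlySupported (Pi.single k (fun x => χ x • κ x) : Form d M) := by
  refine ⟨tsupport χ, hχ, fun x hx m => ?_⟩
  by_cases hm : m = k
  · subst hm
    rw [Pi.single_eq_same, image_eq_zero_of_notMem_tsupport hx]
    exact zero_smul ℂ (κ x)
  · rw [Pi.single_eq_of_ne hm]
    rfl

theorem eq_zero_of_lt {k : ℕ} (hk : d < k) {x : M} (α : CForm (TSpace d x) k) : α = 0 :=
  cform_eq_zero_of_finrank_lt (V := TSpace d x)
    (by rwa [(Fact.out : Module.finrank ℝ (TSpace d x) = d)]) α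

/-- In the domain of a chart, where a cut-off function `χ` is equal to `1`, a form is the
combination of coordinate forms. -/
theorem mulOp_indicator_eq_sum (x₀ : M) {χ : M → ℂ} {A : Set M}
    (hA : A ⊆ (extChartAt (𝓡 d) x₀).source) (hχ : ∀ x ∈ A, χ x = 1) (η : Form d M) :
    mulOp (A.indicator fun _ => 1) η = ∑ k ∈ Finset.range (d + 1), ∑ t : Fin k → Fin d,
      mulOp (A.indicator fun x => η k x fun j => coordField x₀ (t j) x)
        (Pi.single k fun x => χ x • chartForm x₀ t x) := by
  funext m x
  have happ : (∑ k ∈ Finset.range (d + 1), ∑ t : Fin k → Fin d,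
      mulOp (A.indicator fun x => η k x fun j => coordField x₀ (t j) x)
        (Pi.single k fun x => χ x • chartForm x₀ t x)) m x =
      ∑ k ∈ Finset.range (d + 1), ∑ t : Fin k → Fin d,
        (A.indicator (fun x => η k x fun j => coordField x₀ (t j) x) x) •
          (Pi.single k (fun x => χ x • chartForm x₀ t x) : Form d M) m x := by
    simp only [Finset.sum_apply]
    rfl
  rcases lt_or_ge d m with hm | hm
  · exact (eq_zero_of_lt hm _).trans (eq_zero_of_lt hm _).symm
  rw [happ, Finset.sum_eq_single_of_mem m (Finset.mem_range.2 (Nat.lt_succ_of_le hm))]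
  · by_cases hx : x ∈ A
    · refine Eq.trans ?_ ((eq_sum_chartForm x₀ (hA hx) (η m)).trans
        (Finset.sum_congr rfl fun t _ => ?_))
      · change (A.indicator (fun _ => (1 : ℂ)) x) • η m x = η m x
        rw [indicator_of_mem hx, one_smul]
      · rw [indicator_of_mem hx, Pi.single_eq_same, hχ x hx, one_smul]
    · refine Eq.trans ?_ (Finset.sum_eq_zero fun t _ => ?_).symm
      · change (A.indicator (fun _ => (1 : ℂ)) x) • η m x = 0
        rw [indicator_of_notMem hx]
        exact zero_smul ℂ (η m x)
      · rw [indicator_of_notMem hx]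
        exact zero_smul ℂ ((Pi.single m (fun x => χ x • chartForm x₀ t x) : Form d M) m x)
  · intro k _ hk
    refine Finset.sum_eq_zero fun t _ => ?_
    rw [Pi.single_eq_of_ne hk.symm]
    exact smul_zero (A := CForm (TSpace d x) m)
      (A.indicator (fun x => η k x fun j => coordField x₀ (t j) x) x)

/-- Every point has a neighbourhood `U` such that the restriction of a given `L^p`-form to any
measurable subset of `U` is a limit of smooth forms: it is a combination of smooth forms supported
in a chart, with `L^p`-functions as coefficients. -/
theorem exists_nhds_mulOp_indicator_mem [T2Space M] (hp : p ≠ ⊤) {η : Form d M}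
    (hη : η ∈ lpForms d M p) (x₀ : M) : ∃ U ∈ 𝓝 x₀, MeasurableSet U ∧
      ∀ A ⊆ U, MeasurableSet A → mulOp (A.indicator fun _ => 1) η ∈ approxForms d M p := by
  -- `U` is the set where a bump function at `x₀` takes the value `1`
  obtain ⟨f⟩ : Nonempty (SmoothBumpFunction (𝓡 d) x₀) := inferInstance
  set χ : M → ℂ := fun x => (f x : ℂ) with hχ
  have hχs : ContMDiff (𝓡 d) 𝓘(ℝ, ℂ) ∞ χ :=
    Complex.ofRealCLM.contDiff.contMDiff.comp f.contMDiff
  have hχc : HasCompactSupport χ := f.hasCompactSupport.comp_left Complex.ofReal_zero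
  have hts : tsupport χ ⊆ (extChartAt (𝓡 d) x₀).source :=
    (closure_mono (Function.support_comp_subset Complex.ofReal_zero f)).trans
      f.tsupport_subset_extChartAt_source
  refine ⟨{x | χ x = 1}, ?_, (isClosed_eq hχs.continuous continuous_const).measurableSet,
    fun A hA hAm => ?_⟩
  · filter_upwards [f.eventuallyEq_one] with x hx
    simp [hχ, hx]
  have hAts : A ⊆ tsupport χ := fun x hx => subset_tsupport χ (by
    rw [Function.mem_support, hA hx]; exact one_ne_zero)
  rw [mulOp_indicator_eq_sum x₀ (hAts.trans hts) (fun x hx => hA hx) η]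
  refine sum_mem fun k hk => sum_mem fun t _ => ?_
  refine mulOp_mem_approxForms_of_memLp hp
    (isSmooth_single fun x₁ => contDiffOn_inChart_smul_chartForm x₀ x₁ hχs hts t)
    (isCompactlySupported_single hχc _) ?_
  obtain ⟨c, hc, hle⟩ := exists_norm_component_le x₀ hχc hts
    (Nat.lt_succ_iff.1 (Finset.mem_range.1 hk)) t
  refine ⟨((aemeasurable_indicator_iff hAm).2 ((hη.1 k x₀ t).mono_measure
    (Measure.restrict_mono (hAts.trans hts) le_rfl))).aestronglyMeasurable,
    (eLpNorm_le_mul_eLpNorm_of_ae_le_mul (g := ptNorm η) (c := c) (ae_of_all _ fun x => ?_)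
      p).trans_lt (ENNReal.mul_lt_top ENNReal.ofReal_lt_top hη.2)⟩
  rw [Real.norm_of_nonneg (ptNorm_nonneg η x)]
  by_cases hx : x ∈ A
  · rw [indicator_of_mem hx]
    exact hle η x (hAts hx)
  · rw [indicator_of_notMem hx, norm_zero]
    exact mul_nonneg hc (ptNorm_nonneg _ _)

/-- A compact set is covered by finitely many of the neighbourhoods of
`exists_nhds_mulOp_indicator_mem`. -/
theorem mulOp_indicator_mem_of_isCompact [T2Space M] (hp : p ≠ ⊤) {η : Form d M}
    (hη : η ∈ lpForms d M p) {K : Set M} (hK : IsCompact K) :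
    mulOp (K.indicator fun _ => 1) η ∈ approxForms d M p := by
  have h : ∃ U, K ⊆ U ∧ MeasurableSet U ∧
      ∀ A ⊆ U, MeasurableSet A → mulOp (A.indicator fun _ => 1) η ∈ approxForms d M p := by
    refine hK.induction_on (p := fun s => ∃ U, s ⊆ U ∧ MeasurableSet U ∧
      ∀ A ⊆ U, MeasurableSet A → mulOp (A.indicator fun _ => 1) η ∈ approxForms d M p)
      ?_ ?_ ?_ ?_
    · refine ⟨∅, Subset.rfl, MeasurableSet.empty, fun A hA _ => ?_⟩
      rw [subset_empty_iff.1 hA, indicator_empty]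
      convert zero_mem (approxForms d M p)
      funext k x
      exact zero_smul ℂ (η k x)
    · rintro s t hst ⟨U, hU, h⟩
      exact ⟨U, hst.trans hU, h⟩
    · rintro s t ⟨U, hsU, hU, h⟩ ⟨W, htW, hW, h'⟩
      refine ⟨U ∪ W, union_subset_union hsU htW, hU.union hW, fun A hA hAm => ?_⟩
      have hsplit : mulOp (A.indicator fun _ => 1) η =
          mulOp ((A ∩ U).indicator fun _ => 1) η + mulOp ((A \ U).indicator fun _ => 1) η := by
        funext k x
        refine Eq.trans ?_ (add_smul _ _ (η k x))
        change (A.indicator (fun _ => (1 : ℂ)) x) • η k x = _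
        congr 1
        by_cases hx : x ∈ A <;> by_cases hx' : x ∈ U <;> simp [hx, hx']
      rw [hsplit]
      exact add_mem (h _ inter_subset_right (hAm.inter hU))
        (h' _ (fun x hx => (hA hx.1).resolve_left hx.2) (hAm.diff hU))
    · intro x _
      obtain ⟨U, hU, hUm, h⟩ := exists_nhds_mulOp_indicator_mem hp hη x
      exact ⟨U, mem_nhdsWithin_of_mem_nhds hU, U, Subset.rfl, hUm, h⟩
  obtain ⟨U, hKU, -, h⟩ := h
  exact h K hKU hK.isClosed.measurableSet

/-- The smooth forms with compact support are dense in `L^p`. -/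
theorem mem_approxForms [T2Space M] (hp : p ≠ ⊤) {η : Form d M} (hη : η ∈ lpForms d M p) :
    η ∈ approxForms d M p := by
  have := Manifold.locallyCompact_of_finiteDimensional (𝓡 d) (M := M)
  refine mem_approxForms_of_forall hη fun ε hε => ?_
  have hmem : MemLp (ptNorm η) p (riemVolume d M) :=
    ⟨(aemeasurable_ptNorm hη.1).aestronglyMeasurable, hη.2⟩
  -- outside of the support of `g`, the norm of `η` is `|η| - g`, so that `η` is small there
  obtain ⟨g, hg, hle, -, -⟩ := hmem.exists_hasCompactSupport_eLpNorm_sub_le hp hε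
  refine ⟨_, mulOp_indicator_mem_of_isCompact hp hη hg, (eLpNorm_mono fun x => ?_).trans hle⟩
  have hsub : η - mulOp ((tsupport g).indicator fun _ => 1) η =
      mulOp ((tsupport g)ᶜ.indicator fun _ => 1) η := by
    have h1 : η = mulOp (fun _ => 1) η := by
      funext k x
      exact (one_smul ℂ (η k x)).symm
    conv_lhs => rw [h1]
    rw [show mulOp ((tsupport g).indicator fun _ => 1) (mulOp (fun _ => (1 : ℂ)) η) =
      mulOp ((tsupport g).indicator fun _ => 1) η by rw [← h1], mulOp_sub]
    congr 1
    funext x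
    by_cases hx : x ∈ tsupport g <;> simp [hx]
  rw [hsub, Real.norm_of_nonneg (ptNorm_nonneg _ _), ptNorm_mulOp]
  by_cases hx : x ∈ tsupport g
  · simp [hx]
  · simp [hx, image_eq_zero_of_notMem_tsupport hx, abs_of_nonneg (ptNorm_nonneg η x)]

theorem toLp_mem_closure [T2Space M] (hp : p ≠ ⊤) {η : Form d M} (hη : η ∈ lpForms d M p) :
    toLp η hη ∈ closure {ξ : LpForms d M p | ∃ (θ : Form d M) (h : θ ∈ lpForms d M p),
      IsSmooth θ ∧ IsCompactlySupported θ ∧ ξ = toLp θ h} := by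
  refine Metric.mem_closure_iff.2 fun ε hε => ?_
  obtain ⟨θ, hθ, hs, hc, hle⟩ := (mem_approxForms hp hη).2 (ENNReal.ofReal (ε / 2))
    (ENNReal.ofReal_pos.2 (half_pos hε)).ne'
  refine ⟨toLp θ hθ, ⟨θ, hθ, hs, hc, rfl⟩, ?_⟩
  rw [dist_eq_norm, toLp_sub, norm_toLp]
  exact (ENNReal.toReal_le_of_le_ofReal (half_pos hε).le hle).trans_lt (half_lt_self hε)

/-- Bounded operators on `L^p` are determined by their values on the smooth forms with compact
support. -/
theorem ext_of_smooth [T2Space M] (hp : p ≠ ⊤) {C C' : LpForms d M p →L[ℂ] LpForms d M p}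
    (h : ∀ (θ : Form d M) (hθ : θ ∈ lpForms d M p), IsSmooth θ → IsCompactlySupported θ →
      C (toLp θ hθ) = C' (toLp θ hθ)) : C = C' := by
  ext1 ξ
  obtain ⟨η, hη, rfl⟩ := toLp_surjective ξ
  refine closure_minimal (t := {ξ | C ξ = C' ξ}) ?_ (isClosed_eq C.continuous C'.continuous)
    (toLp_mem_closure hp hη)
  rintro _ ⟨θ, hθ, hs, hc, rfl⟩
  exact h θ hθ hs hc

end Density

end HodgeDirac

end

theorem mainTheorem9 {d : ℕ} {M : Type*} [TopologicalSpace M] [T2Space M]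
    [SecondCountableTopology M] [ChartedSpace (EuclideanSpace ℝ (Fin d)) M]
    [IsManifold (𝓡 d) ∞ M] [MeasurableSpace M] [BorelSpace M]
    [RiemannianBundle (fun x : M => TangentSpace (𝓡 d) x)]
    [IsContMDiffRiemannianBundle (𝓡 d) ∞ (EuclideanSpace ℝ (Fin d))
      (fun x : M => TangentSpace (𝓡 d) x)]
    (o : HodgeDirac.TangentOrientation d M) (f : M → ℂ) (hf : ContMDiff (𝓡 d) 𝓘(ℝ, ℂ) ∞ f) :
    (∀ η : HodgeDirac.Form d M, HodgeDirac.IsSmooth η →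
      HodgeDirac.commutator o f η = HodgeDirac.wedgeDiff f η - HodgeDirac.interiorGrad f η) ∧
    ∀ (p : ℝ≥0∞) [Fact (1 ≤ p)], p ≠ ⊤ → HodgeDirac.supNormDiff (d := d) f < ⊤ →
      ∃ C : HodgeDirac.LpForms d M p →L[ℂ] HodgeDirac.LpForms d M p,
        (∀ (η : HodgeDirac.Form d M) (hη : η ∈ HodgeDirac.lpForms d M p), HodgeDirac.IsSmooth η →
          ∃ h : HodgeDirac.commutator o f η ∈ HodgeDirac.lpForms d M p,
            C (HodgeDirac.toLp η hη) = HodgeDirac.toLp (HodgeDirac.commutator o f η) h) ∧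
        (∀ C' : HodgeDirac.LpForms d M p →L[ℂ] HodgeDirac.LpForms d M p,
          (∀ (η : HodgeDirac.Form d M) (hη : η ∈ HodgeDirac.lpForms d M p),
            HodgeDirac.IsSmooth η → HodgeDirac.IsCompactlySupported η →
              ∃ h : HodgeDirac.commutator o f η ∈ HodgeDirac.lpForms d M p,
                C' (HodgeDirac.toLp η hη) = HodgeDirac.toLp (HodgeDirac.commutator o f η) h) →
          C' = C) ∧
        ((∀ x, (f x).im = 0) → ‖C‖ = (HodgeDirac.supNormDiff (d := d) f).toReal) := by
  refine ⟨fun η hη => HodgeDirac.commutator_eq o hf hη, fun p _ hp hS => ?_⟩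
  have hC (η : HodgeDirac.Form d M) (hη : η ∈ HodgeDirac.lpForms d M p)
      (hs : HodgeDirac.IsSmooth η) : ∃ h : HodgeDirac.commutator o f η ∈ HodgeDirac.lpForms d M p,
        HodgeDirac.gradCliffLp f hf hS (HodgeDirac.toLp η hη) =
          HodgeDirac.toLp (HodgeDirac.commutator o f η) h := by
    have heq : HodgeDirac.commutator o f η = HodgeDirac.gradCliff f η :=
      HodgeDirac.commutator_eq o hf hs
    rw [heq]
    exact ⟨HodgeDirac.gradCliff_mem_lpForms hf hS hη, HodgeDirac.gradCliffLp_toLp hf hS hη⟩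
  refine ⟨HodgeDirac.gradCliffLp f hf hS, hC, fun C' hC' => ?_, fun hre =>
    HodgeDirac.norm_gradCliffLp_of_real hf hre hp hS⟩
  refine HodgeDirac.ext_of_smooth hp fun θ hθ hs hc => ?_
  obtain ⟨h, h1⟩ := hC' θ hθ hs hc
  obtain ⟨h', h2⟩ := hC θ hθ hs
  exact h1.trans h2.symm
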